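/- Let $X$ be a compact connected Riemann surface (of any genus), $p_M\colon M\to X$ a holomorphic line bundle with $\deg M>0$, $n\ge 1$, and let $\underline a=(a_2,a_4,\dots,a_{2n})\in B_{2n}(X,M)=\bigoplus_{i=1}^n H^0(X,M^{2i})$; put $a_0=1$. Let $\eta$ be the tautological section of $p_M^*M$ and let $$\Sigma=\{\eta^{2n}+a_2\eta^{2n-2}+\dots+a_{2n}=0\}\subset \mathrm{Tot}(M)$$ be the spectral curve (the possibly non-reduced curve defined by this equation), with the involution $\sigma$ given by multiplication by $-1$ on the fibres of $M$. Let $\Sigma/\sigma$ be the quotient curve, whose structure sheaf is the sheaf $\mathcal O_\Sigma^\sigma$ of $\sigma$-invariant functions. The point $\underline a$ is called of $\mathfrak{sl}(2)$-type if $\Sigma/\sigma$ is smooth. The number of sheets of $\Sigma\to X$ meeting at $\lambda\in\Sigma\cap M_x$ is the multiplicity of $\lambda$ as a root of $T^{2n}+a_2(x)T^{2n-2}+\dots+a_{2n}(x)$. (1) $\underline a$ is of $\mathfrak{sl}(2)$-type if and only if every singular point of $\Sigma$ lies on the zero section of $M$ and exactly two sheets meet there. (2) If $\underline a$ is of $\mathfrak{sl}(2)$-type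 and $(n,\underline a)\neq(1,0)$, then every singular point of $\Sigma$ is of type $A_k$ for some $k\ge1$, i.e. the local ring of $\Sigma$ there is isomorphic to that of the plane curve $y^2=x^{k+1}$ at the origin. (3) Let $\mathrm{disc}^{\mathrm{red}}_{\mathfrak{sp}}(\underline a)\in H^0(X,M^{2n(n-1)})$ be the reduced discriminant, i.e. $\prod_{i<j}(h_i+h_j)^2(h_i-h_j)^2$ expressed through the coefficients of $\prod_i(T-h_i)(T+h_i)=T^{2n}+a_2T^{2n-2}+\dots+a_{2n}$. If all its zeros are simple (in particular it does not vanish identically) and $a_{2n-2}$ and $a_{2n}$ have no common zero, then $\underline a$ is of $\mathfrak{sl}(2)$-type. -/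

import Mathlib

open Bundle Filter Topology Polynomial TensorProduct
open scoped Manifold ContDiff

/-! ### Analytic local rings of plane-type curves `{q = 0}` -/

section LocalRings

variable {E : Type*} [NormedAddCommGroup E] [NormedSpace ℂ E]
  {H : Type*} [TopologicalSpace H] (I : ModelWithCorners ℂ E H)
  {N : Type*} [TopologicalSpace N] [ChartedSpace H N]

/-- The `ℂ`-algebra of functions on `N` that are holomorphic near every point of `S`. -/
def holAlg (S : Set N) : Subalgebra ℂ (N → ℂ) where
  carrier := {f | ∀ p ∈ S, ContMDiffAt I 𝓘(ℂ) ω f p}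
  mul_mem' hf hg := fun p hp => (hf p hp).mul (hg p hp)
  add_mem' hf hg := fun p hp => (hf p hp).add (hg p hp)
  algebraMap_mem' _ := fun _ _ => contMDiffAt_const

/-- The functions, holomorphic near `S`, whose germ along `S` is a holomorphic multiple of `q`. -/
def germIdeal (S : Set N) (q : N → ℂ) : Ideal (holAlg I S) where
  carrier := {f | ∃ h : holAlg I S, (f : N → ℂ) =ᶠ[𝓝ˢ S] (h : N → ℂ) * q}
  zero_mem' := ⟨0, by simp⟩
  add_mem' := by
    rintro f g ⟨h, hh⟩ ⟨k, hk⟩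
    refine ⟨h + k, ?_⟩
    filter_upwards [hh, hk] with y h1 h2
    simp [h1, h2, add_mul]
  smul_mem' := by
    rintro c f ⟨h, hh⟩
    refine ⟨c * h, ?_⟩
    filter_upwards [hh] with y h1
    simp [h1, mul_assoc]

/-- The ring `𝒪_{N,S} / (q)` of germs along `S` of holomorphic functions modulo `q`.
For `S = {p}` it is the analytic local ring at `p` of the (possibly non-reduced) analytic
hypersurface `{q = 0}`. -/
def HypersurfaceRing (S : Set N) (q : N → ℂ) : Type _ := holAlg I S ⧸ germIdeal I S q

noncomputable instance (S : Set N) (q : N → ℂ) : CommRing (HypersurfaceRing I S q) :=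
  Ideal.Quotient.commRing (germIdeal I S q)

noncomputable instance (S : Set N) (q : N → ℂ) : Algebra ℂ (HypersurfaceRing I S q) :=
  Ideal.Quotient.algebra ℂ

variable {I} in
/-- The endomorphism of `𝒪_{N,S} / (q)` induced by an endomorphism of `𝒪_{N,S}` preserving `(q)`. -/
noncomputable def HypersurfaceRing.map {S : Set N} {q : N → ℂ} (φ : holAlg I S →ₐ[ℂ] holAlg I S)
    (hφ : germIdeal I S q ≤ (germIdeal I S q).comap φ) :
    HypersurfaceRing I S q →ₐ[ℂ] HypersurfaceRing I S q :=
  Ideal.quotientMapₐ (germIdeal I S q) φ hφ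

end LocalRings

/-- A one-dimensional local ring is regular iff it is a discrete valuation ring; a point of a
complex curve is smooth iff its local ring is such a ring. -/
def IsSmoothCurveRing (R : Type*) [CommRing R] : Prop :=
  ∃ _ : IsDomain R, IsDiscreteValuationRing R

/-- The local ring at the origin of the plane curve `y ^ 2 = x ^ (k + 1)` (with `x = v.1`,
`y = v.2`): the singularity `A_k`. -/
abbrev AkRing (k : ℕ) : Type :=
  HypersurfaceRing 𝓘(ℂ, ℂ × ℂ) {(0 : ℂ × ℂ)} (fun v => v.2 ^ 2 - v.1 ^ (k + 1))

/-! ### The reduced `sp(2n)`-discriminant as an invariant polynomial -/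

/-- `η ^ n + c 0 η ^ (n-1) + ⋯ + c (n-1)`, so that `(quotPoly c)(T ^ 2)` is the characteristic
polynomial `T ^ (2n) + c 0 T ^ (2n-2) + ⋯ + c (n-1)`. -/
noncomputable def quotPoly {n : ℕ} (c : Fin n → ℂ) : ℂ[X] :=
  X ^ n + ∑ j : Fin n, C (c j) * X ^ (n - (j + 1))

/-- The reduced `sp(2n, ℂ)`-discriminant in terms of the coefficients of the characteristic
polynomial; by `redDisc_eq` it is the product over the short roots. -/
noncomputable def redDisc {n : ℕ} (c : Fin n → ℂ) : ℂ := (quotPoly c).discr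

/-- If the characteristic polynomial is `∏ (T - h i) (T + h i)`, the reduced discriminant is the
product over `i < j` of `-(h i + h j) ^ 2` and `-(h i - h j) ^ 2`. -/
theorem redDisc_eq {n : ℕ} (c h : Fin n → ℂ)
    (hc : (quotPoly c).comp (X ^ 2) = ∏ i, ((X - C (h i)) * (X + C (h i)))) :
    redDisc c = ∏ i, ∏ j ∈ Finset.Ioi i, (-(h i + h j) ^ 2) * (-(h i - h j) ^ 2) := by
  have hmon : (quotPoly c).Monic := by
    unfold quotPoly
    refine monic_X_pow_add ((degree_sum_le _ _).trans_lt ?_)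
    refine (Finset.sup_lt_iff (WithBot.bot_lt_coe n)).2 ?_
    intro j _
    refine (degree_C_mul_X_pow_le _ _).trans_lt ?_
    exact Nat.cast_lt.2 (by omega : n - ((j : ℕ) + 1) < n)
  have hq : quotPoly c = ∏ i, (X - C (h i ^ 2)) := by
    have h2 : (∏ i, (X - C (h i ^ 2)) : ℂ[X]).comp (X ^ 2) = (quotPoly c).comp (X ^ 2) := by
      rw [hc, Polynomial.prod_comp]
      refine Finset.prod_congr rfl fun i _ => ?_
      simp
      ring
    have := Polynomial.expand_injective (R := ℂ) (n := 2) two_pos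
    apply this
    rw [expand_eq_comp_X_pow, expand_eq_comp_X_pow, h2]
  have hdeg : (quotPoly c).natDegree = n := by
    rw [hq, natDegree_prod_of_monic _ _ fun i _ => monic_X_sub_C _]
    simp [-map_pow]
  rcases Nat.eq_zero_or_pos n with rfl | hn
  · have h1 : quotPoly c = C 1 := by simp [quotPoly]
    simp [redDisc, h1, -map_one]
  have hres := resultant_deriv (f := quotPoly c) (natDegree_pos_iff_degree_pos.1 (by omega))
  have hev : resultant (quotPoly c) (quotPoly c).derivative (quotPoly c).natDegree
      ((quotPoly c).natDegree - 1) = ∏ i, ∏ j ∈ Finset.univ.erase i, (h i ^ 2 - h j ^ 2) := by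
    have := resultant_prod_left Finset.univ (fun i => X - C (h i ^ 2)) (quotPoly c).derivative
      ((quotPoly c).natDegree - 1) (by simp [-map_pow]) (natDegree_derivative_le _)
    rw [← hq] at this
    rw [this]
    refine Finset.prod_congr rfl fun i _ => ?_
    rw [natDegree_X_sub_C, resultant_X_sub_C_left _ _ _ (natDegree_derivative_le _), hq]
    rw [derivative_prod_finset, eval_finsetSum, Finset.sum_eq_single i]
    · simp [eval_prod, -map_pow]
    · intro b _ hb
      simp only [eval_mul, eval_prod]
      rw [Finset.prod_eq_zero (i := i) (by simp [hb.symm]) (by simp), zero_mul]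
    · simp
  rw [hev, hmon.leadingCoeff, hdeg, mul_one] at hres
  have hsplit : ∀ i : Fin n, Finset.univ.erase i = Finset.Ioi i ∪ Finset.Iio i := by
    intro i
    ext j
    simp [lt_or_lt_iff_ne, eq_comm]
  have hswap : ∏ i : Fin n, ∏ j ∈ Finset.Iio i, (h i ^ 2 - h j ^ 2) =
      ∏ i : Fin n, ∏ j ∈ Finset.Ioi i, (h j ^ 2 - h i ^ 2) :=
    Finset.prod_comm' (by simp)
  have hcard : ∑ i : Fin n, (Finset.Ioi i).card = n * (n - 1) / 2 := by
    simp only [Fin.card_Ioi]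
    rw [← Finset.sum_range_id, Fin.sum_univ_eq_sum_range (fun i => n - 1 - i) n,
      Finset.sum_range_reflect (fun i => i) n]
  have hprod : ∏ i, ∏ j ∈ Finset.univ.erase i, (h i ^ 2 - h j ^ 2) =
      (-1) ^ (n * (n - 1) / 2) *
        ∏ i, ∏ j ∈ Finset.Ioi i, (-(h i + h j) ^ 2) * (-(h i - h j) ^ 2) := by
    have h0 : ∏ i : Fin n, ∏ j ∈ Finset.univ.erase i, (h i ^ 2 - h j ^ 2) =
        ∏ i : Fin n, ((∏ j ∈ Finset.Ioi i, (h i ^ 2 - h j ^ 2)) *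
          ∏ j ∈ Finset.Iio i, (h i ^ 2 - h j ^ 2)) := by
      refine Finset.prod_congr rfl fun i _ => ?_
      rw [hsplit, Finset.prod_union]
      exact Finset.disjoint_left.2 fun j hj hj' =>
        lt_asymm (Finset.mem_Ioi.1 hj) (Finset.mem_Iio.1 hj')
    rw [h0, Finset.prod_mul_distrib, hswap, ← hcard, ← Finset.prod_pow_eq_pow_sum,
      ← Finset.prod_mul_distrib, ← Finset.prod_mul_distrib]
    refine Finset.prod_congr rfl fun i _ => ?_
    rw [← Finset.prod_const, ← Finset.prod_mul_distrib, ← Finset.prod_mul_distrib]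
    exact Finset.prod_congr rfl fun j _ => by ring
  rw [hprod] at hres
  exact (mul_left_cancel₀ (pow_ne_zero _ (by norm_num)) hres).symm

/-! ### Line bundles, their powers, degree -/

section LineBundle

set_option linter.unusedSectionVars false

variable {X : Type*} [TopologicalSpace X] [ChartedSpace ℂ X]
  (M : X → Type*) [TopologicalSpace (TotalSpace ℂ M)] [∀ x, TopologicalSpace (M x)]
  [∀ x, AddCommGroup (M x)] [∀ x, Module ℂ (M x)] [FiberBundle ℂ M] [VectorBundle ℂ ℂ M]

/-- The fibre coordinate on `Tot M` in the preferred trivialization around `x`. -/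
noncomputable def fibreCoord (x : X) (p : TotalSpace ℂ M) : ℂ :=
  (trivializationAt ℂ M x).linearMapAt ℂ p.1 p.2

/-- The fibre coordinate on `M ^ k` at `y`, in the trivialization of `M ^ k` induced by the
preferred trivialization of `M` around `x`: it sends `v₁ ⊗ ⋯ ⊗ vₖ` to the product of the
coordinates of the `vᵢ`. -/
noncomputable def powCoord (x : X) (k : ℕ) (y : X) : (⨂[ℂ]^k (M y)) →ₗ[ℂ] ℂ :=
  PiTensorProduct.lift ((MultilinearMap.mkPiAlgebra ℂ (Fin k) ℂ).compLinearMap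
    fun _ => (trivializationAt ℂ M x).linearMapAt ℂ y)

/-- `H⁰(X, M ^ k)`. -/
noncomputable def holSections (k : ℕ) : Submodule ℂ (∀ x, ⨂[ℂ]^k (M x)) where
  carrier := {s | ∀ x, ContMDiffAt 𝓘(ℂ) 𝓘(ℂ) ω (fun y => powCoord M x k y (s y)) x}
  zero_mem' := fun x => by simpa using contMDiffAt_const
  add_mem' hf hg := fun x => by simpa using! (hf x).add (hg x)
  smul_mem' c f hf := fun x => by
    simpa using! (contMDiffAt_const (c := c)).mul (hf x)

/-- A complex function on `X` read in the preferred chart around `x`. -/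
noncomputable def inChart (f : X → ℂ) (x : X) : ℂ → ℂ := f ∘ (chartAt ℂ x).symm

/-- The order at `x` of a (meromorphic) section `s` of `M`. -/
noncomputable def sectionOrder (s : ∀ x, M x) (x : X) : WithTop ℤ :=
  meromorphicOrderAt (inChart (fun y => fibreCoord M x ⟨y, s y⟩) x) (chartAt ℂ x x)

/-- `s` is a meromorphic section of `M` that vanishes identically on no open set. -/
def IsNonzeroMeromorphicSection (s : ∀ x, M x) : Prop :=
  ∀ x, MeromorphicAt (inChart (fun y => fibreCoord M x ⟨y, s y⟩) x) (chartAt ℂ x x) ∧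
    sectionOrder M s x ≠ ⊤

open Classical in
/-- The degree of the line bundle `M` on a compact Riemann surface: the degree of the divisor of
any nonzero meromorphic section. -/
noncomputable def lineBundleDegree : ℤ :=
  if h : ∃ s : ∀ x, M x, IsNonzeroMeromorphicSection M s then
    ∑ᶠ x, (sectionOrder M h.choose x).untop₀
  else 0

/-- `B_{2n}(X, M) = ⨁ H⁰(X, M ^ (2i))`, `i = 1, …, n`; the entry with index `j` is `a_{2(j+1)}`. -/
abbrev HitchinBase (n : ℕ) : Type _ := ∀ j : Fin n, holSections M (2 * ((j : ℕ) + 1))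

/-! ### The involution on `Tot M` -/

/-- The reflection in the zero section of `M`. -/
def reflection (p : TotalSpace ℂ M) : TotalSpace ℂ M := ⟨p.1, -p.2⟩

theorem reflection_reflection (p : TotalSpace ℂ M) : reflection M (reflection M p) = p :=
  congrArg (TotalSpace.mk p.1) (neg_neg p.2)

theorem fibreCoord_reflection (x : X) (p : TotalSpace ℂ M) :
    fibreCoord M x (reflection M p) = - fibreCoord M x p :=
  ((trivializationAt ℂ M x).linearMapAt ℂ p.1).map_neg p.2

theorem contMDiff_reflection [IsManifold 𝓘(ℂ) ω X] [ContMDiffVectorBundle ω ℂ M 𝓘(ℂ)] :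
    ContMDiff (𝓘(ℂ).prod 𝓘(ℂ)) (𝓘(ℂ).prod 𝓘(ℂ)) ω (reflection M) := by
  intro p
  rw [contMDiffAt_totalSpace]
  refine ⟨contMDiffAt_proj M, ?_⟩
  have h2 := ((contMDiffAt_totalSpace (n := ω) (IM := 𝓘(ℂ).prod 𝓘(ℂ)) (IB := 𝓘(ℂ))
    (f := (id : TotalSpace ℂ M → TotalSpace ℂ M)) (x₀ := p)).1 contMDiffAt_id).2
  refine h2.neg.congr_of_eventuallyEq ?_
  have hb : (trivializationAt ℂ M p.1).baseSet ∈ 𝓝 p.1 :=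
    (trivializationAt ℂ M p.1).open_baseSet.mem_nhds (mem_baseSet_trivializationAt ℂ M p.1)
  have hc : Tendsto (fun v : TotalSpace ℂ M => v.1) (𝓝 p) (𝓝 p.1) :=
    (FiberBundle.continuous_proj ℂ M).tendsto p
  filter_upwards [hc hb] with v hv
  have := fibreCoord_reflection M p.1 v
  have h3 : v.1 ∈ (trivializationAt ℂ M p.1).baseSet := hv
  simp only [fibreCoord] at this
  rw [Trivialization.coe_linearMapAt_of_mem _ h3] at this
  have h4 : (reflection M v).1 ∈ (trivializationAt ℂ M p.1).baseSet := hv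
  rw [Trivialization.coe_linearMapAt_of_mem _ h4] at this
  exact this

/-- The orbit of `p` under the reflection. -/
def reflOrbit (p : TotalSpace ℂ M) : Set (TotalSpace ℂ M) := {p, reflection M p}

theorem mapsTo_reflOrbit (p : TotalSpace ℂ M) :
    Set.MapsTo (reflection M) (reflOrbit M p) (reflOrbit M p) := by
  rintro _ (rfl | rfl)
  · exact Or.inr rfl
  · exact Or.inl (reflection_reflection M _)

/-! ### Spectral curves -/

variable {M} {n : ℕ} (a : HitchinBase M n)

/-- The coefficients `a_2, …, a_{2n}` at `y` in the trivialization around `x`. -/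
noncomputable def localCoeff (x y : X) (j : Fin n) : ℂ :=
  powCoord M x (2 * ((j : ℕ) + 1)) y ((a j : ∀ x, ⨂[ℂ]^(2 * ((j : ℕ) + 1)) (M x)) y)

/-- The characteristic polynomial `T ^ (2n) + a_2 T ^ (2n-2) + ⋯ + a_{2n}` at `y`, in the
trivialization around `x`. -/
noncomputable def charPoly (x y : X) : ℂ[X] :=
  Polynomial.X ^ (2 * n) + ∑ j : Fin n,
    C (localCoeff a x y j) * Polynomial.X ^ (2 * n - 2 * ((j : ℕ) + 1))

/-- The section `η ^ (2n) + a_2 η ^ (2n-2) + ⋯ + a_{2n}` of the pullback of `M ^ (2n)` to `Tot M`,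
in the trivialization around `x`. -/
noncomputable def spectralEq (x : X) (p : TotalSpace ℂ M) : ℂ :=
  (charPoly a x p.1).eval (fibreCoord M x p)

theorem spectralEq_reflection (x : X) (p : TotalSpace ℂ M) :
    spectralEq a x (reflection M p) = spectralEq a x p := by
  have h : ∀ m : ℕ, (-fibreCoord M x p) ^ (2 * m) = fibreCoord M x p ^ (2 * m) := fun m =>
    (even_two_mul m).neg_pow _
  have h1 : (reflection M p).proj = p.proj := rfl
  simp only [spectralEq, charPoly, fibreCoord_reflection, h1, eval_add, eval_finsetSum, eval_mul,
    eval_C, eval_pow, eval_X, ← Nat.mul_sub, h]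

/-- The spectral curve `Σ ⊂ Tot M` (as a set of points). -/
def spectralCurve : Set (TotalSpace ℂ M) := {p | spectralEq a p.1 p = 0}

/-- The analytic local ring `𝒪_{Σ,p}`. -/
abbrev SpectralLocalRing (p : TotalSpace ℂ M) : Type _ :=
  HypersurfaceRing (𝓘(ℂ).prod 𝓘(ℂ)) {p} (spectralEq a p.1)

/-- `p` is a singular point of the spectral curve `Σ`. -/
def IsSingularPoint (p : TotalSpace ℂ M) : Prop :=
  p ∈ spectralCurve a ∧ ¬ IsSmoothCurveRing (SpectralLocalRing a p)

/-- The number of sheets of `Σ → X` that meet at `p`, i.e. the multiplicity of `p` in its fibre. -/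
noncomputable def sheetNumber (p : TotalSpace ℂ M) : ℕ :=
  (charPoly a p.1 p.1).rootMultiplicity (fibreCoord M p.1 p)

/-- `p` is a singularity of `Σ` of type `A_k`. -/
def IsTypeA (k : ℕ) (p : TotalSpace ℂ M) : Prop :=
  Nonempty (SpectralLocalRing a p ≃ₐ[ℂ] AkRing k)

/-- All zeros of the section `disc^red(a)` of `M ^ (2n(n-1))` are simple; near `x` the section is
given in the trivialization around `x` by `y ↦ redDisc (localCoeff a x y)`. -/
def RedDiscSimpleZeros : Prop :=
  ∀ x, redDisc (localCoeff a x x) = 0 →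
    analyticOrderAt (inChart (fun y => redDisc (localCoeff a x y)) x) (chartAt ℂ x x) = 1

/-- `a_{2i}` vanishes at `x`; since `a_0 = 1`, this never happens for `i = 0`. -/
def CoeffVanishesAt (i : ℕ) (x : X) : Prop :=
  ∃ j : Fin n, (j : ℕ) + 1 = i ∧ (a j : ∀ x, ⨂[ℂ]^(2 * ((j : ℕ) + 1)) (M x)) x = 0

/-- The ring of germs of holomorphic functions on `Σ` along the orbit `{p, σ p}`, i.e. the stalk
at `[p]` of the push-forward of `𝒪_Σ` to `Σ/σ`. -/
abbrev OrbitRing (p : TotalSpace ℂ M) : Type _ :=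
  HypersurfaceRing (𝓘(ℂ).prod 𝓘(ℂ)) (reflOrbit M p) (spectralEq a p.1)

variable [IsManifold 𝓘(ℂ) ω X] [ContMDiffVectorBundle ω ℂ M 𝓘(ℂ)]

variable (M) in
/-- The action `f ↦ f ∘ σ` on functions holomorphic near an orbit. -/
def reflPullback (p : TotalSpace ℂ M) :
    holAlg (𝓘(ℂ).prod 𝓘(ℂ)) (reflOrbit M p) →ₐ[ℂ] holAlg (𝓘(ℂ).prod 𝓘(ℂ)) (reflOrbit M p) where
  toFun f := ⟨fun v => (f : TotalSpace ℂ M → ℂ) (reflection M v), fun v hv =>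
    (f.2 _ (mapsTo_reflOrbit M p hv)).comp v (contMDiff_reflection M v)⟩
  map_one' := rfl
  map_mul' _ _ := rfl
  map_zero' := rfl
  map_add' _ _ := rfl
  commutes' _ := rfl

theorem germIdeal_le_comap (p : TotalSpace ℂ M) :
    germIdeal (𝓘(ℂ).prod 𝓘(ℂ)) (reflOrbit M p) (spectralEq a p.1) ≤
      (germIdeal (𝓘(ℂ).prod 𝓘(ℂ)) (reflOrbit M p) (spectralEq a p.1)).comap
        (reflPullback M p) := by
  rintro f ⟨h, hh⟩
  refine ⟨reflPullback M p h, ?_⟩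
  have ht : Tendsto (reflection M) (𝓝ˢ (reflOrbit M p)) (𝓝ˢ (reflOrbit M p)) :=
    (contMDiff_reflection M).continuous.tendsto_nhdsSet (mapsTo_reflOrbit M p)
  filter_upwards [ht.eventually hh] with v hv
  rw [Pi.mul_apply, spectralEq_reflection] at hv
  exact hv

/-- The action of the involution `σ` of `Σ` on germs along an orbit. -/
noncomputable def sigmaAction (p : TotalSpace ℂ M) : OrbitRing a p →ₐ[ℂ] OrbitRing a p :=
  HypersurfaceRing.map (reflPullback M p) (germIdeal_le_comap a p)

/-- The local ring of `Σ/σ` at the image of `p`: the stalk of the sheaf of `σ`-invariant functions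
on `Σ`. -/
noncomputable def QuotientLocalRing (p : TotalSpace ℂ M) : Subalgebra ℂ (OrbitRing a p) :=
  AlgHom.equalizer (sigmaAction a p) (AlgHom.id ℂ (OrbitRing a p))

/-- `a` is of `sl(2)`-type: the quotient `Σ/σ` is smooth. -/
def IsSl2Type : Prop :=
  ∀ p ∈ spectralCurve a, IsSmoothCurveRing ↥(QuotientLocalRing a p)

end LineBundle

/-!
Write `u = t ^ 2` for the square of the fibre coordinate `t`. In a chart `z` of `X` the spectral
curve is `Q(z, t ^ 2) = 0` with `Q(z, u) = u ^ n + a_2 u ^ (n-1) + ⋯ + a_{2n}` (`quotientEq`), and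
everything is read off from the differential of `Q`.

*Local rings.* A germ `f(z, t)` that is even in `t` is a germ in `(z, t ^ 2)`
(`AnalyticAt.exists_eq_comp_sq_snd`), so the local ring of `Σ/σ` is that of the plane curve `Q = 0`,
also at points off the zero section, where the two points of an orbit have isomorphic
neighbourhoods. A hypersurface germ `q = 0` in the plane has a discrete valuation ring as its local
ring iff `dq ≠ 0` (`isSmoothCurveRing_iff_fderiv_ne_zero`); hence `a` is of `sl(2)`-type iff
`dQ ≠ 0` at all points of `Q = 0` (`isSl2Type_iff`).

*Sheets at singular points.* Off the zero section `(z, t) ↦ (z, t ^ 2)` is a local isomorphism, so a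
singular point of `Σ` there gives a singular point of `Σ/σ`. On the zero section `Σ` is singular iff
`∂_z Q = 0`, and then `Σ/σ` is smooth iff `∂_u Q ≠ 0`, i.e. iff `u = 0` is a simple root of `Q` in the
fibre, i.e. iff two sheets of `Σ` meet.

*Type `A_k`.* At a singular point `∂_u Q ≠ 0`, so `Q` is a unit times `u - g(z)` and `Σ` is
`t ^ 2 = g(z)`. If `g` vanishes to finite order `k + 1`, then `z` can be rescaled by a root of a unit
to obtain `A_k`. Otherwise `a_{2n}` vanishes near a point, hence everywhere. For `n = 1` this means
`a = 0`. For `n ≥ 2` the zero section lies in `Σ/σ`, and smoothness along it makes `a_{2n-2}` a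
nowhere vanishing section of `M ^ (2n-2)`. Then `s ^ (2n-2) / a_{2n-2}`, for a meromorphic section
`s` of `M`, is a meromorphic function whose divisor has degree `(2n-2) deg M > 0`, which is impossible
(`finsum_chartOrder_eq_zero`). That the divisor of a meromorphic function `f` has degree zero follows
from conservation of multiplicity: the degree of `div (f - w)` is locally constant in `w`, and so is
that of `div (1/f - w)`.

*The discriminant.* Suppose `dQ = 0` at a point `(z₀, u₀)` of `Q = 0`. Modulo `(z - z₀) ^ 2` the
polynomial `Q` then has the root `u₀`, say `Q = (u - u₀) g`, and `g(u₀) = ∂_u Q(u₀)` is divisible by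
`z - z₀`. The resultant of `Q` and `∂_u Q` is `g(u₀)` times that of `g` and `∂_u Q`, which is a
combination of the values of both at `u₀` and so divisible by `z - z₀` as well. Hence the discriminant
vanishes to order at least two (`RedDiscSimpleZeros.isSl2Type`).
-/

/-! ### Double power series -/

/-- Sum over the antidiagonals of a summable double family. -/
theorem HasSum.antidiagonal_sum {F : ℕ × ℕ → ℂ} {S : ℂ} (h : HasSum F S) :
    HasSum (fun n => ∑ ij ∈ Finset.HasAntidiagonal.antidiagonal n, F ij) S := by
  have h1 := (Finset.HasAntidiagonal.sigmaAntidiagonalEquivProd (A := ℕ)).hasSum_iff.2 h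
  refine h1.sigma fun n => ?_
  have := hasSum_fintype (fun c : Finset.HasAntidiagonal.antidiagonal n => F c)
  rw [Finset.sum_coe_sort (Finset.HasAntidiagonal.antidiagonal n) F] at this
  exact this

theorem summable_double_geometric {s : ℝ} (h0 : 0 ≤ s) (h1 : s < 1) :
    Summable fun ij : ℕ × ℕ => s ^ (ij.1 + ij.2) := by
  have := (summable_geometric_of_lt_one h0 h1).mul_of_nonneg
    (summable_geometric_of_lt_one h0 h1) (fun n => pow_nonneg h0 n) (fun n => pow_nonneg h0 n)
  simpa [pow_add] using this

/-- A holomorphic function of two variables is the sum of an absolutely convergent double power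
series. -/
theorem AnalyticAt.exists_hasSum_double {f : ℂ × ℂ → ℂ} (hf : AnalyticAt ℂ f 0) :
    ∃ (a : ℕ → ℕ → ℂ) (r : ℝ), 0 < r ∧
      Summable (fun ij : ℕ × ℕ => ‖a ij.1 ij.2‖ * r ^ (ij.1 + ij.2)) ∧
      ∀ z t : ℂ, ‖z‖ ≤ r → ‖t‖ ≤ r →
        HasSum (fun ij : ℕ × ℕ => a ij.1 ij.2 * z ^ ij.1 * t ^ ij.2) (f (z, t)) := by
  obtain ⟨p, R, hp⟩ := hf
  obtain ⟨ρ, hρ0, hρR⟩ : ∃ ρ : NNReal, 0 < ρ ∧ (ρ : ENNReal) < R := by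
    obtain ⟨ρ, h1, h2⟩ := ENNReal.lt_iff_exists_nnreal_btwn.1 hp.r_pos
    exact ⟨ρ, by exact_mod_cast h1, h2⟩
  obtain ⟨C, hC0, hC⟩ := p.norm_mul_pow_le_of_lt_radius (hρR.trans_le hp.r_le)
  -- `b n i` is the coefficient of `z ^ i t ^ (n - i)` in the homogeneous part `p n`; its bound
  -- `2 ^ n ‖p n‖` and the double summation cost a factor `4` in the radius
  let b : ∀ n : ℕ, ℕ → ℂ := fun n i => ∑ s ∈ Finset.powersetCard i (Finset.univ : Finset (Fin n)),
    p n (s.piecewise (fun _ => ((1 : ℂ), (0 : ℂ))) (fun _ => ((0 : ℂ), (1 : ℂ))))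
  have hb : ∀ n i, ‖b n i‖ ≤ 2 ^ n * ‖p n‖ := by
    intro n i
    refine (norm_sum_le _ _).trans ?_
    have h1 : ∀ s ∈ Finset.powersetCard i (Finset.univ : Finset (Fin n)),
        ‖p n (s.piecewise (fun _ => ((1 : ℂ), (0 : ℂ))) (fun _ => ((0 : ℂ), (1 : ℂ))))‖ ≤ ‖p n‖ := by
      intro s _
      refine ((p n).le_opNorm _).trans ?_
      refine mul_le_of_le_one_right (norm_nonneg _) ?_
      refine Finset.prod_le_one (fun _ _ => norm_nonneg _) fun k _ => ?_
      by_cases hk : k ∈ s <;> simp [Finset.piecewise, hk]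
    refine (Finset.sum_le_card_nsmul _ _ _ h1).trans ?_
    rw [nsmul_eq_mul, Finset.card_powersetCard, Finset.card_fin]
    gcongr
    exact_mod_cast Nat.choose_le_two_pow n i
  have hpn : ∀ (z t : ℂ) (n : ℕ), p n (fun _ => (z, t)) =
      ∑ ij ∈ Finset.HasAntidiagonal.antidiagonal n, b (ij.1 + ij.2) ij.1 * z ^ ij.1 * t ^ ij.2 := by
    intro z t n
    have h1 : (fun _ : Fin n => (z, t)) =
        (fun _ => z • ((1 : ℂ), (0 : ℂ))) + (fun _ => t • ((0 : ℂ), (1 : ℂ))) := by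
      funext k
      simp
    rw [h1, ContinuousMultilinearMap.map_add_univ, Finset.Nat.sum_antidiagonal_eq_sum_range_succ_mk,
      ← Finset.powerset_univ, Finset.sum_powerset, Finset.card_fin]
    refine Finset.sum_congr rfl fun i hi => ?_
    have hin : i + (n - i) = n := by
      have := Finset.mem_range.1 hi
      omega
    simp only [hin, b, Finset.sum_mul]
    refine Finset.sum_congr rfl fun s hs => ?_
    have hs' : s.card = i := (Finset.mem_powersetCard.1 hs).2
    have h2 : s.piecewise (fun _ => z • ((1 : ℂ), (0 : ℂ))) (fun _ => t • ((0 : ℂ), (1 : ℂ))) =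
        fun k => (s.piecewise (fun _ => z) (fun _ => t) k : ℂ) •
          (s.piecewise (fun _ => ((1 : ℂ), (0 : ℂ))) (fun _ => ((0 : ℂ), (1 : ℂ))) k) := by
      funext k
      by_cases hk : k ∈ s <;> simp [Finset.piecewise, hk]
    rw [h2, ContinuousMultilinearMap.map_smul_univ]
    have h3 : ∏ k, s.piecewise (fun _ => z) (fun _ => t) k = z ^ i * t ^ (n - i) := by
      rw [Finset.prod_piecewise]
      simp [hs', Finset.card_sdiff]
    rw [h3, smul_eq_mul]
    ring
  have hsum : Summable (fun ij : ℕ × ℕ => ‖b (ij.1 + ij.2) ij.1‖ * (ρ / 4 : ℝ) ^ (ij.1 + ij.2)) := by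
    refine Summable.of_nonneg_of_le (fun _ => by positivity) (fun ij => ?_)
      ((summable_double_geometric (s := 1 / 2) (by norm_num) (by norm_num)).mul_left C)
    calc ‖b (ij.1 + ij.2) ij.1‖ * (ρ / 4 : ℝ) ^ (ij.1 + ij.2)
        ≤ (2 ^ (ij.1 + ij.2) * ‖p (ij.1 + ij.2)‖) * (ρ / 4 : ℝ) ^ (ij.1 + ij.2) := by
          gcongr
          exact hb _ _
      _ = (‖p (ij.1 + ij.2)‖ * (ρ : ℝ) ^ (ij.1 + ij.2)) * (1 / 2) ^ (ij.1 + ij.2) := by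
          rw [show (ρ / 4 : ℝ) = ρ * (1 / 2) * (1 / 2) by ring, mul_pow, mul_pow]
          have : (2 : ℝ) ^ (ij.1 + ij.2) * (1 / 2) ^ (ij.1 + ij.2) = 1 := by
            rw [← mul_pow]; norm_num
          linear_combination (‖p (ij.1 + ij.2)‖ * (ρ : ℝ) ^ (ij.1 + ij.2) *
            (1 / 2) ^ (ij.1 + ij.2)) * this
      _ ≤ C * (1 / 2) ^ (ij.1 + ij.2) := by
          gcongr
          exact hC _
  refine ⟨fun i j => b (i + j) i, ρ / 4, by positivity, hsum, fun z t hz ht => ?_⟩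
  have hS : Summable (fun ij : ℕ × ℕ => b (ij.1 + ij.2) ij.1 * z ^ ij.1 * t ^ ij.2) := by
    refine Summable.of_norm_bounded hsum fun ij => ?_
    rw [norm_mul, norm_mul, norm_pow, norm_pow, mul_assoc, pow_add]
    gcongr
  have h1 := hS.hasSum.antidiagonal_sum
  have hmem : ((z, t) : ℂ × ℂ) ∈ Metric.eball (0 : ℂ × ℂ) R := by
    rw [Metric.mem_eball, edist_zero_right]
    refine lt_of_le_of_lt ?_ hρR
    have : ‖((z, t) : ℂ × ℂ)‖ ≤ ρ := by
      rw [Prod.norm_def]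
      refine max_le (hz.trans ?_) (ht.trans ?_) <;>
      linarith [ρ.coe_nonneg]
    rw [enorm_eq_nnnorm]
    exact_mod_cast this
  have h2 := hp.hasSum hmem
  simp only [zero_add, hpn] at h2
  have := h1.unique h2
  rw [← this]
  exact hS.hasSum

/-- The sum of an absolutely convergent double power series is holomorphic. -/
theorem analyticAt_tsum_double {a : ℕ → ℕ → ℂ} {r : ℝ} (hr : 0 < r)
    (ha : Summable (fun ij : ℕ × ℕ => ‖a ij.1 ij.2‖ * r ^ (ij.1 + ij.2))) :
    AnalyticAt ℂ (fun v : ℂ × ℂ => ∑' ij : ℕ × ℕ, a ij.1 ij.2 * v.1 ^ ij.1 * v.2 ^ ij.2) 0 := by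
  let m : ∀ n : ℕ, ℕ → ContinuousMultilinearMap ℂ (fun _ : Fin n => ℂ × ℂ) ℂ := fun n i =>
    (ContinuousMultilinearMap.mkPiAlgebra ℂ (Fin n) ℂ).compContinuousLinearMap
      fun k => if (k : ℕ) < i then ContinuousLinearMap.fst ℂ ℂ ℂ else ContinuousLinearMap.snd ℂ ℂ ℂ
  have hm : ∀ n i, ‖m n i‖ ≤ 1 := by
    intro n i
    refine ContinuousMultilinearMap.opNorm_le_bound zero_le_one fun v => ?_
    simp only [m, ContinuousMultilinearMap.compContinuousLinearMap_apply,
      ContinuousMultilinearMap.mkPiAlgebra_apply, norm_prod, one_mul]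
    refine Finset.prod_le_prod (fun _ _ => norm_nonneg _) fun k _ => ?_
    split_ifs
    · exact norm_fst_le _
    · exact norm_snd_le _
  have hmv : ∀ i j (v : ℂ × ℂ), m (i + j) i (fun _ => v) = v.1 ^ i * v.2 ^ j := by
    intro i j v
    simp only [m, ContinuousMultilinearMap.compContinuousLinearMap_apply,
      ContinuousMultilinearMap.mkPiAlgebra_apply]
    rw [Fin.prod_univ_add]
    simp
  let p : FormalMultilinearSeries ℂ (ℂ × ℂ) ℂ := fun n =>
    ∑ ij ∈ Finset.HasAntidiagonal.antidiagonal n, a ij.1 ij.2 • m n ij.1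
  have hpv : ∀ n (v : ℂ × ℂ), p n (fun _ => v) =
      ∑ ij ∈ Finset.HasAntidiagonal.antidiagonal n, a ij.1 ij.2 * v.1 ^ ij.1 * v.2 ^ ij.2 := by
    intro n v
    simp only [p, _root_.sum_apply, _root_.smul_apply,
      smul_eq_mul]
    refine Finset.sum_congr rfl fun ij hij => ?_
    obtain rfl := Finset.HasAntidiagonal.mem_antidiagonal.1 hij
    rw [hmv, mul_assoc]
  have hpn : ∀ n, ‖p n‖ * r ^ n ≤
      ∑ ij ∈ Finset.HasAntidiagonal.antidiagonal n, ‖a ij.1 ij.2‖ * r ^ (ij.1 + ij.2) := by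
    intro n
    rw [Finset.sum_congr rfl (g := fun ij : ℕ × ℕ => ‖a ij.1 ij.2‖ * r ^ n)
      fun ij hij => by rw [Finset.HasAntidiagonal.mem_antidiagonal.1 hij], ← Finset.sum_mul]
    gcongr
    refine (norm_sum_le _ _).trans (Finset.sum_le_sum fun ij _ => ?_)
    rw [norm_smul]
    exact mul_le_of_le_one_right (norm_nonneg _) (hm _ _)
  have hsum : Summable fun n => ‖p n‖ * r ^ n := by
    refine Summable.of_nonneg_of_le (fun n => by positivity) hpn ?_
    have h1 := (Finset.HasAntidiagonal.sigmaAntidiagonalEquivProd (A := ℕ)).summable_iff.2 ha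
    have h2 := h1.sigma' (fun n => (hasSum_fintype _).summable)
    refine h2.congr fun n => ?_
    rw [tsum_fintype, ← Finset.sum_coe_sort (Finset.HasAntidiagonal.antidiagonal n)]
    rfl
  refine ⟨p, ENNReal.ofReal r, ?_, by simpa using hr, ?_⟩
  · have := p.le_radius_of_summable_norm (r := ⟨r, hr.le⟩) hsum
    rwa [ENNReal.ofReal, Real.toNNReal_of_nonneg hr.le]
  · intro v hv
    rw [Metric.mem_eball, edist_zero_right] at hv
    have hv' : ‖v‖ ≤ r := by
      rw [← ofReal_norm, ENNReal.ofReal_lt_ofReal_iff hr] at hv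
      exact hv.le
    simp only [zero_add, hpv]
    refine HasSum.antidiagonal_sum
      (F := fun ij : ℕ × ℕ => a ij.1 ij.2 * v.1 ^ ij.1 * v.2 ^ ij.2) (Summable.hasSum ?_)
    refine Summable.of_norm_bounded ha fun ij => ?_
    rw [norm_mul, norm_mul, norm_pow, norm_pow, mul_assoc, pow_add]
    gcongr
    · exact (norm_fst_le v).trans hv'
    · exact (norm_snd_le v).trans hv'

theorem eventually_norm_le_zero {r : ℝ} (hr : 0 < r) :
    ∀ᶠ v : ℂ × ℂ in 𝓝 0, ‖v.1‖ ≤ r ∧ ‖v.2‖ ≤ r := by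
  filter_upwards [Metric.closedBall_mem_nhds (0 : ℂ × ℂ) hr] with v hv
  rw [mem_closedBall_zero_iff] at hv
  exact ⟨(norm_fst_le v).trans hv, (norm_snd_le v).trans hv⟩

/-- Division by a coordinate: `f(z,t) - f(z,0)` is a holomorphic multiple of `t`. -/
theorem AnalyticAt.exists_eq_mul_snd {f : ℂ × ℂ → ℂ} (hf : AnalyticAt ℂ f 0) :
    ∃ h : ℂ × ℂ → ℂ, AnalyticAt ℂ h 0 ∧ ∀ᶠ v in 𝓝 0, f v = f (v.1, 0) + v.2 * h v := by
  obtain ⟨a, r, hr, ha, hsum⟩ := hf.exists_hasSum_double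
  have hinj : Function.Injective (fun ij : ℕ × ℕ => (ij.1, ij.2 + 1)) := by
    rintro ⟨i, j⟩ ⟨k, l⟩ h
    simpa using h
  have ha' : Summable (fun ij : ℕ × ℕ => ‖a ij.1 (ij.2 + 1)‖ * r ^ (ij.1 + ij.2)) := by
    have h1 := (ha.comp_injective hinj).mul_left r⁻¹
    refine h1.congr fun ij => ?_
    simp only [Function.comp_apply]
    rw [← add_assoc, pow_succ]
    field_simp
  refine ⟨_, analyticAt_tsum_double (a := fun i j => a i (j + 1)) hr ha', ?_⟩
  filter_upwards [eventually_norm_le_zero hr] with v hv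
  obtain ⟨z, t⟩ := v
  have h1 := hsum z t hv.1 hv.2
  have h0 := hsum z 0 hv.1 (by simpa using hr.le)
  have hsub := h1.sub h0
  have hz : ∀ ij ∉ Set.range (fun ij : ℕ × ℕ => (ij.1, ij.2 + 1)),
      a ij.1 ij.2 * z ^ ij.1 * t ^ ij.2 - a ij.1 ij.2 * z ^ ij.1 * 0 ^ ij.2 = 0 := by
    rintro ⟨i, j⟩ hij
    cases j with
    | zero => simp
    | succ j => exact absurd ⟨(i, j), rfl⟩ hij
  rw [← hinj.hasSum_iff hz] at hsub
  have h2 : (fun v : ℂ × ℂ => ∑' ij : ℕ × ℕ, a ij.1 (ij.2 + 1) * v.1 ^ ij.1 * v.2 ^ ij.2) (z, t) * t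
      = f (z, t) - f (z, 0) := by
    rw [← hsub.tsum_eq, ← tsum_mul_right]
    refine tsum_congr fun ij => ?_
    simp [Function.comp_apply, pow_succ, mul_assoc]
  simp only at h2 ⊢
  linear_combination -h2

/-- An even holomorphic function of `t` is a holomorphic function of `t ^ 2`. -/
theorem AnalyticAt.exists_eq_comp_sq_snd {f : ℂ × ℂ → ℂ} (hf : AnalyticAt ℂ f 0)
    (heven : ∀ᶠ v in 𝓝 0, f (v.1, -v.2) = f v) :
    ∃ F : ℂ × ℂ → ℂ, AnalyticAt ℂ F 0 ∧ ∀ᶠ v in 𝓝 0, f v = F (v.1, v.2 ^ 2) := by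
  obtain ⟨a, r, hr, ha, hsum⟩ := hf.exists_hasSum_double
  have hinj : Function.Injective (fun ij : ℕ × ℕ => (ij.1, 2 * ij.2)) := by
    rintro ⟨i, j⟩ ⟨k, l⟩ h
    simpa using h
  have ha' : Summable (fun ij : ℕ × ℕ => ‖a ij.1 (2 * ij.2)‖ * (min r (r ^ 2)) ^ (ij.1 + ij.2)) := by
    refine Summable.of_nonneg_of_le (fun _ => by positivity) (fun ij => ?_)
      (ha.comp_injective hinj)
    simp only [Function.comp_apply]
    rw [pow_add, pow_add, pow_mul]
    gcongr
    · exact min_le_left _ _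
    · exact min_le_right _ _
  refine ⟨_, analyticAt_tsum_double (a := fun i j => a i (2 * j)) (r := min r (r ^ 2))
    (by positivity) ha', ?_⟩
  filter_upwards [eventually_norm_le_zero hr, heven] with v hv he
  obtain ⟨z, t⟩ := v
  have h1 := hsum z t hv.1 hv.2
  have h2 := hsum z (-t) hv.1 (by simpa using hv.2)
  simp only at he
  rw [he] at h2
  have h3 := (h1.add h2).mul_left (1 / 2)
  have hz : ∀ ij ∉ Set.range (fun ij : ℕ × ℕ => (ij.1, 2 * ij.2)),
      (1 / 2) * (a ij.1 ij.2 * z ^ ij.1 * t ^ ij.2 + a ij.1 ij.2 * z ^ ij.1 * (-t) ^ ij.2) = 0 := by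
    rintro ⟨i, j⟩ hij
    rcases Nat.even_or_odd j with ⟨k, rfl⟩ | hj
    · exact absurd ⟨(i, k), by simp [two_mul]⟩ hij
    · simp [hj.neg_pow]
  rw [← hinj.hasSum_iff hz] at h3
  have h4 : f (z, t) = 1 / 2 * (f (z, t) + f (z, t)) := by ring
  rw [h4, ← h3.tsum_eq]
  refine tsum_congr fun ij => ?_
  simp only [Function.comp_apply, (even_two_mul ij.2).neg_pow, pow_mul]
  ring

/-! ### Functoriality of the rings of germs -/

section Functoriality

variable {E : Type*} [NormedAddCommGroup E] [NormedSpace ℂ E]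
  {H : Type*} [TopologicalSpace H] {I : ModelWithCorners ℂ E H}
  {N : Type*} [TopologicalSpace N] [ChartedSpace H N]
  {E' : Type*} [NormedAddCommGroup E'] [NormedSpace ℂ E']
  {H' : Type*} [TopologicalSpace H'] {I' : ModelWithCorners ℂ E' H'}
  {N' : Type*} [TopologicalSpace N'] [ChartedSpace H' N']

variable (I) in
/-- The class of a holomorphic function in the ring of germs modulo `q`. -/
noncomputable def HypersurfaceRing.mk (S : Set N) (q : N → ℂ) :
    holAlg I S →ₐ[ℂ] HypersurfaceRing I S q :=
  Ideal.Quotient.mkₐ ℂ (germIdeal I S q)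

theorem HypersurfaceRing.mk_surjective (S : Set N) (q : N → ℂ) :
    Function.Surjective (HypersurfaceRing.mk I S q) :=
  Ideal.Quotient.mkₐ_surjective ℂ _

theorem HypersurfaceRing.mk_eq_mk {S : Set N} {q : N → ℂ} {f g : holAlg I S} :
    HypersurfaceRing.mk I S q f = HypersurfaceRing.mk I S q g ↔
      ∃ h : holAlg I S, ∀ᶠ v in 𝓝ˢ S, f.1 v - g.1 v = h.1 v * q v :=
  Ideal.Quotient.mk_eq_mk_iff_sub_mem f g

theorem HypersurfaceRing.mk_eq_zero {S : Set N} {q : N → ℂ} {f : holAlg I S} :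
    HypersurfaceRing.mk I S q f = 0 ↔
      ∃ h : holAlg I S, ∀ᶠ v in 𝓝ˢ S, f.1 v = h.1 v * q v :=
  Ideal.Quotient.eq_zero_iff_mem

theorem HypersurfaceRing.map_mk {S : Set N} {q : N → ℂ} (φ : holAlg I S →ₐ[ℂ] holAlg I S)
    (hφ : germIdeal I S q ≤ (germIdeal I S q).comap φ) (f : holAlg I S) :
    HypersurfaceRing.map φ hφ (HypersurfaceRing.mk I S q f) = HypersurfaceRing.mk I S q (φ f) :=
  rfl

/-- Pullback of functions holomorphic near `S'` along a map that is holomorphic near `S`. -/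
def holAlg.comap (φ : N → N') {S : Set N} {S' : Set N'} (hS : Set.MapsTo φ S S')
    (hφ : ∀ p ∈ S, ContMDiffAt I I' ω φ p) : holAlg I' S' →ₐ[ℂ] holAlg I S where
  toFun f := ⟨fun v => f.1 (φ v), fun p hp => (f.2 _ (hS hp)).comp p (hφ p hp)⟩
  map_one' := rfl
  map_mul' _ _ := rfl
  map_zero' := rfl
  map_add' _ _ := rfl
  commutes' _ := rfl

theorem tendsto_nhdsSet_of_contMDiffAt {φ : N → N'} {S : Set N} {S' : Set N'}
    (hS : Set.MapsTo φ S S') (hφ : ∀ p ∈ S, ContMDiffAt I I' ω φ p) :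
    Tendsto φ (𝓝ˢ S) (𝓝ˢ S') := by
  intro U hU
  rw [mem_map, mem_nhdsSet_iff_forall]
  exact fun p hp => (hφ p hp).continuousAt (mem_nhdsSet_iff_forall.1 hU _ (hS hp))

/-- The homomorphism between the rings of germs on two hypersurfaces that is induced by a
holomorphic map `φ` such that the pullback of the second equation is a multiple of the first. -/
noncomputable def HypersurfaceRing.comap (φ : N → N') {S : Set N} {S' : Set N'} {q : N → ℂ}
    {q' : N' → ℂ} (hS : Set.MapsTo φ S S') (hφ : ∀ p ∈ S, ContMDiffAt I I' ω φ p)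
    (u : holAlg I S) (hq : ∀ᶠ v in 𝓝ˢ S, q' (φ v) = u.1 v * q v) :
    HypersurfaceRing I' S' q' →ₐ[ℂ] HypersurfaceRing I S q :=
  Ideal.quotientMapₐ (germIdeal I S q) (holAlg.comap φ hS hφ) (by
    rintro f ⟨h, hh⟩
    refine ⟨holAlg.comap φ hS hφ h * u, ?_⟩
    filter_upwards [(tendsto_nhdsSet_of_contMDiffAt hS hφ).eventually hh, hq] with v h1 h2
    change f.1 (φ v) = h.1 (φ v) * u.1 v * q v
    rw [h1, Pi.mul_apply, h2, mul_assoc])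

/-- A biholomorphism between neighbourhoods of `p` and `p'` that carries `q'` to a unit multiple of
`q` induces an isomorphism of local rings. -/
theorem HypersurfaceRing.nonempty_algEquiv {p : N} {p' : N'} {q : N → ℂ} {q' : N' → ℂ}
    {φ : N → N'} {ψ : N' → N} (hφp : φ p = p') (hψp : ψ p' = p)
    (hφ : ContMDiffAt I I' ω φ p) (hψ : ContMDiffAt I' I ω ψ p')
    (hψφ : ∀ᶠ v in 𝓝 p, ψ (φ v) = v) (hφψ : ∀ᶠ w in 𝓝 p', φ (ψ w) = w)
    {u : N → ℂ} (hu : ContMDiffAt I 𝓘(ℂ) ω u p) (hu0 : u p ≠ 0)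
    (hq : ∀ᶠ v in 𝓝 p, q v = u v * q' (φ v)) :
    Nonempty (HypersurfaceRing I {p} q ≃ₐ[ℂ] HypersurfaceRing I' {p'} q') := by
  have hψ' : ContMDiffAt I' 𝓘(ℂ) ω (fun w => u (ψ w)) p' := by
    subst hψp
    exact hu.comp p' hψ
  have hui : ContMDiffAt I 𝓘(ℂ) ω (fun v => (u v)⁻¹) p := hu.inv₀ hu0
  have h1 : ∀ᶠ v in 𝓝ˢ {p}, q' (φ v) = (u v)⁻¹ * q v := by
    rw [nhdsSet_singleton]
    filter_upwards [hq, hu.continuousAt.eventually_ne hu0] with v h2 h3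
    rw [h2]
    field_simp
  have h2 : ∀ᶠ w in 𝓝ˢ {p'}, q (ψ w) = u (ψ w) * q' w := by
    rw [nhdsSet_singleton]
    have ht : Tendsto ψ (𝓝 p') (𝓝 p) := by
      simpa only [hψp] using hψ.continuousAt.tendsto
    filter_upwards [ht.eventually hq, hφψ] with w h3 h4
    rw [h3, h4]
  let F : HypersurfaceRing I' {p'} q' →ₐ[ℂ] HypersurfaceRing I {p} q :=
    HypersurfaceRing.comap φ (by simpa using hφp) (by simpa using hφ)
      ⟨fun v => (u v)⁻¹, by simpa [holAlg] using hui⟩ h1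
  let G : HypersurfaceRing I {p} q →ₐ[ℂ] HypersurfaceRing I' {p'} q' :=
    HypersurfaceRing.comap ψ (by simpa using hψp) (by simpa using hψ)
      ⟨fun w => u (ψ w), by simpa [holAlg] using hψ'⟩ h2
  refine ⟨AlgEquiv.ofAlgHom G F ?_ ?_⟩
  · refine AlgHom.ext fun x => ?_
    obtain ⟨f, rfl⟩ := HypersurfaceRing.mk_surjective _ _ x
    refine HypersurfaceRing.mk_eq_mk.2 ⟨0, ?_⟩
    rw [nhdsSet_singleton]
    filter_upwards [hφψ] with w hw
    change f.1 (φ (ψ w)) - f.1 w = 0 * _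
    rw [hw]
    simp
  · refine AlgHom.ext fun x => ?_
    obtain ⟨f, rfl⟩ := HypersurfaceRing.mk_surjective _ _ x
    refine HypersurfaceRing.mk_eq_mk.2 ⟨0, ?_⟩
    rw [nhdsSet_singleton]
    filter_upwards [hψφ] with w hw
    change f.1 (ψ (φ w)) - f.1 w = 0 * _
    rw [hw]
    simp

end Functoriality

theorem IsSmoothCurveRing.of_ringEquiv {R S : Type*} [CommRing R] [CommRing S] (e : R ≃+* S)
    (h : IsSmoothCurveRing R) : IsSmoothCurveRing S := by
  obtain ⟨_, _⟩ := h
  have : IsDomain S := e.symm.toMulEquiv.isDomain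
  exact ⟨this, IsDiscreteValuationRing.RingEquivClass.isDiscreteValuationRing e⟩

theorem isSmoothCurveRing_congr {R S : Type*} [CommRing R] [CommRing S] (e : R ≃+* S) :
    IsSmoothCurveRing R ↔ IsSmoothCurveRing S :=
  ⟨IsSmoothCurveRing.of_ringEquiv e, IsSmoothCurveRing.of_ringEquiv e.symm⟩

/-- A ring in which every nonzero element is a unit times a power of a fixed non-nilpotent
non-unit is a discrete valuation ring. -/
theorem isSmoothCurveRing_of_uniformizer {R : Type*} [CommRing R] {z : R} (hz : ¬ IsUnit z)
    (hnil : ∀ n : ℕ, z ^ n ≠ 0) (h : ∀ x : R, x ≠ 0 → ∃ (n : ℕ) (u : R), IsUnit u ∧ x = z ^ n * u) :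
    IsSmoothCurveRing R := by
  have : Nontrivial R := ⟨⟨z ^ 0, 0, hnil 0⟩⟩
  have : NoZeroDivisors R := by
    refine ⟨fun {x y} hxy => ?_⟩
    by_contra! hne
    obtain ⟨n, u, hu, rfl⟩ := h x hne.1
    obtain ⟨m, v, hv, rfl⟩ := h y hne.2
    refine hnil (n + m) ((hu.mul hv).mul_left_eq_zero.1 ?_)
    rw [← hxy]
    ring
  have hdom : IsDomain R := NoZeroDivisors.to_isDomain R
  refine ⟨hdom, IsDiscreteValuationRing.ofHasUnitMulPowIrreducibleFactorization ⟨z, ⟨hz, ?_⟩, ?_⟩⟩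
  · intro x y hxy
    have hz0 : z ≠ 0 := by simpa using hnil 1
    have hx : x ≠ 0 := by
      rintro rfl
      exact hz0 (by simpa using hxy)
    have hy : y ≠ 0 := by
      rintro rfl
      exact hz0 (by simpa using hxy)
    obtain ⟨n, u, hu, rfl⟩ := h x hx
    obtain ⟨m, v, hv, rfl⟩ := h y hy
    rcases n with _ | n
    · left
      simpa using hu
    rcases m with _ | m
    · right
      simpa using hv
    · exfalso
      refine hz (IsUnit.of_mul_eq_one (z ^ n * u * (z ^ m * v)) ?_)
      refine mul_left_cancel₀ hz0 ?_
      linear_combination -hxy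
  · intro x hx
    obtain ⟨n, u, hu, rfl⟩ := h x hx
    exact ⟨n, hu.unit, rfl⟩

/-! ### The smoothness criterion for plane curves -/

section PlaneCurves

theorem contDiffAt_omega_iff {V F : Type*} [NormedAddCommGroup V] [NormedSpace ℂ V]
    [NormedAddCommGroup F] [NormedSpace ℂ F] [CompleteSpace F] {f : V → F} {p : V} :
    ContDiffAt ℂ ω f p ↔ AnalyticAt ℂ f p :=
  ⟨fun h => h.analyticAt, fun h => h.contDiffAt⟩

theorem contMDiffAt_iff_analyticAt_prod {F : Type*} [NormedAddCommGroup F] [NormedSpace ℂ F]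
    [CompleteSpace F] {f : ℂ × ℂ → F} {p : ℂ × ℂ} :
    ContMDiffAt 𝓘(ℂ, ℂ × ℂ) 𝓘(ℂ, F) ω f p ↔ AnalyticAt ℂ f p := by
  rw [contMDiffAt_iff_contDiffAt, contDiffAt_omega_iff]

theorem mem_holAlg_zero {f : ℂ × ℂ → ℂ} :
    f ∈ holAlg 𝓘(ℂ, ℂ × ℂ) {(0 : ℂ × ℂ)} ↔ AnalyticAt ℂ f 0 := by
  rw [← contMDiffAt_iff_analyticAt_prod]
  exact ⟨fun h => h 0 rfl, fun h p hp => hp ▸ h⟩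

/-- A class is a unit of the local ring iff its value at the point is nonzero. -/
theorem isUnit_mk_iff {q : ℂ × ℂ → ℂ} (hq : q 0 = 0)
    {f : holAlg 𝓘(ℂ, ℂ × ℂ) {(0 : ℂ × ℂ)}} :
    IsUnit (HypersurfaceRing.mk 𝓘(ℂ, ℂ × ℂ) {0} q f) ↔ f.1 0 ≠ 0 := by
  constructor
  · intro h h0
    obtain ⟨x, hx⟩ := h.exists_right_inv
    obtain ⟨g, rfl⟩ := HypersurfaceRing.mk_surjective _ _ x
    rw [← map_mul, ← map_one (HypersurfaceRing.mk 𝓘(ℂ, ℂ × ℂ) {(0 : ℂ × ℂ)} q),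
      HypersurfaceRing.mk_eq_mk] at hx
    obtain ⟨k, hk⟩ := hx
    rw [nhdsSet_singleton] at hk
    have := hk.self_of_nhds
    change f.1 0 * g.1 0 - 1 = k.1 0 * q 0 at this
    rw [h0, hq] at this
    norm_num at this
  · intro h0
    have hf := mem_holAlg_zero.1 f.2
    refine IsUnit.of_mul_eq_one (HypersurfaceRing.mk 𝓘(ℂ, ℂ × ℂ) {0} q
      ⟨fun v => (f.1 v)⁻¹, mem_holAlg_zero.2 (hf.inv h0)⟩) ?_
    rw [← map_mul, ← map_one (HypersurfaceRing.mk 𝓘(ℂ, ℂ × ℂ) {(0 : ℂ × ℂ)} q),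
      HypersurfaceRing.mk_eq_mk]
    refine ⟨0, ?_⟩
    rw [nhdsSet_singleton]
    filter_upwards [hf.continuousAt.eventually_ne h0] with v hv
    change f.1 v * (f.1 v)⁻¹ - 1 = 0 * q v
    rw [mul_inv_cancel₀ hv]
    ring

/-- The local ring of the line `t = 0` is a discrete valuation ring with uniformizer `z`. -/
theorem isSmoothCurveRing_snd {q : ℂ × ℂ → ℂ} (hq : ∀ v, q v = v.2) :
    IsSmoothCurveRing (HypersurfaceRing 𝓘(ℂ, ℂ × ℂ) {(0 : ℂ × ℂ)} q) := by
  let Z : holAlg 𝓘(ℂ, ℂ × ℂ) {(0 : ℂ × ℂ)} := ⟨fun v => v.1, mem_holAlg_zero.2 analyticAt_fst⟩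
  have h0 : q 0 = 0 := hq 0
  have hline : Tendsto (fun z : ℂ => (z, (0 : ℂ))) (𝓝 0) (𝓝 0) := by
    have : Continuous fun z : ℂ => (z, (0 : ℂ)) := by fun_prop
    exact this.tendsto 0
  refine isSmoothCurveRing_of_uniformizer
    (z := HypersurfaceRing.mk 𝓘(ℂ, ℂ × ℂ) {0} q Z) ?_ ?_ ?_
  · rw [isUnit_mk_iff h0]
    simp [Z]
  · intro n hn
    rw [← map_pow, HypersurfaceRing.mk_eq_zero] at hn
    obtain ⟨k, hk⟩ := hn
    rw [nhdsSet_singleton] at hk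
    have h1 : ∀ᶠ z : ℂ in 𝓝[≠] 0, z ^ n = k.1 (z, 0) * q (z, 0) :=
      (hline.eventually hk).filter_mono nhdsWithin_le_nhds
    obtain ⟨z, hz1, hz2⟩ := (h1.and self_mem_nhdsWithin).exists
    rw [hq, mul_zero] at hz1
    exact pow_ne_zero n hz2 hz1
  · intro x hx
    obtain ⟨f, rfl⟩ := HypersurfaceRing.mk_surjective _ _ x
    have hf := mem_holAlg_zero.1 f.2
    have hg : AnalyticAt ℂ (fun z : ℂ => f.1 (z, 0)) 0 := by
      refine AnalyticAt.fun_comp (g := f.1) (f := fun z : ℂ => (z, (0 : ℂ))) hf ?_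
      fun_prop
    obtain ⟨h, hh, hfh⟩ := hf.exists_eq_mul_snd
    have hfst : Tendsto (fun v : ℂ × ℂ => v.1) (𝓝 0) (𝓝 0) := continuous_fst.tendsto 0
    by_cases htop : ∀ᶠ z in 𝓝 0, f.1 (z, 0) = 0
    · refine absurd (HypersurfaceRing.mk_eq_zero.2 ⟨⟨h, mem_holAlg_zero.2 hh⟩, ?_⟩) hx
      rw [nhdsSet_singleton]
      filter_upwards [hfh, hfst.eventually htop] with v h1 h2
      rw [h1, h2, hq]
      ring
    · obtain ⟨n, g, hga, hg0, hfg⟩ := hg.exists_eventuallyEq_pow_smul_nonzero_iff.2 htop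
      refine ⟨n, HypersurfaceRing.mk 𝓘(ℂ, ℂ × ℂ) {0} q
        ⟨fun v => g v.1, mem_holAlg_zero.2 ?_⟩, (isUnit_mk_iff h0).2 hg0, ?_⟩
      · exact AnalyticAt.fun_comp (g := g) (f := fun v : ℂ × ℂ => v.1) hga analyticAt_fst
      · rw [← map_pow, ← map_mul, HypersurfaceRing.mk_eq_mk]
        refine ⟨⟨h, mem_holAlg_zero.2 hh⟩, ?_⟩
        rw [nhdsSet_singleton]
        filter_upwards [hfh, hfst.eventually hfg] with v h1 h2
        change f.1 v - v.1 ^ n * g v.1 = h v * q v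
        rw [h1, h2, hq]
        simp
        ring

/-- The holomorphic inverse function theorem at the origin of `ℂ × ℂ`. -/
theorem AnalyticAt.exists_localInverse {Φ : ℂ × ℂ → ℂ × ℂ} (hΦ : AnalyticAt ℂ Φ 0) (h0 : Φ 0 = 0)
    {A : ℂ × ℂ →L[ℂ] ℂ × ℂ} (hA : HasFDerivAt Φ A 0) (hinj : Function.Injective A) :
    ∃ Ψ : ℂ × ℂ → ℂ × ℂ, AnalyticAt ℂ Ψ 0 ∧ Ψ 0 = 0 ∧ (∀ᶠ v in 𝓝 0, Ψ (Φ v) = v) ∧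
      ∀ᶠ w in 𝓝 0, Φ (Ψ w) = w := by
  let e : (ℂ × ℂ) ≃L[ℂ] ℂ × ℂ := (LinearEquiv.ofInjectiveEndo
    (A : ℂ × ℂ →ₗ[ℂ] ℂ × ℂ) hinj).toContinuousLinearEquiv
  have he : HasFDerivAt Φ (e : ℂ × ℂ →L[ℂ] ℂ × ℂ) 0 := by
    convert hA using 1
    ext <;> rfl
  have hc : ContDiffAt ℂ ω Φ 0 := contDiffAt_omega_iff.2 hΦ
  have hω : (ω : WithTop ℕ∞) ≠ 0 := by simp
  let o := hc.toOpenPartialHomeomorph Φ he hω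
  have ho : ⇑o = Φ := hc.toOpenPartialHomeomorph_coe he hω
  have hs : (0 : ℂ × ℂ) ∈ o.source := hc.mem_toOpenPartialHomeomorph_source he hω
  have ht : (0 : ℂ × ℂ) ∈ o.target := by
    have := hc.image_mem_toOpenPartialHomeomorph_target he hω
    rwa [h0] at this
  refine ⟨o.symm, ?_, ?_, ?_, ?_⟩
  · have := hc.to_localInverse he hω
    rw [h0] at this
    exact contDiffAt_omega_iff.1 this
  · have := o.left_inv hs
    rwa [ho, h0] at this
  · filter_upwards [o.open_source.mem_nhds hs] with v hv
    have := o.left_inv hv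
    rwa [ho] at this
  · filter_upwards [o.open_target.mem_nhds ht] with v hv
    have := o.right_inv hv
    rwa [ho] at this

/-- A plane curve `q = 0` with `dq ≠ 0` is smooth. -/
theorem isSmoothCurveRing_of_fderiv_ne_zero {q : ℂ × ℂ → ℂ} (hq : AnalyticAt ℂ q 0) (h0 : q 0 = 0)
    (hd : fderiv ℂ q 0 ≠ 0) :
    IsSmoothCurveRing (HypersurfaceRing 𝓘(ℂ, ℂ × ℂ) {(0 : ℂ × ℂ)} q) := by
  obtain ⟨k, hk⟩ : ∃ k : ℂ × ℂ →L[ℂ] ℂ, Function.Injective (k.prod (fderiv ℂ q 0)) := by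
    by_cases h2 : fderiv ℂ q 0 (0, 1) = 0
    · refine ⟨ContinuousLinearMap.snd ℂ ℂ ℂ, (injective_iff_map_eq_zero _).2 ?_⟩
      rintro ⟨z, t⟩ hv
      simp only [ContinuousLinearMap.prod_apply, Prod.mk_eq_zero] at hv
      obtain ⟨rfl : t = 0, hv⟩ := hv
      have h1 : fderiv ℂ q 0 (1, 0) ≠ 0 := by
        intro h1
        refine hd (ContinuousLinearMap.ext fun w => ?_)
        have : w = w.1 • ((1 : ℂ), (0 : ℂ)) + w.2 • ((0 : ℂ), (1 : ℂ)) := by ext <;> simp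
        rw [this, map_add, map_smul, map_smul, h1, h2]
        simp
      have : ((z, 0) : ℂ × ℂ) = z • ((1 : ℂ), (0 : ℂ)) := by ext <;> simp
      rw [this, map_smul, smul_eq_mul, mul_eq_zero] at hv
      simp [hv.resolve_right h1]
    · refine ⟨ContinuousLinearMap.fst ℂ ℂ ℂ, (injective_iff_map_eq_zero _).2 ?_⟩
      rintro ⟨z, t⟩ hv
      simp only [ContinuousLinearMap.prod_apply, Prod.mk_eq_zero] at hv
      obtain ⟨rfl : z = 0, hv⟩ := hv
      have : ((0, t) : ℂ × ℂ) = t • ((0 : ℂ), (1 : ℂ)) := by ext <;> simp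
      rw [this, map_smul, smul_eq_mul, mul_eq_zero] at hv
      simp [hv.resolve_right h2]
  have hΦ : AnalyticAt ℂ (fun v => (k v, q v)) 0 := (k.analyticAt 0).prod hq
  have hΦ0 : (fun v => (k v, q v)) 0 = 0 := by simp [h0]
  obtain ⟨Ψ, hΨ, hΨ0, h1, h2⟩ := hΦ.exists_localInverse hΦ0
    (k.hasFDerivAt.prodMk hq.differentiableAt.hasFDerivAt) hk
  obtain ⟨e⟩ := HypersurfaceRing.nonempty_algEquiv (q := q) (q' := fun v => v.2)
    (u := fun _ => 1) hΦ0 hΨ0 (contMDiffAt_iff_analyticAt_prod.2 hΦ)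
    (contMDiffAt_iff_analyticAt_prod.2 hΨ) h1 h2 contMDiffAt_const one_ne_zero
    (Eventually.of_forall fun v => (one_mul _).symm)
  exact (isSmoothCurveRing_snd fun _ => rfl).of_ringEquiv e.symm.toRingEquiv

/-- If `dq = 0` then the classes of both coordinates would be multiples of a uniformizer, which
contradicts the independence of their differentials. -/
theorem not_isSmoothCurveRing_of_fderiv_eq_zero {q : ℂ × ℂ → ℂ} (hq : AnalyticAt ℂ q 0)
    (h0 : q 0 = 0) (hd : fderiv ℂ q 0 = 0) :
    ¬ IsSmoothCurveRing (HypersurfaceRing 𝓘(ℂ, ℂ × ℂ) {(0 : ℂ × ℂ)} q) := by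
  rintro ⟨_, _⟩
  obtain ⟨ϖ, hϖ⟩ := IsDiscreteValuationRing.exists_irreducible
    (HypersurfaceRing 𝓘(ℂ, ℂ × ℂ) {(0 : ℂ × ℂ)} q)
  obtain ⟨f, rfl⟩ := HypersurfaceRing.mk_surjective _ _ ϖ
  have hf := mem_holAlg_zero.1 f.2
  have hf0 : f.1 0 = 0 := by
    by_contra h
    exact hϖ.not_isUnit ((isUnit_mk_iff h0).2 h)
  have key : ∀ k : ℂ × ℂ →L[ℂ] ℂ, ∃ c : ℂ, k = c • fderiv ℂ f.1 0 := by
    intro k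
    let K : holAlg 𝓘(ℂ, ℂ × ℂ) {(0 : ℂ × ℂ)} := ⟨k, mem_holAlg_zero.2 (k.analyticAt 0)⟩
    have hK : HypersurfaceRing.mk 𝓘(ℂ, ℂ × ℂ) {(0 : ℂ × ℂ)} q K ∈
        IsLocalRing.maximalIdeal (HypersurfaceRing 𝓘(ℂ, ℂ × ℂ) {(0 : ℂ × ℂ)} q) := by
      rw [IsLocalRing.mem_maximalIdeal, mem_nonunits_iff, isUnit_mk_iff h0]
      simp [K]
    rw [hϖ.maximalIdeal_eq, Ideal.mem_span_singleton] at hK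
    obtain ⟨x, hx⟩ := hK
    obtain ⟨g, rfl⟩ := HypersurfaceRing.mk_surjective _ _ x
    rw [← map_mul, HypersurfaceRing.mk_eq_mk] at hx
    obtain ⟨b, hb⟩ := hx
    rw [nhdsSet_singleton] at hb
    have hg := mem_holAlg_zero.1 g.2
    have hba := mem_holAlg_zero.1 b.2
    refine ⟨g.1 0, ?_⟩
    have h1 : (k : ℂ × ℂ → ℂ) =ᶠ[𝓝 0] fun v => f.1 v * g.1 v + b.1 v * q v := by
      filter_upwards [hb] with v hv
      change k v - f.1 v * g.1 v = b.1 v * q v at hv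
      linear_combination hv
    have h2 := h1.fderiv_eq (𝕜 := ℂ)
    have h3 := (hf.differentiableAt.hasFDerivAt.mul hg.differentiableAt.hasFDerivAt).add
      (hba.differentiableAt.hasFDerivAt.mul hq.differentiableAt.hasFDerivAt)
    rw [k.fderiv] at h2
    rw [h2]
    refine h3.fderiv.trans (ContinuousLinearMap.ext fun v => ?_)
    simp [hf0, h0, hd]
  obtain ⟨c, hc⟩ := key (ContinuousLinearMap.fst ℂ ℂ ℂ)
  obtain ⟨d, hd'⟩ := key (ContinuousLinearMap.snd ℂ ℂ ℂ)
  have e1 := congrArg (fun k : ℂ × ℂ →L[ℂ] ℂ => k (1, 0)) hc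
  have e2 := congrArg (fun k : ℂ × ℂ →L[ℂ] ℂ => k (1, 0)) hd'
  have e3 := congrArg (fun k : ℂ × ℂ →L[ℂ] ℂ => k (0, 1)) hd'
  simp at e1 e2 e3
  rcases e2 with rfl | e2
  · simp at e3
  · simp [e2] at e1

/-- The Jacobian criterion for plane curves, including non-reduced ones. -/
theorem isSmoothCurveRing_iff_fderiv_ne_zero {q : ℂ × ℂ → ℂ} (hq : AnalyticAt ℂ q 0)
    (h0 : q 0 = 0) :
    IsSmoothCurveRing (HypersurfaceRing 𝓘(ℂ, ℂ × ℂ) {(0 : ℂ × ℂ)} q) ↔ fderiv ℂ q 0 ≠ 0 :=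
  ⟨fun h hd => not_isSmoothCurveRing_of_fderiv_eq_zero hq h0 hd h,
    isSmoothCurveRing_of_fderiv_ne_zero hq h0⟩

end PlaneCurves

/-! ### Weierstrass preparation in degree one and singularities of type `A_k` -/

/-- A nonvanishing holomorphic germ of one variable has a holomorphic `m`-th root. -/
theorem AnalyticAt.exists_pow_eq {g : ℂ → ℂ} {z₀ : ℂ} (hg : AnalyticAt ℂ g z₀) (h0 : g z₀ ≠ 0)
    {m : ℕ} (hm : m ≠ 0) :
    ∃ ρ : ℂ → ℂ, AnalyticAt ℂ ρ z₀ ∧ ρ z₀ ≠ 0 ∧ ∀ z, ρ z ^ m = g z := by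
  have hpow : ∀ z, (g z₀ ^ (m⁻¹ : ℂ) * (g z / g z₀) ^ (m⁻¹ : ℂ)) ^ m = g z := by
    intro z
    rw [mul_pow, Complex.cpow_nat_inv_pow _ hm, Complex.cpow_nat_inv_pow _ hm]
    field_simp
  refine ⟨fun z => g z₀ ^ (m⁻¹ : ℂ) * (g z / g z₀) ^ (m⁻¹ : ℂ), ?_, ?_, hpow⟩
  · refine analyticAt_const.mul (AnalyticAt.cpow (hg.div_const) analyticAt_const ?_)
    rw [div_self h0]
    exact Complex.one_mem_slitPlane
  · intro h
    refine h0 ?_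
    rw [← hpow z₀]
    simp only at h
    rw [h, zero_pow hm]

/-- If `∂Q/∂u ≠ 0` then `Q` is a unit multiple of `u - g(z)`. -/
theorem AnalyticAt.exists_eq_mul_snd_sub {Q : ℂ × ℂ → ℂ} (hQ : AnalyticAt ℂ Q 0) (h0 : Q 0 = 0)
    (hd : fderiv ℂ Q 0 (0, 1) ≠ 0) :
    ∃ (g : ℂ → ℂ) (e : ℂ × ℂ → ℂ), AnalyticAt ℂ g 0 ∧ g 0 = 0 ∧ AnalyticAt ℂ e 0 ∧ e 0 ≠ 0 ∧
      (∀ᶠ v in 𝓝 0, Q v = e v * (v.2 - g v.1)) ∧ fderiv ℂ Q 0 (1, 0) = -(e 0 * deriv g 0) := by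
  have hinj : Function.Injective ((ContinuousLinearMap.fst ℂ ℂ ℂ).prod (fderiv ℂ Q 0)) := by
    refine (injective_iff_map_eq_zero _).2 ?_
    rintro ⟨z, t⟩ hv
    simp only [ContinuousLinearMap.prod_apply, Prod.mk_eq_zero] at hv
    obtain ⟨rfl : z = 0, hv⟩ := hv
    have : ((0, t) : ℂ × ℂ) = t • ((0 : ℂ), (1 : ℂ)) := by ext <;> simp
    rw [this, map_smul, smul_eq_mul, mul_eq_zero] at hv
    simp [hv.resolve_right hd]
  have hΦ : AnalyticAt ℂ (fun v : ℂ × ℂ => (v.1, Q v)) 0 := analyticAt_fst.prod hQ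
  have hΦ0 : (fun v : ℂ × ℂ => (v.1, Q v)) 0 = 0 := by simp [h0]
  obtain ⟨Ψ, hΨ, hΨ0, -, hΦΨ⟩ := hΦ.exists_localInverse hΦ0
    (hasFDerivAt_fst.prodMk hQ.differentiableAt.hasFDerivAt) hinj
  let ι : ℂ → ℂ × ℂ := fun z => (z, 0)
  have hι : AnalyticAt ℂ ι 0 := analyticAt_id.prod analyticAt_const
  have hg : AnalyticAt ℂ (fun z => (Ψ (ι z)).2) 0 :=
    AnalyticAt.fun_comp (g := Prod.snd) (f := fun z => Ψ (ι z)) analyticAt_snd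
      (AnalyticAt.fun_comp (g := Ψ) (f := ι) hΨ hι)
  set g : ℂ → ℂ := fun z => (Ψ (ι z)).2 with hgdef
  have hg0 : g 0 = 0 := by
    change (Ψ 0).2 = 0
    rw [hΨ0]
    rfl
  have hQg : ∀ᶠ z in 𝓝 0, Q (z, g z) = 0 := by
    filter_upwards [hι.continuousAt.eventually hΦΨ] with z hz
    have h1 : (Ψ (ι z)).1 = z := congrArg Prod.fst hz
    have h2 : Q (Ψ (ι z)) = 0 := congrArg Prod.snd hz
    have h3 : Ψ (ι z) = (z, g z) := Prod.ext h1 rfl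
    rwa [h3] at h2
  have hgf : AnalyticAt ℂ (fun v : ℂ × ℂ => g v.1) 0 :=
    AnalyticAt.fun_comp (g := g) (f := fun v : ℂ × ℂ => v.1) hg analyticAt_fst
  let σ : ℂ × ℂ → ℂ × ℂ := fun v => (v.1, v.2 + g v.1)
  have hσ : AnalyticAt ℂ σ 0 := analyticAt_fst.prod (analyticAt_snd.add hgf)
  have hσ0 : σ 0 = 0 := by simp [σ, hg0]
  let τ : ℂ × ℂ → ℂ × ℂ := fun v => (v.1, v.2 - g v.1)
  have hτ : AnalyticAt ℂ τ 0 := analyticAt_fst.prod (analyticAt_snd.sub hgf)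
  have hτ0 : τ 0 = 0 := by simp [τ, hg0]
  have hK : AnalyticAt ℂ (fun v => Q (σ v)) 0 :=
    AnalyticAt.fun_comp (g := Q) (f := σ) (by rwa [hσ0]) hσ
  obtain ⟨h, hh, hKh⟩ := hK.exists_eq_mul_snd
  have he : AnalyticAt ℂ (fun v => h (τ v)) 0 :=
    AnalyticAt.fun_comp (g := h) (f := τ) (by rwa [hτ0]) hτ
  have hev : ∀ᶠ v in 𝓝 0, Q v = h (τ v) * (v.2 - g v.1) := by
    have h1 := hτ.continuousAt.tendsto
    rw [hτ0] at h1
    have h2 : Tendsto (fun v : ℂ × ℂ => v.1) (𝓝 0) (𝓝 0) := continuous_fst.tendsto 0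
    filter_upwards [h1.eventually hKh, h2.eventually hQg] with v hv hv2
    have e1 : σ (τ v) = v := by simp [σ, τ]
    have e2 : σ ((τ v).1, 0) = (v.1, g v.1) := by simp [σ, τ]
    rw [e1, e2, hv2, zero_add] at hv
    rw [hv, mul_comm]
  have hfd : ∀ w : ℂ × ℂ, fderiv ℂ Q 0 w = h 0 * (w.2 - deriv g 0 * w.1) := by
    intro w
    have h1 := (show Q =ᶠ[𝓝 0] fun v => h (τ v) * (v.2 - g v.1) from hev).fderiv_eq (𝕜 := ℂ)
    have h2 : HasFDerivAt (fun v : ℂ × ℂ => g v.1)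
        (deriv g 0 • ContinuousLinearMap.fst ℂ ℂ ℂ) 0 :=
      HasDerivAt.comp_hasFDerivAt (h₂ := g) (f := Prod.fst) (0 : ℂ × ℂ)
        hg.differentiableAt.hasDerivAt hasFDerivAt_fst
    have h3 := he.differentiableAt.hasFDerivAt.mul (hasFDerivAt_snd.sub h2)
    rw [h1]
    have h4 := DFunLike.congr_fun h3.fderiv w
    refine h4.trans ?_
    simp [hg0, hτ0]
  refine ⟨g, fun v => h (τ v), hg, hg0, he, ?_, hev, ?_⟩
  · intro hz
    simp only [hτ0] at hz
    exact hd (by rw [hfd, hz, zero_mul])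
  · rw [hfd]
    simp [hτ0]

theorem analyticAt_sq_snd : AnalyticAt ℂ (fun v : ℂ × ℂ => (v.1, v.2 ^ 2)) 0 :=
  analyticAt_fst.prod (analyticAt_snd.pow 2)

theorem tendsto_sq_snd : Tendsto (fun v : ℂ × ℂ => (v.1, v.2 ^ 2)) (𝓝 0) (𝓝 0) := by
  have h : Continuous fun v : ℂ × ℂ => (v.1, v.2 ^ 2) := by fun_prop
  exact h.tendsto' 0 0 (by simp)

theorem AnalyticAt.comp_sq_snd {f : ℂ × ℂ → ℂ} (hf : AnalyticAt ℂ f 0) :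
    AnalyticAt ℂ (fun v : ℂ × ℂ => f (v.1, v.2 ^ 2)) 0 := by
  refine AnalyticAt.fun_comp (g := f) (f := fun v : ℂ × ℂ => (v.1, v.2 ^ 2)) ?_ analyticAt_sq_snd
  have : ((0 : ℂ × ℂ).1, (0 : ℂ × ℂ).2 ^ 2) = 0 := by simp
  rwa [this]

/-- The double cover `t ^ 2 = u` of a curve `Q(z, u) = 0` that is transversal to the lines
`z = const` has a singularity of type `A_k`, unless it contains a double line. -/
theorem nonempty_algEquiv_AkRing {Q P : ℂ × ℂ → ℂ} (hQ : AnalyticAt ℂ Q 0) (h0 : Q 0 = 0)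
    (hd : fderiv ℂ Q 0 (0, 1) ≠ 0) (hd' : fderiv ℂ Q 0 (1, 0) = 0)
    (hne : ¬ ∀ᶠ z in 𝓝 0, Q (z, 0) = 0) (hP : ∀ᶠ v in 𝓝 0, P v = Q (v.1, v.2 ^ 2)) :
    ∃ k : ℕ, 1 ≤ k ∧
      Nonempty (HypersurfaceRing 𝓘(ℂ, ℂ × ℂ) {(0 : ℂ × ℂ)} P ≃ₐ[ℂ] AkRing k) := by
  obtain ⟨g, e, hg, hg0, he, he0, hQe, hdg⟩ := hQ.exists_eq_mul_snd_sub h0 hd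
  have hg1 : deriv g 0 = 0 := by
    rw [hd', eq_comm, neg_eq_zero, mul_eq_zero] at hdg
    exact hdg.resolve_left he0
  have hline : Tendsto (fun z : ℂ => (z, (0 : ℂ))) (𝓝 0) (𝓝 0) := by
    have : Continuous fun z : ℂ => (z, (0 : ℂ)) := by fun_prop
    exact this.tendsto 0
  have hgne : ¬ ∀ᶠ z in 𝓝 0, g z = 0 := by
    intro hz
    refine hne ?_
    filter_upwards [hz, hline.eventually hQe] with z h1 h2
    rw [h2, h1]
    simp
  obtain ⟨m, e₁, he₁, he₁0, hge⟩ := hg.exists_eventuallyEq_pow_smul_nonzero_iff.2 hgne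
  simp only [sub_zero, smul_eq_mul] at hge
  have hm0 : m ≠ 0 := by
    rintro rfl
    have := hge.self_of_nhds
    rw [hg0] at this
    exact he₁0 (by simpa using this.symm)
  have hm1 : m ≠ 1 := by
    rintro rfl
    have h1 := (show g =ᶠ[𝓝 0] fun z => z ^ 1 * e₁ z from hge).deriv_eq
    have h2 := ((hasDerivAt_id (0 : ℂ)).mul he₁.differentiableAt.hasDerivAt).deriv
    simp only [pow_one] at h1
    rw [hg1] at h1
    have h3 := h1.trans h2
    exact he₁0 (by simpa using h3.symm)
  obtain ⟨ρ, hρ, hρ0, hρm⟩ := he₁.exists_pow_eq he₁0 hm0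
  obtain ⟨k, rfl⟩ : ∃ k, m = k + 1 := ⟨m - 1, by omega⟩
  refine ⟨k, by omega, ?_⟩
  have hρf : AnalyticAt ℂ (fun v : ℂ × ℂ => ρ v.1) 0 :=
    AnalyticAt.fun_comp (g := ρ) (f := fun v : ℂ × ℂ => v.1) hρ analyticAt_fst
  let Φ : ℂ × ℂ → ℂ × ℂ := fun v => (v.1 * ρ v.1, v.2)
  have hΦ : AnalyticAt ℂ Φ 0 := (analyticAt_fst.mul hρf).prod analyticAt_snd
  have hΦ0 : Φ 0 = 0 := by simp [Φ]
  obtain ⟨Ψ, hΨ, hΨ0, h1, h2⟩ := hΦ.exists_localInverse hΦ0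
    ((hasFDerivAt_fst.mul hρf.differentiableAt.hasFDerivAt).prodMk hasFDerivAt_snd) (by
      refine (injective_iff_map_eq_zero _).2 ?_
      rintro ⟨z, t⟩ hv
      simp [hρ0] at hv
      simp [hv])
  refine HypersurfaceRing.nonempty_algEquiv hΦ0 hΨ0 (contMDiffAt_iff_analyticAt_prod.2 hΦ)
    (contMDiffAt_iff_analyticAt_prod.2 hΨ) h1 h2 (contMDiffAt_iff_analyticAt_prod.2 he.comp_sq_snd)
    (by simpa [← Prod.zero_eq_mk] using he0) ?_
  have h4 : Tendsto (fun v : ℂ × ℂ => v.1) (𝓝 0) (𝓝 0) := continuous_fst.tendsto 0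
  filter_upwards [hP, tendsto_sq_snd.eventually hQe, h4.eventually hge] with v e1 e2 e3
  rw [e1, e2, e3]
  simp only [Φ, mul_pow, hρm]

/-! ### Coordinates on a line bundle and its powers -/

section LineBundle
set_option linter.unusedSectionVars false
variable {X : Type*} [TopologicalSpace X] [ChartedSpace ℂ X]
  {M : X → Type*} [TopologicalSpace (TotalSpace ℂ M)] [∀ x, TopologicalSpace (M x)]
  [∀ x, AddCommGroup (M x)] [∀ x, Module ℂ (M x)] [FiberBundle ℂ M] [VectorBundle ℂ ℂ M]

theorem fibreCoord_of_mem {x : X} {v : TotalSpace ℂ M}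
    (hv : v.1 ∈ (trivializationAt ℂ M x).baseSet) :
    fibreCoord M x v = (trivializationAt ℂ M x v).2 := by
  rw [fibreCoord, Trivialization.coe_linearMapAt_of_mem _ hv]

theorem fibreCoord_eq_zero_iff {x : X} {v : TotalSpace ℂ M}
    (hv : v.1 ∈ (trivializationAt ℂ M x).baseSet) : fibreCoord M x v = 0 ↔ v.2 = 0 := by
  rw [fibreCoord, Trivialization.linearMapAt_def_of_mem _ hv]
  exact LinearEquiv.map_eq_zero_iff _

/-- The coordinate on a fibre is a linear isomorphism over the domain of the trivialization. -/
theorem exists_linearMapAt_eq_one {x y : X} (hy : y ∈ (trivializationAt ℂ M x).baseSet) :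
    ∃ v₀ : M y, (trivializationAt ℂ M x).linearMapAt ℂ y v₀ = 1 ∧
      ∀ v, v = (trivializationAt ℂ M x).linearMapAt ℂ y v • v₀ := by
  rw [Trivialization.linearMapAt_def_of_mem _ hy]
  set L := (trivializationAt ℂ M x).linearEquivAt ℂ y hy
  refine ⟨L.symm 1, L.apply_symm_apply 1, fun v => L.injective ?_⟩
  simp

theorem powCoord_tprod (x y : X) (k : ℕ) (v : Fin k → M y) :
    powCoord M x k y (PiTensorProduct.tprod ℂ v) =
      ∏ i, (trivializationAt ℂ M x).linearMapAt ℂ y (v i) := by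
  simp [powCoord]

/-- The coordinate on `M ^ k` is injective on fibres, since a power of a line is spanned by a single
pure tensor. -/
theorem powCoord_eq_zero_iff {x y : X} (hy : y ∈ (trivializationAt ℂ M x).baseSet) {k : ℕ}
    {s : ⨂[ℂ]^k (M y)} : powCoord M x k y s = 0 ↔ s = 0 := by
  refine ⟨fun h => ?_, fun h => by rw [h, map_zero]⟩
  obtain ⟨v₀, -, hv₀⟩ := exists_linearMapAt_eq_one hy
  have key : (LinearMap.id : (⨂[ℂ]^k (M y)) →ₗ[ℂ] ⨂[ℂ]^k (M y)) =
      (powCoord M x k y).smulRight (PiTensorProduct.tprod ℂ fun _ => v₀) := by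
    refine PiTensorProduct.ext (MultilinearMap.ext fun v => ?_)
    have h1 : v = fun i => (trivializationAt ℂ M x).linearMapAt ℂ y (v i) • v₀ :=
      funext fun i => hv₀ (v i)
    have h2 := (PiTensorProduct.tprod ℂ).map_smul_univ
      (fun i => (trivializationAt ℂ M x).linearMapAt ℂ y (v i)) (fun _ => v₀)
    rw [← h1, ← powCoord_tprod] at h2
    simpa using! h2
  have := LinearMap.congr_fun key s
  simpa [h] using this

/-- The transition between two trivializations multiplies the coordinate on `M` by a nonzero number
and the coordinate on `M ^ k` by its `k`-th power. -/
theorem exists_coordChange {x x' y : X} (hy : y ∈ (trivializationAt ℂ M x).baseSet)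
    (hy' : y ∈ (trivializationAt ℂ M x').baseSet) :
    ∃ c : ℂ, c ≠ 0 ∧ (∀ v : M y, fibreCoord M x ⟨y, v⟩ = c * fibreCoord M x' ⟨y, v⟩) ∧
      ∀ (k : ℕ) (s : ⨂[ℂ]^k (M y)), powCoord M x k y s = c ^ k * powCoord M x' k y s := by
  obtain ⟨v₀, h1, hv₀⟩ := exists_linearMapAt_eq_one hy'
  have hL : ∀ v : M y, (trivializationAt ℂ M x).linearMapAt ℂ y v =
      (trivializationAt ℂ M x).linearMapAt ℂ y v₀ *
        (trivializationAt ℂ M x').linearMapAt ℂ y v := by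
    intro v
    conv_lhs => rw [hv₀ v, map_smul, smul_eq_mul, mul_comm]
  refine ⟨(trivializationAt ℂ M x).linearMapAt ℂ y v₀, ?_, hL, fun k s => ?_⟩
  · intro h0
    have h2 : v₀ = 0 := (fibreCoord_eq_zero_iff (v := ⟨y, v₀⟩) hy).1 h0
    rw [h2, map_zero] at h1
    exact zero_ne_one h1
  · have key : powCoord M x k y =
        ((trivializationAt ℂ M x).linearMapAt ℂ y v₀) ^ k • powCoord M x' k y := by
      refine PiTensorProduct.ext (MultilinearMap.ext fun v => ?_)
      simp only [LinearMap.compMultilinearMap_apply, LinearMap.smul_apply]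
      rw [powCoord_tprod, powCoord_tprod, smul_eq_mul,
        Finset.prod_congr rfl fun i _ => hL (v i), Finset.prod_mul_distrib]
      simp
    rw [key]
    rfl

theorem ContMDiffAt.analyticAt_inChart {f : X → ℂ} {x : X} (hf : ContMDiffAt 𝓘(ℂ) 𝓘(ℂ) ω f x) :
    AnalyticAt ℂ (inChart f x) (chartAt ℂ x x) := by
  have h := (contMDiffAt_iff.1 hf).2
  simp only [mfld_simps] at h
  exact (contDiffWithinAt_univ.1 h).analyticAt

theorem analyticAt_localCoeff {n : ℕ} (a : HitchinBase M n) (x : X) (j : Fin n) :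
    AnalyticAt ℂ (inChart (fun y => localCoeff a x y j) x) (chartAt ℂ x x) :=
  ((a j).2 x).analyticAt_inChart

variable [IsManifold 𝓘(ℂ) ω X] [ContMDiffVectorBundle ω ℂ M 𝓘(ℂ)]

variable (M) in
/-- Holomorphic coordinates on `Tot M` centred at `p`: a chart of `X` and the fibre coordinate. -/
theorem exists_localCoord (p : TotalSpace ℂ M) :
    ∃ (φ : TotalSpace ℂ M → ℂ × ℂ) (ψ : ℂ × ℂ → TotalSpace ℂ M), φ p = 0 ∧ ψ 0 = p ∧
      ContMDiffAt (𝓘(ℂ).prod 𝓘(ℂ)) 𝓘(ℂ, ℂ × ℂ) ω φ p ∧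
      ContMDiffAt 𝓘(ℂ, ℂ × ℂ) (𝓘(ℂ).prod 𝓘(ℂ)) ω ψ 0 ∧
      (∀ᶠ v in 𝓝 p, ψ (φ v) = v) ∧ (∀ᶠ w in 𝓝 0, φ (ψ w) = w) ∧
      ∀ᶠ v in 𝓝 p, φ v = (chartAt ℂ p.1 v.1 - chartAt ℂ p.1 p.1,
        fibreCoord M p.1 v - fibreCoord M p.1 p) ∧ v.1 ∈ (chartAt ℂ p.1).source := by
  have : IsManifold (𝓘(ℂ).prod 𝓘(ℂ)) ω (TotalSpace ℂ M) := inferInstance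
  let e := extChartAt (𝓘(ℂ).prod 𝓘(ℂ)) p
  have hcont : Tendsto (fun v : TotalSpace ℂ M => v.1) (𝓝 p) (𝓝 p.1) :=
    (FiberBundle.continuous_proj ℂ M).tendsto p
  have hform : ∀ v : TotalSpace ℂ M, v.1 ∈ (trivializationAt ℂ M p.1).baseSet →
      e v = (chartAt ℂ p.1 v.1, fibreCoord M p.1 v) := by
    intro v hv
    rw [fibreCoord_of_mem hv]
    simp only [e, FiberBundle.extChartAt]
    simp [Trivialization.coe_fst' _ hv]
  have hp := mem_baseSet_trivializationAt ℂ M p.1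
  have htgt : e.target ∈ 𝓝 (e p) := extChartAt_target_mem_nhds p
  refine ⟨fun v => e v - e p, fun w => e.symm (w + e p), sub_self _, ?_, ?_, ?_, ?_, ?_, ?_⟩
  · change e.symm (0 + e p) = p
    rw [zero_add]
    exact e.left_inv (mem_extChartAt_source p)
  · exact contMDiffAt_extChartAt.sub contMDiffAt_const
  · have h1 : ContMDiffAt 𝓘(ℂ, ℂ × ℂ) (𝓘(ℂ).prod 𝓘(ℂ)) ω e.symm (0 + e p) := by
      rw [zero_add]
      exact (contMDiffOn_extChartAt_symm p).contMDiffAt htgt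
    refine ContMDiffAt.comp (0 : ℂ × ℂ) h1 ?_
    exact contMDiffAt_id.add contMDiffAt_const
  · filter_upwards [extChartAt_source_mem_nhds (I := 𝓘(ℂ).prod 𝓘(ℂ)) p] with v hv
    rw [sub_add_cancel]
    exact e.left_inv hv
  · have h1 : Tendsto (fun w : ℂ × ℂ => w + e p) (𝓝 0) (𝓝 (e p)) := by
      have : Continuous fun w : ℂ × ℂ => w + e p := by fun_prop
      exact this.tendsto' 0 _ (zero_add _)
    filter_upwards [h1 htgt] with w hw
    rw [e.right_inv hw, add_sub_cancel_right]
  · filter_upwards [hcont ((trivializationAt ℂ M p.1).open_baseSet.mem_nhds hp),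
      hcont ((chartAt ℂ p.1).open_source.mem_nhds (mem_chart_source ℂ p.1))] with v hv hv'
    refine ⟨?_, hv'⟩
    rw [hform v hv, hform p hp]
    rfl

end LineBundle

/-! ### Local equations of the spectral curve and of its quotient -/

theorem eval_quotPoly {n : ℕ} (c : Fin n → ℂ) (u : ℂ) :
    (quotPoly c).eval u = u ^ n + ∑ j : Fin n, c j * u ^ (n - ((j : ℕ) + 1)) := by
  simp [quotPoly, eval_finsetSum]

/-- The differential of `Q(z, t ^ 2)` at `t = t₀`, in coordinates centred at that point. -/
theorem fderiv_comp_double {Q : ℂ × ℂ → ℂ} (hQ : AnalyticAt ℂ Q 0) (t₀ : ℂ) (w : ℂ × ℂ) :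
    fderiv ℂ (fun v : ℂ × ℂ => Q (v.1, v.2 ^ 2 + 2 * t₀ * v.2)) 0 w =
      fderiv ℂ Q 0 (w.1, 2 * t₀ * w.2) := by
  have h1 : HasFDerivAt (fun v : ℂ × ℂ => (v.1, v.2 ^ 2 + 2 * t₀ * v.2))
      ((ContinuousLinearMap.fst ℂ ℂ ℂ).prod ((2 * t₀) • ContinuousLinearMap.snd ℂ ℂ ℂ)) 0 := by
    have h2 : HasFDerivAt (fun v : ℂ × ℂ => v.2 ^ 2 + 2 * t₀ * v.2)
        ((2 * (0 : ℂ × ℂ).2 ^ 1) • ContinuousLinearMap.snd ℂ ℂ ℂ +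
          (2 * t₀) • ContinuousLinearMap.snd ℂ ℂ ℂ) 0 := by
      refine HasFDerivAt.add ?_ (hasFDerivAt_snd.const_mul (2 * t₀))
      simpa using! (hasFDerivAt_snd (𝕜 := ℂ) (p := (0 : ℂ × ℂ))).pow 2
    exact hasFDerivAt_fst.prodMk (h2.congr_fderiv (ContinuousLinearMap.ext fun v => by simp))
  have h3 : HasFDerivAt Q (fderiv ℂ Q 0) ((0 : ℂ × ℂ).1, (0 : ℂ × ℂ).2 ^ 2 + 2 * t₀ * (0 : ℂ × ℂ).2) := by
    have : ((0 : ℂ × ℂ).1, (0 : ℂ × ℂ).2 ^ 2 + 2 * t₀ * (0 : ℂ × ℂ).2) = 0 := by simp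
    rw [this]
    exact hQ.differentiableAt.hasFDerivAt
  have h4 := (h3.comp (0 : ℂ × ℂ) h1).fderiv
  exact DFunLike.congr_fun h4 w

theorem analyticAt_comp_double {Q : ℂ × ℂ → ℂ} (hQ : AnalyticAt ℂ Q 0) (t₀ : ℂ) :
    AnalyticAt ℂ (fun v : ℂ × ℂ => Q (v.1, v.2 ^ 2 + 2 * t₀ * v.2)) 0 := by
  refine AnalyticAt.fun_comp (g := Q) (f := fun v : ℂ × ℂ => (v.1, v.2 ^ 2 + 2 * t₀ * v.2)) ?_ ?_
  · have : ((0 : ℂ × ℂ).1, (0 : ℂ × ℂ).2 ^ 2 + 2 * t₀ * (0 : ℂ × ℂ).2) = 0 := by simp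
    rwa [this]
  · exact analyticAt_fst.prod ((analyticAt_snd.pow 2).add (analyticAt_const.mul analyticAt_snd))

section LineBundle

set_option linter.unusedSectionVars false

variable {X : Type*} [TopologicalSpace X] [ChartedSpace ℂ X]
  {M : X → Type*} [TopologicalSpace (TotalSpace ℂ M)] [∀ x, TopologicalSpace (M x)]
  [∀ x, AddCommGroup (M x)] [∀ x, Module ℂ (M x)] [FiberBundle ℂ M] [VectorBundle ℂ ℂ M]
  {n : ℕ} (a : HitchinBase M n)

/-- The equation `u ^ n + a_2 u ^ (n-1) + ⋯ + a_{2n} = 0` of `Σ/σ` near a point over `x`, in the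
coordinate `z` of `X` and the coordinate `u = t ^ 2` on `M ^ 2`, both shifted so that the point in
question, at height `u₀`, becomes the origin. -/
noncomputable def quotientEq (x : X) (u₀ : ℂ) (v : ℂ × ℂ) : ℂ :=
  (quotPoly (localCoeff a x ((chartAt ℂ x).symm (v.1 + chartAt ℂ x x)))).eval (v.2 + u₀)

theorem eval_charPoly (x y : X) (t : ℂ) :
    (charPoly a x y).eval t = (quotPoly (localCoeff a x y)).eval (t ^ 2) := by
  rw [eval_quotPoly]
  simp [charPoly, eval_finsetSum, ← pow_mul, Nat.mul_sub]

theorem analyticAt_quotientEq (x : X) (u₀ : ℂ) : AnalyticAt ℂ (quotientEq a x u₀) 0 := by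
  have h : quotientEq a x u₀ = fun v => (v.2 + u₀) ^ n + ∑ j : Fin n,
      inChart (fun y => localCoeff a x y j) x (v.1 + chartAt ℂ x x) *
        (v.2 + u₀) ^ (n - ((j : ℕ) + 1)) := by
    funext v
    rw [quotientEq, eval_quotPoly]
    rfl
  rw [h]
  have hs : AnalyticAt ℂ (fun v : ℂ × ℂ => v.2 + u₀) 0 := analyticAt_snd.add analyticAt_const
  refine (hs.pow n).add (Finset.analyticAt_fun_sum _ fun j _ => AnalyticAt.mul ?_ (hs.pow _))
  refine AnalyticAt.fun_comp (g := inChart (fun y => localCoeff a x y j) x)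
    (f := fun v : ℂ × ℂ => v.1 + chartAt ℂ x x) ?_ (analyticAt_fst.add analyticAt_const)
  simpa using analyticAt_localCoeff a x j

theorem quotientEq_zero (x : X) (u₀ : ℂ) :
    quotientEq a x u₀ 0 = (quotPoly (localCoeff a x x)).eval u₀ := by
  simp [quotientEq]

theorem mem_spectralCurve_iff {p : TotalSpace ℂ M} :
    p ∈ spectralCurve a ↔ quotientEq a p.1 (fibreCoord M p.1 p ^ 2) 0 = 0 := by
  rw [quotientEq_zero, ← eval_charPoly]
  rfl

/-- The derivative of the local equation along the fibre. -/
theorem fderiv_quotientEq_snd (x : X) (u₀ : ℂ) :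
    fderiv ℂ (quotientEq a x u₀) 0 (0, 1) =
      (quotPoly (localCoeff a x x)).derivative.eval u₀ := by
  have h1 : HasDerivAt (fun u : ℂ => ((0 : ℂ), u)) (0, 1) 0 :=
    (hasDerivAt_const _ _).prodMk (hasDerivAt_id _)
  have h2 := HasFDerivAt.comp_hasDerivAt (x := (0 : ℂ)) (f := fun u : ℂ => ((0 : ℂ), u))
    (l := quotientEq a x u₀) (analyticAt_quotientEq a x u₀).differentiableAt.hasFDerivAt h1
  have h3 : HasDerivAt (fun u : ℂ => (quotPoly (localCoeff a x x)).eval (u + u₀))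
      ((quotPoly (localCoeff a x x)).derivative.eval u₀) 0 := by
    have := (quotPoly (localCoeff a x x)).hasDerivAt (0 + u₀)
    simpa using! this.comp_add_const (0 : ℂ) u₀
  have h4 : (quotientEq a x u₀ ∘ fun u : ℂ => ((0 : ℂ), u)) =
      fun u => (quotPoly (localCoeff a x x)).eval (u + u₀) := by
    funext u
    simp [quotientEq]
  rw [h4] at h2
  exact h2.unique h3

/-- The derivative of the local equation along the base. -/
theorem fderiv_quotientEq_fst (x : X) (u₀ : ℂ) :
    fderiv ℂ (quotientEq a x u₀) 0 (1, 0) =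
      deriv (fun z => (quotPoly (localCoeff a x ((chartAt ℂ x).symm z))).eval u₀)
        (chartAt ℂ x x) := by
  have h1 : HasDerivAt (fun z : ℂ => (z, (0 : ℂ))) (1, 0) 0 :=
    (hasDerivAt_id _).prodMk (hasDerivAt_const _ _)
  have h2 := (HasFDerivAt.comp_hasDerivAt (x := (0 : ℂ)) (f := fun z : ℂ => (z, (0 : ℂ)))
    (l := quotientEq a x u₀) (analyticAt_quotientEq a x u₀).differentiableAt.hasFDerivAt h1).deriv
  have h3 := deriv_comp_add_const
    (fun z => (quotPoly (localCoeff a x ((chartAt ℂ x).symm z))).eval u₀) (chartAt ℂ x x) 0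
  rw [zero_add] at h3
  rw [← h2, ← h3]
  congr 1
  funext z
  simp [quotientEq]

variable [IsManifold 𝓘(ℂ) ω X] [ContMDiffVectorBundle ω ℂ M 𝓘(ℂ)]

/-- Coordinates centred at `p` in which the spectral curve is the pullback of `quotientEq` under
`(z, t) ↦ (z, t ^ 2)`. -/
theorem exists_spectralCoord (p : TotalSpace ℂ M) :
    ∃ (φ : TotalSpace ℂ M → ℂ × ℂ) (ψ : ℂ × ℂ → TotalSpace ℂ M), φ p = 0 ∧ ψ 0 = p ∧
      ContMDiffAt (𝓘(ℂ).prod 𝓘(ℂ)) 𝓘(ℂ, ℂ × ℂ) ω φ p ∧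
      ContMDiffAt 𝓘(ℂ, ℂ × ℂ) (𝓘(ℂ).prod 𝓘(ℂ)) ω ψ 0 ∧
      (∀ᶠ v in 𝓝 p, ψ (φ v) = v) ∧ (∀ᶠ w in 𝓝 0, φ (ψ w) = w) ∧
      (∀ᶠ v in 𝓝 p, φ v = (chartAt ℂ p.1 v.1 - chartAt ℂ p.1 p.1,
        fibreCoord M p.1 v - fibreCoord M p.1 p)) ∧
      ∀ᶠ v in 𝓝 p, spectralEq a p.1 v = quotientEq a p.1 (fibreCoord M p.1 p ^ 2)
        ((φ v).1, (φ v).2 ^ 2 + 2 * fibreCoord M p.1 p * (φ v).2) := by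
  obtain ⟨φ, ψ, h1, h2, h3, h4, h5, h6, h7⟩ := exists_localCoord M p
  refine ⟨φ, ψ, h1, h2, h3, h4, h5, h6, h7.mono fun v hv => hv.1, ?_⟩
  filter_upwards [h7] with v ⟨hv, hs⟩
  have e1 : (φ v).1 + chartAt ℂ p.1 p.1 = chartAt ℂ p.1 v.1 := by
    rw [hv]
    ring
  have e2 : (φ v).2 ^ 2 + 2 * fibreCoord M p.1 p * (φ v).2 + fibreCoord M p.1 p ^ 2 =
      fibreCoord M p.1 v ^ 2 := by
    rw [hv]
    ring
  rw [spectralEq, eval_charPoly, quotientEq, e2, e1, (chartAt ℂ p.1).left_inv hs]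

/-- The local ring of the spectral curve in coordinates. -/
theorem nonempty_spectralLocalRing_algEquiv (p : TotalSpace ℂ M) {P : ℂ × ℂ → ℂ}
    (hP : ∀ v, P v = quotientEq a p.1 (fibreCoord M p.1 p ^ 2)
      (v.1, v.2 ^ 2 + 2 * fibreCoord M p.1 p * v.2)) :
    Nonempty (SpectralLocalRing a p ≃ₐ[ℂ] HypersurfaceRing 𝓘(ℂ, ℂ × ℂ) {(0 : ℂ × ℂ)} P) := by
  obtain ⟨φ, ψ, h1, h2, h3, h4, h5, h6, -, h8⟩ := exists_spectralCoord a p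
  refine HypersurfaceRing.nonempty_algEquiv h1 h2 h3 h4 h5 h6 (u := fun _ => 1) contMDiffAt_const
    one_ne_zero ?_
  filter_upwards [h8] with v hv
  rw [hv, hP, one_mul]

theorem isSmoothCurveRing_spectralLocalRing_iff {p : TotalSpace ℂ M} (hp : p ∈ spectralCurve a) :
    IsSmoothCurveRing (SpectralLocalRing a p) ↔ ∃ w : ℂ × ℂ,
      fderiv ℂ (quotientEq a p.1 (fibreCoord M p.1 p ^ 2)) 0
        (w.1, 2 * fibreCoord M p.1 p * w.2) ≠ 0 := by
  obtain ⟨e⟩ := nonempty_spectralLocalRing_algEquiv a p (fun _ => rfl)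
  have hQ := analyticAt_quotientEq a p.1 (fibreCoord M p.1 p ^ 2)
  rw [isSmoothCurveRing_congr e.toRingEquiv,
    isSmoothCurveRing_iff_fderiv_ne_zero (analyticAt_comp_double hQ _)]
  · simp only [← fderiv_comp_double hQ]
    rw [Ne, ContinuousLinearMap.ext_iff, not_forall]
    rfl
  · rw [mem_spectralCurve_iff] at hp
    simpa [← Prod.zero_eq_mk] using hp

end LineBundle

/-! ### The local rings of the quotient curve -/

section LineBundle

set_option linter.unusedSectionVars false

variable {X : Type*} [TopologicalSpace X] [ChartedSpace ℂ X]
  {M : X → Type*} [TopologicalSpace (TotalSpace ℂ M)] [∀ x, TopologicalSpace (M x)]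
  [∀ x, AddCommGroup (M x)] [∀ x, Module ℂ (M x)] [FiberBundle ℂ M] [VectorBundle ℂ ℂ M]
  {n : ℕ} (a : HitchinBase M n)

theorem eventually_nhdsSet_reflOrbit {p : TotalSpace ℂ M} {P : TotalSpace ℂ M → Prop} :
    (∀ᶠ v in 𝓝ˢ (reflOrbit M p), P v) ↔
      (∀ᶠ v in 𝓝 p, P v) ∧ ∀ᶠ v in 𝓝 (reflection M p), P v := by
  rw [reflOrbit, nhdsSet_insert, nhdsSet_singleton, eventually_sup]

theorem mem_holAlg_reflOrbit {p : TotalSpace ℂ M} {f : TotalSpace ℂ M → ℂ} :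
    f ∈ holAlg (𝓘(ℂ).prod 𝓘(ℂ)) (reflOrbit M p) ↔
      ContMDiffAt (𝓘(ℂ).prod 𝓘(ℂ)) 𝓘(ℂ) ω f p ∧
        ContMDiffAt (𝓘(ℂ).prod 𝓘(ℂ)) 𝓘(ℂ) ω f (reflection M p) := by
  refine ⟨fun h => ⟨h p (Or.inl rfl), h _ (Or.inr rfl)⟩, ?_⟩
  rintro ⟨h1, h2⟩ _ (rfl | rfl)
  · exact h1
  · exact h2

theorem mem_holAlg_singleton {p : TotalSpace ℂ M} {f : TotalSpace ℂ M → ℂ} :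
    f ∈ holAlg (𝓘(ℂ).prod 𝓘(ℂ)) {p} ↔ ContMDiffAt (𝓘(ℂ).prod 𝓘(ℂ)) 𝓘(ℂ) ω f p := by
  simp [holAlg]

variable [IsManifold 𝓘(ℂ) ω X] [ContMDiffVectorBundle ω ℂ M 𝓘(ℂ)]

theorem tendsto_reflection (p : TotalSpace ℂ M) :
    Tendsto (reflection M) (𝓝 p) (𝓝 (reflection M p)) :=
  (contMDiff_reflection M).continuous.tendsto p

theorem ContMDiffAt.comp_reflection {f : TotalSpace ℂ M → ℂ} {p : TotalSpace ℂ M}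
    (hf : ContMDiffAt (𝓘(ℂ).prod 𝓘(ℂ)) 𝓘(ℂ) ω f (reflection M p)) :
    ContMDiffAt (𝓘(ℂ).prod 𝓘(ℂ)) 𝓘(ℂ) ω (fun v => f (reflection M v)) p :=
  ContMDiffAt.comp p hf (contMDiff_reflection M p)

theorem mk_mem_quotientLocalRing {p : TotalSpace ℂ M}
    {f : holAlg (𝓘(ℂ).prod 𝓘(ℂ)) (reflOrbit M p)} :
    HypersurfaceRing.mk _ (reflOrbit M p) (spectralEq a p.1) f ∈ QuotientLocalRing a p ↔
      ∃ h : holAlg (𝓘(ℂ).prod 𝓘(ℂ)) (reflOrbit M p), ∀ᶠ v in 𝓝ˢ (reflOrbit M p),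
        f.1 (reflection M v) - f.1 v = h.1 v * spectralEq a p.1 v := by
  rw [QuotientLocalRing, AlgHom.mem_equalizer, sigmaAction, HypersurfaceRing.map_mk]
  exact HypersurfaceRing.mk_eq_mk

theorem continuousAt_fibreCoord (p : TotalSpace ℂ M) : ContinuousAt (fibreCoord M p.1) p := by
  obtain ⟨φ, ψ, h1, -, h3, -, -, -, h7⟩ := exists_localCoord M p
  have h8 : ContinuousAt (fun v => (φ v).2 + fibreCoord M p.1 p) p :=
    (continuous_snd.continuousAt.comp h3.continuousAt).add continuousAt_const
  refine h8.congr ?_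
  filter_upwards [h7] with v hv
  rw [hv.1]
  ring

/-- Away from the zero section the fibre coordinate separates the two points of an orbit. -/
theorem eventually_re_fibreCoord {p : TotalSpace ℂ M} (hp : fibreCoord M p.1 p ≠ 0) :
    ∀ᶠ v in 𝓝 p, 0 < (fibreCoord M p.1 v / fibreCoord M p.1 p).re := by
  have h1 : ContinuousAt (fun v => (fibreCoord M p.1 v / fibreCoord M p.1 p).re) p :=
    Complex.continuous_re.continuousAt.comp ((continuousAt_fibreCoord p).div_const _)
  refine h1.eventually_const_lt ?_
  simp [div_self hp]

theorem eventually_re_fibreCoord_reflection {p : TotalSpace ℂ M} (hp : fibreCoord M p.1 p ≠ 0) :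
    ∀ᶠ v in 𝓝 (reflection M p), (fibreCoord M p.1 v / fibreCoord M p.1 p).re < 0 := by
  have h1 := tendsto_reflection (reflection M p)
  rw [reflection_reflection] at h1
  filter_upwards [h1.eventually (eventually_re_fibreCoord hp)] with v hv
  rw [fibreCoord_reflection, neg_div, Complex.neg_re] at hv
  linarith

open Classical in
/-- The function that agrees with `f` near `p` and with `g` near the reflected point. -/
noncomputable def glueOrbit (p : TotalSpace ℂ M) (f g : TotalSpace ℂ M → ℂ)
    (v : TotalSpace ℂ M) : ℂ :=
  if 0 < (fibreCoord M p.1 v / fibreCoord M p.1 p).re then f v else g v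

theorem glueOrbit_eventuallyEq_left {p : TotalSpace ℂ M} (hp : fibreCoord M p.1 p ≠ 0)
    (f g : TotalSpace ℂ M → ℂ) : ∀ᶠ v in 𝓝 p, glueOrbit p f g v = f v := by
  filter_upwards [eventually_re_fibreCoord hp] with v hv
  rw [glueOrbit, if_pos hv]

theorem glueOrbit_eventuallyEq_right {p : TotalSpace ℂ M} (hp : fibreCoord M p.1 p ≠ 0)
    (f g : TotalSpace ℂ M → ℂ) : ∀ᶠ v in 𝓝 (reflection M p), glueOrbit p f g v = g v := by
  filter_upwards [eventually_re_fibreCoord_reflection hp] with v hv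
  rw [glueOrbit, if_neg hv.not_gt]

theorem glueOrbit_mem_holAlg {p : TotalSpace ℂ M} (hp : fibreCoord M p.1 p ≠ 0)
    {f g : TotalSpace ℂ M → ℂ} (hf : ContMDiffAt (𝓘(ℂ).prod 𝓘(ℂ)) 𝓘(ℂ) ω f p)
    (hg : ContMDiffAt (𝓘(ℂ).prod 𝓘(ℂ)) 𝓘(ℂ) ω g (reflection M p)) :
    glueOrbit p f g ∈ holAlg (𝓘(ℂ).prod 𝓘(ℂ)) (reflOrbit M p) :=
  mem_holAlg_reflOrbit.2 ⟨hf.congr_of_eventuallyEq (glueOrbit_eventuallyEq_left hp f g),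
    hg.congr_of_eventuallyEq (glueOrbit_eventuallyEq_right hp f g)⟩

/-- Away from the zero section `Σ → Σ/σ` is a local isomorphism: an invariant germ along an orbit
is determined by its restriction to one of the two points, which is arbitrary. -/
theorem nonempty_quotientLocalRing_ringEquiv {p : TotalSpace ℂ M} (hp : fibreCoord M p.1 p ≠ 0) :
    Nonempty (QuotientLocalRing a p ≃+* SpectralLocalRing a p) := by
  let r : OrbitRing a p →ₐ[ℂ] SpectralLocalRing a p :=
    HypersurfaceRing.comap id (S := {p}) (S' := reflOrbit M p) (q := spectralEq a p.1)
      (q' := spectralEq a p.1) (by rintro _ rfl; exact Or.inl rfl) (fun _ _ => contMDiffAt_id) 1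
      (Eventually.of_forall fun v => (one_mul _).symm)
  let s : QuotientLocalRing a p →+* SpectralLocalRing a p :=
    (r.comp (QuotientLocalRing a p).val).toRingHom
  have hq : ∀ v, spectralEq a p.1 (reflection M v) = spectralEq a p.1 v :=
    spectralEq_reflection a p.1
  have hback := tendsto_reflection (reflection M p)
  rw [reflection_reflection] at hback
  refine ⟨RingEquiv.ofBijective s ⟨(injective_iff_map_eq_zero s).2 ?_, ?_⟩⟩
  · rintro ⟨x, hx⟩ hsx
    obtain ⟨f, rfl⟩ := HypersurfaceRing.mk_surjective _ _ x
    obtain ⟨h, hh⟩ := (mk_mem_quotientLocalRing a).1 hx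
    obtain ⟨k, hk⟩ := HypersurfaceRing.mk_eq_zero.1 hsx
    rw [nhdsSet_singleton] at hk
    change ∀ᶠ v in 𝓝 p, f.1 v = k.1 v * spectralEq a p.1 v at hk
    have hk' := mem_holAlg_singleton.1 k.2
    refine Subtype.ext (HypersurfaceRing.mk_eq_zero.2
      ⟨⟨glueOrbit p k.1 (fun v => k.1 (reflection M v) - h.1 v), glueOrbit_mem_holAlg hp hk' ?_⟩,
        eventually_nhdsSet_reflOrbit.2 ⟨?_, ?_⟩⟩)
    · refine ContMDiffAt.sub (ContMDiffAt.comp_reflection ?_) (mem_holAlg_reflOrbit.1 h.2).2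
      rwa [reflection_reflection]
    · filter_upwards [hk, glueOrbit_eventuallyEq_left hp k.1
        (fun v => k.1 (reflection M v) - h.1 v)] with v h1 h2
      rw [h1]
      simp only [h2]
    · filter_upwards [hback.eventually hk, (eventually_nhdsSet_reflOrbit.1 hh).2,
        glueOrbit_eventuallyEq_right hp k.1 (fun v => k.1 (reflection M v) - h.1 v)] with v h1 h2 h3
      simp only [h3]
      rw [hq] at h1
      linear_combination h1 - h2
  · intro y
    obtain ⟨g, rfl⟩ := HypersurfaceRing.mk_surjective _ _ y
    have hg := mem_holAlg_singleton.1 g.2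
    let f : holAlg (𝓘(ℂ).prod 𝓘(ℂ)) (reflOrbit M p) :=
      ⟨glueOrbit p g.1 (fun v => g.1 (reflection M v)), glueOrbit_mem_holAlg hp hg (by
        refine ContMDiffAt.comp_reflection ?_
        rwa [reflection_reflection])⟩
    have hl := glueOrbit_eventuallyEq_left hp g.1 (fun v => g.1 (reflection M v))
    have hr := glueOrbit_eventuallyEq_right hp g.1 (fun v => g.1 (reflection M v))
    refine ⟨⟨HypersurfaceRing.mk _ _ _ f, (mk_mem_quotientLocalRing a).2
      ⟨0, eventually_nhdsSet_reflOrbit.2 ⟨?_, ?_⟩⟩⟩, ?_⟩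
    · filter_upwards [hl, (tendsto_reflection p).eventually hr] with v h1 h2
      change glueOrbit p _ _ _ - glueOrbit p _ _ _ = 0 * _
      rw [h1, h2]
      simp only [reflection_reflection]
      ring
    · filter_upwards [hr, hback.eventually hl] with v h1 h2
      change glueOrbit p _ _ _ - glueOrbit p _ _ _ = 0 * _
      rw [h1, h2]
      ring
    · refine HypersurfaceRing.mk_eq_mk.2 ⟨0, ?_⟩
      rw [nhdsSet_singleton]
      filter_upwards [hl] with v h1
      change glueOrbit p _ _ v - g.1 v = 0 * _
      rw [h1]
      ring

/-- A property of `(z, u)` near the origin can be tested on the points `(z, t ^ 2)`. -/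
theorem eventually_of_comp_sq_snd {P : ℂ × ℂ → Prop} (h : ∀ᶠ v : ℂ × ℂ in 𝓝 0, P (v.1, v.2 ^ 2)) :
    ∀ᶠ v in 𝓝 0, P v := by
  obtain ⟨ε, hε, hb⟩ := Metric.eventually_nhds_iff_ball.1 h
  have h1 : ∀ᶠ v : ℂ × ℂ in 𝓝 0, ‖v.1‖ < ε := by
    have : Continuous fun v : ℂ × ℂ => ‖v.1‖ := by fun_prop
    exact this.continuousAt.eventually_lt_const (by simpa using hε)
  have h2 : ∀ᶠ v : ℂ × ℂ in 𝓝 0, ‖v.2‖ < ε ^ 2 := by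
    have : Continuous fun v : ℂ × ℂ => ‖v.2‖ := by fun_prop
    exact this.continuousAt.eventually_lt_const (by simpa using by positivity)
  filter_upwards [h1, h2] with v hv1 hv2
  obtain ⟨t, ht⟩ := IsAlgClosed.exists_pow_nat_eq v.2 (n := 2) two_pos
  rw [← ht, norm_pow] at hv2
  have := hb (v.1, t) (by
    rw [mem_ball_zero_iff, Prod.norm_def]
    exact max_lt hv1 (lt_of_pow_lt_pow_left₀ 2 hε.le hv2))
  simpa [ht] using this

/-- On the zero section the local ring of `Σ/σ` is the local ring of the plane curve
`u ^ n + a_2 u ^ (n-1) + ⋯ + a_{2n} = 0`: an invariant germ is represented by an even function, that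
is, by a function of `z` and `u = t ^ 2`. -/
theorem nonempty_quotientLocalRing_ringEquiv_of_eq_zero {p : TotalSpace ℂ M} (hp : p.2 = 0) :
    Nonempty (HypersurfaceRing 𝓘(ℂ, ℂ × ℂ) {(0 : ℂ × ℂ)} (quotientEq a p.1 0) ≃+*
      QuotientLocalRing a p) := by
  obtain ⟨φ, ψ, hφp, hψ0, hφ, hψ, hψφ, hφψ, hφeq, hspec⟩ := exists_spectralCoord a p
  have ht0 : fibreCoord M p.1 p = 0 := by
    rw [fibreCoord, hp, map_zero]
  simp only [ht0, mul_zero, zero_mul, add_zero, sub_zero, zero_pow two_ne_zero] at hφeq hspec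
  have hσp : reflection M p = p := by
    obtain ⟨x, v⟩ := p
    simp only at hp
    simp [reflection, hp]
  have horb : reflOrbit M p = {p} := by simp [reflOrbit, hσp]
  have hσt : Tendsto (reflection M) (𝓝 p) (𝓝 p) := by
    simpa only [hσp] using tendsto_reflection p
  have hφt : Tendsto φ (𝓝 p) (𝓝 0) := by simpa only [hφp] using hφ.continuousAt.tendsto
  have hψt : Tendsto ψ (𝓝 0) (𝓝 p) := by simpa only [hψ0] using hψ.continuousAt.tendsto
  have hφσ : ∀ᶠ v in 𝓝 p, φ (reflection M v) = ((φ v).1, -(φ v).2) := by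
    filter_upwards [hφeq, hσt.eventually hφeq] with v h1 h2
    rw [h1, h2, fibreCoord_reflection]
    rfl
  have hψσ : ∀ᶠ w in 𝓝 0, ψ (w.1, -w.2) = reflection M (ψ w) := by
    filter_upwards [hψt.eventually hφσ, hψt.eventually (hσt.eventually hψφ), hφψ] with w h1 h2 h3
    rw [h1, h3] at h2
    exact h2
  -- The even part of a germ at `p` is a function of `z` and `t ^ 2`.
  have key : ∀ f : TotalSpace ℂ M → ℂ, ContMDiffAt (𝓘(ℂ).prod 𝓘(ℂ)) 𝓘(ℂ) ω f p →
      ∃ F : ℂ × ℂ → ℂ, AnalyticAt ℂ F 0 ∧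
        ∀ᶠ v in 𝓝 p, (f v + f (reflection M v)) / 2 = F ((φ v).1, (φ v).2 ^ 2) := by
    intro f hf
    have h1 : ContMDiffAt (𝓘(ℂ).prod 𝓘(ℂ)) 𝓘(ℂ) ω
        (fun v => (f v + f (reflection M v)) * (1 / 2)) (ψ 0) := by
      rw [hψ0]
      exact (hf.add (ContMDiffAt.comp_reflection (by rwa [hσp]))).mul contMDiffAt_const
    have h2 := contMDiffAt_iff_analyticAt_prod.1 (ContMDiffAt.comp (0 : ℂ × ℂ) h1 hψ)
    obtain ⟨F, hF, hfF⟩ := h2.exists_eq_comp_sq_snd (by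
      filter_upwards [hψσ] with w hw
      simp only [Function.comp_apply, hw, reflection_reflection]
      ring)
    refine ⟨F, hF, ?_⟩
    filter_upwards [hφt.eventually hfF, hψφ] with v h3 h4
    rw [← h3, Function.comp_apply, h4]
    ring
  have hsq : ContMDiffAt (𝓘(ℂ).prod 𝓘(ℂ)) 𝓘(ℂ, ℂ × ℂ) ω (fun v => ((φ v).1, (φ v).2 ^ 2)) p := by
    refine ContMDiffAt.comp p (g := fun w : ℂ × ℂ => (w.1, w.2 ^ 2)) ?_ hφ
    rw [hφp]
    exact contMDiffAt_iff_analyticAt_prod.2 analyticAt_sq_snd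
  have hsqσ : ∀ᶠ v in 𝓝 p, ((φ (reflection M v)).1, (φ (reflection M v)).2 ^ 2) =
      ((φ v).1, (φ v).2 ^ 2) := by
    filter_upwards [hφσ] with v hv
    rw [hv]
    simp
  have hnhds : ∀ {P : TotalSpace ℂ M → Prop},
      (∀ᶠ v in 𝓝 p, P v) → ∀ᶠ v in 𝓝ˢ (reflOrbit M p), P v := by
    intro P h
    rwa [horb, nhdsSet_singleton]
  have hhol : ∀ {f : TotalSpace ℂ M → ℂ}, ContMDiffAt (𝓘(ℂ).prod 𝓘(ℂ)) 𝓘(ℂ) ω f p →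
      f ∈ holAlg (𝓘(ℂ).prod 𝓘(ℂ)) (reflOrbit M p) := by
    intro f hf
    rwa [horb, mem_holAlg_singleton]
  let s : HypersurfaceRing 𝓘(ℂ, ℂ × ℂ) {(0 : ℂ × ℂ)} (quotientEq a p.1 0) →ₐ[ℂ] OrbitRing a p :=
    HypersurfaceRing.comap (fun v => ((φ v).1, (φ v).2 ^ 2)) (S := reflOrbit M p)
      (q := spectralEq a p.1)
      (by rw [horb]; rintro _ rfl; simp [hφp])
      (by rw [horb]; rintro _ rfl; exact hsq) 1
      (hnhds (hspec.mono fun v hv => hv.symm.trans (one_mul _).symm))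
  have hs : ∀ x, s x ∈ QuotientLocalRing a p := by
    intro x
    obtain ⟨F, rfl⟩ := HypersurfaceRing.mk_surjective _ _ x
    refine (mk_mem_quotientLocalRing a).2 ⟨0, hnhds ?_⟩
    filter_upwards [hsqσ] with v hv
    change F.1 ((φ (reflection M v)).1, (φ (reflection M v)).2 ^ 2) -
      F.1 ((φ v).1, (φ v).2 ^ 2) = 0 * _
    rw [hv]
    ring
  refine ⟨RingEquiv.ofBijective (s.codRestrict _ hs).toRingHom
    ⟨(injective_iff_map_eq_zero (s.codRestrict _ hs).toRingHom).2 ?_, ?_⟩⟩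
  · intro x hx
    obtain ⟨F, rfl⟩ := HypersurfaceRing.mk_surjective _ _ x
    obtain ⟨h, hh⟩ := HypersurfaceRing.mk_eq_zero.1 (congrArg Subtype.val hx)
    replace hh : ∀ᶠ v in 𝓝 p, F.1 ((φ v).1, (φ v).2 ^ 2) = h.1 v * spectralEq a p.1 v :=
      (eventually_nhdsSet_reflOrbit.1 hh).1
    obtain ⟨G, hG, hhG⟩ := key h.1 (mem_holAlg_reflOrbit.1 h.2).1
    refine HypersurfaceRing.mk_eq_zero.2 ⟨⟨G, mem_holAlg_zero.2 hG⟩, ?_⟩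
    rw [nhdsSet_singleton]
    refine eventually_of_comp_sq_snd (P := fun w => F.1 w = G w * quotientEq a p.1 0 w) ?_
    have h1 : ∀ᶠ v in 𝓝 p, F.1 ((φ v).1, (φ v).2 ^ 2) =
        G ((φ v).1, (φ v).2 ^ 2) * quotientEq a p.1 0 ((φ v).1, (φ v).2 ^ 2) := by
      filter_upwards [hh, hσt.eventually hh, hsqσ, hspec, hhG] with v h1 h2 h3 h4 h5
      rw [h3, spectralEq_reflection] at h2
      rw [← h5, ← h4]
      linear_combination (h1 + h2) / 2
    filter_upwards [hψt.eventually h1, hφψ] with w h2 h3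
    rwa [h3] at h2
  · rintro ⟨y, hy⟩
    obtain ⟨f, rfl⟩ := HypersurfaceRing.mk_surjective _ _ y
    obtain ⟨h, hh⟩ := (mk_mem_quotientLocalRing a).1 hy
    have hh1 := (eventually_nhdsSet_reflOrbit.1 hh).1
    obtain ⟨F, hF, hfF⟩ := key f.1 (mem_holAlg_reflOrbit.1 f.2).1
    refine ⟨HypersurfaceRing.mk _ _ _ ⟨F, mem_holAlg_zero.2 hF⟩,
      Subtype.ext (HypersurfaceRing.mk_eq_mk.2
        ⟨⟨fun v => h.1 v * (1 / 2), hhol ((mem_holAlg_reflOrbit.1 h.2).1.mul contMDiffAt_const)⟩,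
          hnhds ?_⟩)⟩
    filter_upwards [hh1, hfF] with v h1 h2
    change F ((φ v).1, (φ v).2 ^ 2) - f.1 v = h.1 v * (1 / 2) * _
    rw [← h2]
    linear_combination h1 / 2

/-- The quotient curve is smooth at the image of `p` iff its local equation has a nonzero
differential there. -/
theorem isSmoothCurveRing_quotientLocalRing_iff {p : TotalSpace ℂ M} (hp : p ∈ spectralCurve a) :
    IsSmoothCurveRing (QuotientLocalRing a p) ↔
      fderiv ℂ (quotientEq a p.1 (fibreCoord M p.1 p ^ 2)) 0 ≠ 0 := by
  by_cases h0 : fibreCoord M p.1 p = 0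
  · have hp0 : p.2 = 0 :=
      (fibreCoord_eq_zero_iff (mem_baseSet_trivializationAt ℂ M p.1)).1 h0
    obtain ⟨e⟩ := nonempty_quotientLocalRing_ringEquiv_of_eq_zero a hp0
    rw [mem_spectralCurve_iff] at hp
    rw [h0, zero_pow two_ne_zero] at hp ⊢
    rw [← isSmoothCurveRing_congr e,
      isSmoothCurveRing_iff_fderiv_ne_zero (analyticAt_quotientEq a p.1 0) hp]
  · obtain ⟨e⟩ := nonempty_quotientLocalRing_ringEquiv a h0
    rw [isSmoothCurveRing_congr e, isSmoothCurveRing_spectralLocalRing_iff a hp]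
    constructor
    · rintro ⟨w, hw⟩ h
      exact hw (by rw [h]; rfl)
    · intro h
      by_contra! hall
      refine h (ContinuousLinearMap.ext fun w => ?_)
      have := hall (w.1, w.2 / (2 * fibreCoord M p.1 p))
      rw [mul_div_cancel₀ _ (mul_ne_zero two_ne_zero h0)] at this
      exact this

end LineBundle

/-! ### Singular points, sheets, and points of `sl(2)`-type -/

theorem quotPoly_monic {n : ℕ} (c : Fin n → ℂ) : (quotPoly c).Monic := by
  unfold quotPoly
  refine monic_X_pow_add ((degree_sum_le _ _).trans_lt ?_)
  refine (Finset.sup_lt_iff (WithBot.bot_lt_coe n)).2 fun j _ => ?_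
  exact (degree_C_mul_X_pow_le _ _).trans_lt (Nat.cast_lt.2 (by omega : n - ((j : ℕ) + 1) < n))

/-- If `0` is a root of `q`, then `0` is a double root of `q(T ^ 2)` iff it is a simple root
of `q`. -/
theorem rootMultiplicity_expand_two_eq_two_iff {q : ℂ[X]} (hq : q ≠ 0) (h0 : q.eval 0 = 0) :
    (expand ℂ 2 q).rootMultiplicity 0 = 2 ↔ q.derivative.eval 0 ≠ 0 := by
  obtain ⟨r, rfl⟩ : X ∣ q := by rwa [X_dvd_iff, coeff_zero_eq_eval_zero]
  have hr : r ≠ 0 := right_ne_zero_of_mul hq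
  have hr2 : expand ℂ 2 r ≠ 0 := (expand_ne_zero two_pos).2 hr
  have hX : ((X : ℂ[X]) ^ 2).rootMultiplicity 0 = 2 := by
    have := rootMultiplicity_X_sub_C_pow (0 : ℂ) 2
    rwa [C_0, sub_zero] at this
  rw [map_mul, expand_X, rootMultiplicity_mul (mul_ne_zero (pow_ne_zero 2 X_ne_zero) hr2), hX,
    Nat.add_eq_left, derivative_mul, derivative_X]
  have h1 : (expand ℂ 2 r).rootMultiplicity 0 = 0 ↔ ¬ (expand ℂ 2 r).IsRoot 0 := by
    rw [← rootMultiplicity_pos hr2]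
    omega
  rw [h1, IsRoot.def, expand_eval]
  simp

section LineBundle

set_option linter.unusedSectionVars false

variable {X : Type*} [TopologicalSpace X] [ChartedSpace ℂ X]
  {M : X → Type*} [TopologicalSpace (TotalSpace ℂ M)] [∀ x, TopologicalSpace (M x)]
  [∀ x, AddCommGroup (M x)] [∀ x, Module ℂ (M x)] [FiberBundle ℂ M] [VectorBundle ℂ ℂ M]
  {n : ℕ} (a : HitchinBase M n)

theorem charPoly_eq_expand (x y : X) :
    charPoly a x y = expand ℂ 2 (quotPoly (localCoeff a x y)) := by
  simp [charPoly, quotPoly, ← pow_mul, Nat.mul_sub]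

theorem fibreCoord_zero_section {x : X} {p : TotalSpace ℂ M} (hp : p.2 = 0) :
    fibreCoord M x p = 0 := by
  rw [fibreCoord, hp, map_zero]

theorem sheetNumber_eq_two_iff {p : TotalSpace ℂ M} (hp : p ∈ spectralCurve a) (h0 : p.2 = 0) :
    sheetNumber a p = 2 ↔ fderiv ℂ (quotientEq a p.1 0) 0 (0, 1) ≠ 0 := by
  rw [mem_spectralCurve_iff, fibreCoord_zero_section h0, zero_pow two_ne_zero,
    quotientEq_zero] at hp
  rw [sheetNumber, charPoly_eq_expand, fibreCoord_zero_section h0,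
    rootMultiplicity_expand_two_eq_two_iff (quotPoly_monic _).ne_zero hp, fderiv_quotientEq_snd]

variable [IsManifold 𝓘(ℂ) ω X] [ContMDiffVectorBundle ω ℂ M 𝓘(ℂ)]

theorem isSingularPoint_iff {p : TotalSpace ℂ M} : IsSingularPoint a p ↔
    p ∈ spectralCurve a ∧ ∀ w : ℂ × ℂ,
      fderiv ℂ (quotientEq a p.1 (fibreCoord M p.1 p ^ 2)) 0
        (w.1, 2 * fibreCoord M p.1 p * w.2) = 0 := by
  refine and_congr_right fun hp => ?_
  rw [isSmoothCurveRing_spectralLocalRing_iff a hp]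
  push Not
  rfl

theorem isSl2Type_iff : IsSl2Type a ↔ ∀ p ∈ spectralCurve a,
    fderiv ℂ (quotientEq a p.1 (fibreCoord M p.1 p ^ 2)) 0 ≠ 0 :=
  forall₂_congr fun _ hp => isSmoothCurveRing_quotientLocalRing_iff a hp

/-- If `Σ/σ` is smooth, then at a singular point of `Σ` the local equation of `Σ/σ` is stationary
along the zero section but not along the fibre. -/
theorem IsSl2Type.fderiv_of_isSingularPoint {a : HitchinBase M n} (ha : IsSl2Type a)
    {p : TotalSpace ℂ M} (hp : IsSingularPoint a p) :
    p.2 = 0 ∧ fderiv ℂ (quotientEq a p.1 0) 0 (1, 0) = 0 ∧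
      fderiv ℂ (quotientEq a p.1 0) 0 (0, 1) ≠ 0 := by
  rw [isSingularPoint_iff] at hp
  obtain ⟨hmem, hd⟩ := hp
  have h1 := (isSl2Type_iff a).1 ha p hmem
  have ht : fibreCoord M p.1 p = 0 := by
    by_contra ht
    refine h1 (ContinuousLinearMap.ext fun w => ?_)
    have := hd (w.1, w.2 / (2 * fibreCoord M p.1 p))
    rwa [mul_div_cancel₀ _ (mul_ne_zero two_ne_zero ht)] at this
  rw [ht, zero_pow two_ne_zero] at hd h1
  have h10 : fderiv ℂ (quotientEq a p.1 0) 0 (1, 0) = 0 := by simpa using hd (1, 0)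
  refine ⟨(fibreCoord_eq_zero_iff (mem_baseSet_trivializationAt ℂ M p.1)).1 ht, h10, fun h2 => ?_⟩
  refine h1 (ContinuousLinearMap.ext fun w => ?_)
  have : w = w.1 • ((1 : ℂ), (0 : ℂ)) + w.2 • ((0 : ℂ), (1 : ℂ)) := by ext <;> simp
  rw [this, map_add, map_smul, map_smul, h10, h2]
  simp

theorem isSl2Type_iff_isSingularPoint : IsSl2Type a ↔
    ∀ p, IsSingularPoint a p → p.2 = 0 ∧ sheetNumber a p = 2 := by
  constructor
  · intro ha p hp
    obtain ⟨h0, -, h2⟩ := ha.fderiv_of_isSingularPoint hp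
    exact ⟨h0, (sheetNumber_eq_two_iff a hp.1 h0).2 h2⟩
  · intro h
    rw [isSl2Type_iff]
    intro p hp hd
    obtain ⟨h0, h2⟩ := h p ((isSingularPoint_iff a).2 ⟨hp, fun w => by rw [hd]; rfl⟩)
    rw [sheetNumber_eq_two_iff a hp h0] at h2
    rw [fibreCoord_zero_section h0, zero_pow two_ne_zero] at hd
    exact h2 (by rw [hd]; rfl)

/-- If `Σ/σ` is smooth, a singular point of `Σ` is of type `A_k` unless `Σ` contains a
neighbourhood of that point in the zero section. -/
theorem IsSl2Type.exists_isTypeA {a : HitchinBase M n} (ha : IsSl2Type a)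
    {p : TotalSpace ℂ M} (hp : IsSingularPoint a p)
    (hne : ¬ ∀ᶠ z in 𝓝 0, quotientEq a p.1 0 (z, 0) = 0) : ∃ k, 1 ≤ k ∧ IsTypeA a k p := by
  obtain ⟨h0, h1, h2⟩ := ha.fderiv_of_isSingularPoint hp
  have hmem := (mem_spectralCurve_iff a).1 hp.1
  rw [fibreCoord_zero_section h0, zero_pow two_ne_zero] at hmem
  obtain ⟨P, hP⟩ : ∃ P : ℂ × ℂ → ℂ, ∀ v, P v = quotientEq a p.1 0 (v.1, v.2 ^ 2) :=
    ⟨_, fun _ => rfl⟩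
  obtain ⟨e⟩ := nonempty_spectralLocalRing_algEquiv a p (P := P) (by
    intro v
    rw [hP, fibreCoord_zero_section h0]
    simp)
  obtain ⟨k, hk, ⟨e'⟩⟩ := nonempty_algEquiv_AkRing (analyticAt_quotientEq a p.1 0) hmem h2 h1 hne
    (Eventually.of_forall hP)
  exact ⟨k, hk, ⟨e.trans e'⟩⟩

end LineBundle

/-! ### Zeros of the discriminant at singular points -/

/-- If `f = (X - u) g` then `res(f, f') = g(u) res(g, f')`, and `res(g, f')` is a combination of
`g(u)` and `f'(u) = g(u)`; so the resultant is a multiple of `f'(u) ^ 2`. -/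
theorem resultant_derivative_eq_zero_of_sq_eq_zero {R : Type*} [CommRing R] {f : R[X]}
    (hf : f.Monic) {u : R} (h0 : f.eval u = 0) (h1 : f.derivative.eval u ^ 2 = 0) :
    resultant f f.derivative f.natDegree (f.natDegree - 1) = 0 := by
  nontriviality R
  obtain ⟨g, hfg⟩ := dvd_iff_isRoot.2 h0
  have hg : g.Monic := (monic_X_sub_C u).of_mul_monic_left (hfg ▸ hf)
  have hdeg : f.natDegree = 1 + g.natDegree := by
    rw [hfg, (monic_X_sub_C u).natDegree_mul hg, natDegree_X_sub_C]
  have hder : f.derivative.eval u = g.eval u := by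
    rw [hfg]
    simp [derivative_mul]
  rw [hder] at h1
  have hg0 : g.natDegree ≠ 0 := by
    intro h
    rw [hg.natDegree_eq_zero.1 h] at h1
    simp at h1
  have hd : f.derivative.natDegree ≤ g.natDegree := by
    have := natDegree_derivative_le f
    omega
  have hmul := resultant_mul_left (X - C u) g f.derivative g.natDegree hd
  rw [natDegree_X_sub_C, resultant_X_sub_C_left _ _ _ hd, hder, ← hfg] at hmul
  obtain ⟨p, q, -, -, hpq⟩ := exists_mul_add_mul_eq_C_resultant (m := g.natDegree)
    (n := g.natDegree) g f.derivative le_rfl hd (Or.inl hg0)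
  have hev := congrArg (eval u) hpq
  rw [eval_add, eval_mul, eval_mul, hder, eval_C] at hev
  have hres : resultant f f.derivative (1 + g.natDegree) g.natDegree = 0 := by
    rw [hmul, ← hev]
    linear_combination (p.eval u + q.eval u) * h1
  rwa [hdeg, Nat.add_sub_cancel_left]

/-- The first-order jet at `z₀`, with values in the dual numbers. -/
noncomputable def jetHom (z₀ : ℂ) : holAlg 𝓘(ℂ) {z₀} →+* DualNumber ℂ where
  toFun f := TrivSqZeroExt.inl (f.1 z₀) + TrivSqZeroExt.inr (deriv f.1 z₀)
  map_one' := by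
    have h : deriv (1 : holAlg 𝓘(ℂ) {z₀}).1 z₀ = 0 := deriv_const z₀ (1 : ℂ)
    rw [h]
    ext <;> simp
  map_zero' := by
    have h : deriv (0 : holAlg 𝓘(ℂ) {z₀}).1 z₀ = 0 := deriv_const z₀ (0 : ℂ)
    rw [h]
    ext <;> simp
  map_mul' f g := by
    have hf := (contMDiffAt_iff_contDiffAt.1 (f.2 z₀ rfl)).differentiableAt (by simp)
    have hg := (contMDiffAt_iff_contDiffAt.1 (g.2 z₀ rfl)).differentiableAt (by simp)
    have h : deriv (f * g).1 z₀ = deriv f.1 z₀ * g.1 z₀ + f.1 z₀ * deriv g.1 z₀ := deriv_mul hf hg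
    rw [h]
    ext
    · simp
    · simp
      ring
  map_add' f g := by
    have hf := (contMDiffAt_iff_contDiffAt.1 (f.2 z₀ rfl)).differentiableAt (by simp)
    have hg := (contMDiffAt_iff_contDiffAt.1 (g.2 z₀ rfl)).differentiableAt (by simp)
    have h : deriv (f + g).1 z₀ = deriv f.1 z₀ + deriv g.1 z₀ := deriv_add hf hg
    rw [h]
    ext <;> simp

theorem fst_jetHom (z₀ : ℂ) (f : holAlg 𝓘(ℂ) {z₀}) : (jetHom z₀ f).fst = f.1 z₀ := by
  simp [jetHom]

theorem snd_jetHom (z₀ : ℂ) (f : holAlg 𝓘(ℂ) {z₀}) : (jetHom z₀ f).snd = deriv f.1 z₀ := by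
  simp [jetHom]

/-- Evaluation at a point `y`, as a homomorphism. -/
def evalHom (z₀ y : ℂ) : holAlg 𝓘(ℂ) {z₀} →+* ℂ where
  toFun f := f.1 y
  map_one' := rfl
  map_zero' := rfl
  map_mul' _ _ := rfl
  map_add' _ _ := rfl

theorem analyticAt_of_mem_holAlg {z₀ : ℂ} (f : holAlg 𝓘(ℂ) {z₀}) : AnalyticAt ℂ f.1 z₀ :=
  (contMDiffAt_iff_contDiffAt.1 (f.2 z₀ rfl)).analyticAt

theorem redDisc_eq_resultant {n : ℕ} (hn : 1 ≤ n) (c : Fin n → ℂ) :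
    redDisc c = (-1) ^ (n * (n - 1) / 2) *
      resultant (quotPoly c) (quotPoly c).derivative n (n - 1) := by
  have hdeg : (quotPoly c).natDegree = n := by
    unfold quotPoly
    refine natDegree_eq_of_degree_eq_some ?_
    rw [degree_add_eq_left_of_degree_lt, degree_X_pow]
    rw [degree_X_pow]
    refine (degree_sum_le _ _).trans_lt ((Finset.sup_lt_iff (WithBot.bot_lt_coe n)).2 fun j _ => ?_)
    exact (degree_C_mul_X_pow_le _ _).trans_lt (Nat.cast_lt.2 (by omega : n - ((j : ℕ) + 1) < n))
  have h := resultant_deriv (f := quotPoly c) (natDegree_pos_iff_degree_pos.1 (by omega))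
  rw [hdeg, (quotPoly_monic c).leadingCoeff, mul_one] at h
  rw [h, ← mul_assoc, ← mul_pow]
  simp [redDisc]

/-- At a singular point of the family of zeros of `quotPoly (c z)` the discriminant does not have a
simple zero: on first-order jets the resultant with the derivative vanishes. -/
theorem redDisc_of_singular {n : ℕ} (hn : 1 ≤ n) {c : Fin n → ℂ → ℂ} {z₀ u₀ : ℂ}
    (hc : ∀ j, AnalyticAt ℂ (c j) z₀) (h0 : (quotPoly fun j => c j z₀).eval u₀ = 0)
    (hz : deriv (fun z => (quotPoly fun j => c j z).eval u₀) z₀ = 0)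
    (hu : (quotPoly fun j => c j z₀).derivative.eval u₀ = 0) :
    redDisc (fun j => c j z₀) = 0 ∧
      analyticOrderAt (fun z => redDisc fun j => c j z) z₀ ≠ 1 := by
  let c' : Fin n → holAlg 𝓘(ℂ) {z₀} := fun j => ⟨c j, by
    rintro _ rfl
    exact contMDiffAt_iff_contDiffAt.2 (hc j).contDiffAt⟩
  let F : (holAlg 𝓘(ℂ) {z₀})[X] := X ^ n + ∑ j : Fin n, C (c' j) * X ^ (n - ((j : ℕ) + 1))
  let U : holAlg 𝓘(ℂ) {z₀} := algebraMap ℂ _ u₀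
  have hlt : (∑ j : Fin n, C (c' j) * X ^ (n - ((j : ℕ) + 1))).degree < (n : WithBot ℕ) := by
    refine (degree_sum_le _ _).trans_lt ((Finset.sup_lt_iff (WithBot.bot_lt_coe n)).2 fun j _ => ?_)
    exact (degree_C_mul_X_pow_le _ _).trans_lt (Nat.cast_lt.2 (by omega : n - ((j : ℕ) + 1) < n))
  have hF : F.Monic := monic_X_pow_add hlt
  have hFdeg : F.natDegree = n := by
    have : Nontrivial (holAlg 𝓘(ℂ) {z₀}) :=
      ⟨0, 1, fun h => zero_ne_one (congrFun (congrArg Subtype.val h) z₀)⟩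
    refine natDegree_eq_of_degree_eq_some ?_
    rw [degree_add_eq_left_of_degree_lt (by rwa [degree_X_pow]), degree_X_pow]
  have hFmap : ∀ y, F.map (evalHom z₀ y) = quotPoly fun j => c j y := by
    intro y
    simp only [F, quotPoly, Polynomial.map_add, Polynomial.map_pow, map_X, Polynomial.map_sum,
      Polynomial.map_mul, map_C]
    rfl
  have hFeval : ∀ y, (F.eval U).1 y = (quotPoly fun j => c j y).eval u₀ := by
    intro y
    rw [← hFmap, eval_map]
    exact (eval₂_at_apply (evalHom z₀ y) U).symm
  have hFeval' : ∀ y, (F.derivative.eval U).1 y = (quotPoly fun j => c j y).derivative.eval u₀ := by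
    intro y
    rw [← hFmap, derivative_map, eval_map]
    exact (eval₂_at_apply (evalHom z₀ y) U).symm
  let r := resultant F F.derivative n (n - 1)
  have hr : ∀ y, redDisc (fun j => c j y) = (-1) ^ (n * (n - 1) / 2) * r.1 y := by
    intro y
    rw [redDisc_eq_resultant hn, ← hFmap, derivative_map, resultant_map_map]
    rfl
  have hjet : jetHom z₀ r = 0 := by
    have h := resultant_derivative_eq_zero_of_sq_eq_zero (hF.map (jetHom z₀)) (u := jetHom z₀ U) ?_ ?_
    · rw [hF.natDegree_map, hFdeg, derivative_map, resultant_map_map] at h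
      exact h
    · rw [eval_map, eval₂_at_apply]
      refine TrivSqZeroExt.ext ((fst_jetHom _ _).trans ((hFeval z₀).trans h0)) ?_
      refine (snd_jetHom _ _).trans ?_
      rw [TrivSqZeroExt.snd_zero, ← hz]
      congr 1
      exact funext hFeval
    · rw [derivative_map, eval_map, eval₂_at_apply, pow_two]
      have h2 : (jetHom z₀ (F.derivative.eval U)).fst = 0 :=
        (fst_jetHom _ _).trans ((hFeval' z₀).trans hu)
      refine TrivSqZeroExt.ext ?_ ?_
      · rw [TrivSqZeroExt.fst_mul, h2, mul_zero]
        rfl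
      · rw [DualNumber.snd_mul, h2]
        simp
  have hr0 : r.1 z₀ = 0 := by rw [← fst_jetHom, hjet, TrivSqZeroExt.fst_zero]
  have hr1 : deriv r.1 z₀ = 0 := by rw [← snd_jetHom, hjet, TrivSqZeroExt.snd_zero]
  refine ⟨by rw [hr, hr0, mul_zero], fun hord => ?_⟩
  have hfun : (fun z => redDisc fun j => c j z) = fun z => (-1) ^ (n * (n - 1) / 2) * r.1 z :=
    funext hr
  rw [hfun] at hord
  have han : AnalyticAt ℂ (fun z => (-1) ^ (n * (n - 1) / 2) * r.1 z) z₀ :=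
    analyticAt_const.mul (analyticAt_of_mem_holAlg r)
  obtain ⟨g, hg, hg0, hev⟩ := (han.analyticOrderAt_eq_natCast (n := 1)).1 (by exact_mod_cast hord)
  have hd1 : deriv (fun z => (-1) ^ (n * (n - 1) / 2) * r.1 z) z₀ = 0 := by
    rw [deriv_const_mul _ (analyticAt_of_mem_holAlg r).differentiableAt, hr1, mul_zero]
  have hd2 := (show _ =ᶠ[𝓝 z₀] _ from hev).deriv_eq
  have hd3 := (((hasDerivAt_id z₀).sub_const z₀).mul hg.differentiableAt.hasDerivAt).deriv
  simp only [pow_one, smul_eq_mul] at hd2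
  rw [hd1] at hd2
  have hd4 := hd2.trans hd3
  exact hg0 (by simpa using hd4.symm)

section LineBundle

set_option linter.unusedSectionVars false

variable {X : Type*} [TopologicalSpace X] [ChartedSpace ℂ X]
  {M : X → Type*} [TopologicalSpace (TotalSpace ℂ M)] [∀ x, TopologicalSpace (M x)]
  [∀ x, AddCommGroup (M x)] [∀ x, Module ℂ (M x)] [FiberBundle ℂ M] [VectorBundle ℂ ℂ M]
  {n : ℕ} {a : HitchinBase M n} [IsManifold 𝓘(ℂ) ω X] [ContMDiffVectorBundle ω ℂ M 𝓘(ℂ)]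

/-- A singular point of `Σ/σ` is a multiple root of the fibre polynomial at which the discriminant
vanishes to order at least two. -/
theorem RedDiscSimpleZeros.isSl2Type (hn : 1 ≤ n) (ha : RedDiscSimpleZeros a) : IsSl2Type a := by
  rw [isSl2Type_iff]
  intro p hp hd
  have hx : (chartAt ℂ p.1).symm (chartAt ℂ p.1 p.1) = p.1 :=
    (chartAt ℂ p.1).left_inv (mem_chart_source ℂ p.1)
  have h1 : fderiv ℂ (quotientEq a p.1 (fibreCoord M p.1 p ^ 2)) 0 (1, 0) = 0 := by
    rw [hd]
    rfl
  have h2 : fderiv ℂ (quotientEq a p.1 (fibreCoord M p.1 p ^ 2)) 0 (0, 1) = 0 := by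
    rw [hd]
    rfl
  rw [fderiv_quotientEq_fst] at h1
  rw [fderiv_quotientEq_snd] at h2
  rw [mem_spectralCurve_iff, quotientEq_zero] at hp
  have hval : (fun j => inChart (fun y => localCoeff a p.1 y j) p.1 (chartAt ℂ p.1 p.1)) =
      localCoeff a p.1 p.1 := by
    funext j
    simp [inChart]
  obtain ⟨h3, h4⟩ := redDisc_of_singular hn (z₀ := chartAt ℂ p.1 p.1)
    (c := fun j => inChart (fun y => localCoeff a p.1 y j) p.1)
    (u₀ := fibreCoord M p.1 p ^ 2) (fun j => analyticAt_localCoeff a p.1 j)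
    (by rwa [hval]) h1 (by rwa [hval])
  rw [hval] at h3
  exact h4 (ha p.1 h3)

end LineBundle

/-! ### Conservation of multiplicity for meromorphic functions -/

theorem meromorphicOrderAt_untop₀_eq_zero {f g : ℂ → ℂ} {y : ℂ} (h : f =ᶠ[𝓝[≠] y] g)
    (hg : AnalyticAt ℂ g y) (hg0 : g y ≠ 0) : (meromorphicOrderAt f y).untop₀ = 0 := by
  rw [meromorphicOrderAt_congr h, hg.meromorphicOrderAt_eq, hg.analyticOrderAt_eq_zero.2 hg0]
  rfl

theorem meromorphicOrderAt_eval {p : ℂ[X]} (hp : p ≠ 0) (z : ℂ) :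
    meromorphicOrderAt (fun t => p.eval t) z = (p.rootMultiplicity z : ℤ) := by
  have han : ∀ q : ℂ[X], AnalyticAt ℂ (fun t => q.eval t) z := fun q => by
    simpa using! AnalyticAt.aeval_polynomial (analyticAt_id (𝕜 := ℂ) (z := z)) q
  obtain ⟨q, hq, hqz⟩ := exists_eq_pow_rootMultiplicity_mul_and_not_dvd p hp z
  refine (meromorphicOrderAt_eq_int_iff (han p).meromorphicAt).2
    ⟨fun t => q.eval t, han q, fun h => hqz (dvd_iff_isRoot.2 h), Eventually.of_forall fun t => ?_⟩
  conv_lhs => rw [hq]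
  simp

/-- A family of divisors `O w` on `Y` *conserves multiplicity* near `(w₀, y₀)`: in small
neighbourhoods of `y₀` the total multiplicity of `O w` does not change when `w` moves away from
`w₀`. The finite set `S` carries the part of `O w` in such a neighbourhood `U`. -/
def ConservesMultiplicity {W Y : Type*} [TopologicalSpace W] [TopologicalSpace Y]
    (O : W → Y → ℤ) (w₀ : W) (y₀ : Y) : Prop :=
  ∀ V ∈ 𝓝 y₀, ∃ U ∈ 𝓝 y₀, U ⊆ V ∧ ∀ᶠ w in 𝓝 w₀, ∃ S : Finset Y, ↑S ⊆ U ∧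
    (∀ y ∈ U, y ∉ S → O w y = 0) ∧ ∑ y ∈ S, O w y = O w₀ y₀ ∧ (O w₀ y₀ = 0 → S = ∅)

theorem eventually_nhds_of_nhdsNE {z₀ : ℂ} {P : ℂ → Prop} (h : ∀ᶠ z in 𝓝[≠] z₀, P z) :
    ∀ᶠ y in 𝓝 z₀, ∀ᶠ z in 𝓝[≠] y, P z := by
  have h1 : ∀ᶠ y in 𝓝[≠] z₀, ∀ᶠ z in 𝓝[≠] y, P z :=
    (eventually_nhdsNE_eventually_nhds_iff.2 h).mono fun y hy => hy.filter_mono nhdsWithin_le_nhds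
  rw [eventually_nhdsWithin_iff] at h1
  filter_upwards [h1] with y hy
  by_cases hyz : y = z₀
  · rwa [hyz]
  · exact hy hyz

section Planar

variable {F : ℂ → ℂ} {w₀ z₀ : ℂ}

theorem conservesMultiplicity_of_eventually_eq (h : ∀ᶠ z in 𝓝[≠] z₀, F z = w₀) :
    ConservesMultiplicity (fun w y => (meromorphicOrderAt (fun z => F z - w) y).untop₀) w₀ z₀ := by
  intro V hV
  have h2 : ∀ y, (∀ᶠ z in 𝓝[≠] y, F z = w₀) → ∀ w,
      (meromorphicOrderAt (fun z => F z - w) y).untop₀ = 0 := by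
    intro y hy w
    have h3 : (fun z => F z - w) =ᶠ[𝓝[≠] y] fun _ => w₀ - w := hy.mono fun z hz => by simp [hz]
    classical
    rw [meromorphicOrderAt_congr h3, meromorphicOrderAt_const]
    split_ifs <;> rfl
  refine ⟨V ∩ {y | ∀ᶠ z in 𝓝[≠] y, F z = w₀}, inter_mem hV (eventually_nhds_of_nhdsNE h),
    Set.inter_subset_left,
    Eventually.of_forall fun w => ⟨∅, by simp, fun y hy _ => h2 y hy.2 w, ?_, fun _ => rfl⟩⟩
  simpa using! (h2 z₀ h w₀).symm

theorem conservesMultiplicity_of_order_neg (hF : MeromorphicAt F z₀)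
    (h : meromorphicOrderAt (fun z => F z - w₀) z₀ < 0) :
    ConservesMultiplicity (fun w y => (meromorphicOrderAt (fun z => F z - w) y).untop₀) w₀ z₀ := by
  intro V hV
  have hord : ∀ w, meromorphicOrderAt (fun z => F z - w) z₀ =
      meromorphicOrderAt (fun z => F z - w₀) z₀ := by
    intro w
    have h1 : (fun z => F z - w) = (fun z => F z - w₀) + fun _ => w₀ - w := by
      ext z; simp
    rw [h1]
    refine meromorphicOrderAt_add_eq_left_of_lt analyticAt_const.meromorphicAt (h.trans_le ?_)
    exact analyticAt_const.meromorphicOrderAt_nonneg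
  have hlarge : ∀ᶠ y in 𝓝[≠] z₀, 1 < ‖F y - w₀‖ :=
    (tendsto_norm_atTop_iff_cobounded.2 (tendsto_cobounded_of_meromorphicOrderAt_neg h)).eventually
      (eventually_gt_atTop 1)
  have hU : ∀ᶠ y in 𝓝 z₀, y ≠ z₀ → AnalyticAt ℂ F y ∧ 1 < ‖F y - w₀‖ :=
    eventually_nhdsWithin_iff.1 (hF.eventually_analyticAt.and hlarge)
  refine ⟨V ∩ {y | y ≠ z₀ → AnalyticAt ℂ F y ∧ 1 < ‖F y - w₀‖}, inter_mem hV hU,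
    Set.inter_subset_left, ?_⟩
  filter_upwards [Metric.ball_mem_nhds w₀ one_pos] with w hw
  refine ⟨{z₀}, by simp [mem_of_mem_nhds hV], fun y hy hyS => ?_, by simp [hord w], fun h0 => ?_⟩
  · obtain ⟨h1, h2⟩ := hy.2 (by simpa using hyS)
    refine meromorphicOrderAt_untop₀_eq_zero EventuallyEq.rfl (h1.sub analyticAt_const) ?_
    intro h3
    rw [sub_eq_zero.1 h3] at h2
    exact lt_asymm h2 (by simpa [dist_eq_norm] using hw)
  · rcases WithTop.untop₀_eq_zero.1 h0 with h1 | h1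
    · exact absurd h1 h.ne
    · exact absurd h1 h.ne_top

theorem conservesMultiplicity_of_order_zero {g : ℂ → ℂ} (hg : AnalyticAt ℂ g z₀) (hg0 : g z₀ ≠ 0)
    (h : ∀ᶠ z in 𝓝[≠] z₀, F z - w₀ = g z) :
    ConservesMultiplicity (fun w y => (meromorphicOrderAt (fun z => F z - w) y).untop₀) w₀ z₀ := by
  intro V hV
  have h1 : ∀ᶠ y in 𝓝 z₀, ‖g z₀‖ / 2 < ‖g y‖ :=
    hg.continuousAt.norm.eventually (lt_mem_nhds (half_lt_self (norm_pos_iff.2 hg0)))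
  refine ⟨_, inter_mem hV (inter_mem (inter_mem hg.eventually_analyticAt h1)
    (eventually_nhds_of_nhdsNE h)), Set.inter_subset_left, ?_⟩
  filter_upwards [Metric.ball_mem_nhds w₀ (half_pos (norm_pos_iff.2 hg0))] with w hw
  refine ⟨∅, by simp, fun y hy _ => ?_, ?_, fun _ => rfl⟩
  · obtain ⟨-, ⟨h2, h3⟩, h4⟩ := hy
    refine meromorphicOrderAt_untop₀_eq_zero (g := fun z => g z - (w - w₀)) ?_
      (AnalyticAt.sub h2 analyticAt_const) ?_
    · filter_upwards [h4] with z hz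
      rw [← hz]
      ring
    · intro h5
      rw [Set.mem_ofPred, sub_eq_zero.1 h5] at h3
      exact lt_asymm h3 (by simpa [dist_eq_norm] using hw)
  · exact (meromorphicOrderAt_untop₀_eq_zero h hg hg0).symm

/-- Near a `w₀`-point of order `k` the function is `w₀ + ρ ^ k` for a local coordinate `ρ`, and
`ρ ^ k = w - w₀` has `k` solutions. -/
theorem conservesMultiplicity_of_order_pos {g : ℂ → ℂ} (hg : AnalyticAt ℂ g z₀) (hg0 : g z₀ ≠ 0)
    {k : ℕ} (hk : k ≠ 0) (h : ∀ᶠ z in 𝓝[≠] z₀, F z - w₀ = (z - z₀) ^ k * g z) :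
    ConservesMultiplicity (fun w y => (meromorphicOrderAt (fun z => F z - w) y).untop₀) w₀ z₀ := by
  intro V hV
  obtain ⟨ρ₁, hρ₁, hρ₁0, hpow⟩ := hg.exists_pow_eq hg0 hk
  let ρ : ℂ → ℂ := fun z => (z - z₀) * ρ₁ z
  have hρ : AnalyticAt ℂ ρ z₀ := (analyticAt_id.sub analyticAt_const).mul hρ₁
  have hρ0 : ρ z₀ = 0 := by simp [ρ]
  have hρd : HasDerivAt ρ (ρ₁ z₀) z₀ := by
    simpa using! ((hasDerivAt_id z₀).sub_const z₀).mul hρ₁.differentiableAt.hasDerivAt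
  obtain ⟨o, ho, hz₀⟩ : ∃ o : OpenPartialHomeomorph ℂ ℂ, (∀ z, o z = ρ z) ∧ z₀ ∈ o.source :=
    ⟨ContDiffAt.toOpenPartialHomeomorph (n := ω) ρ (a := z₀) hρ.contDiffAt
      (f' := ContinuousLinearEquiv.unitsEquivAut ℂ (Units.mk0 _ hρ₁0)) hρd.hasFDerivAt (by simp),
      fun _ => rfl, ContDiffAt.mem_toOpenPartialHomeomorph_source _ _ _⟩
  have hderiv : ∀ᶠ y in 𝓝 z₀, deriv ρ y ≠ 0 :=
    hρ.deriv.continuousAt.eventually_ne (by rwa [hρd.deriv])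
  let W : Set ℂ := {y | y ∈ V ∧ AnalyticAt ℂ ρ y ∧ deriv ρ y ≠ 0 ∧
    ∀ᶠ z in 𝓝[≠] y, F z - w₀ = (z - z₀) ^ k * g z}
  have hW : W ∈ 𝓝 z₀ := by
    filter_upwards [hV, hρ.eventually_analyticAt, hderiv, eventually_nhds_of_nhdsNE h]
      with y h1 h2 h3 h4 using ⟨h1, h2, h3, h4⟩
  have ho₀ : o z₀ = 0 := (ho z₀).trans hρ0
  obtain ⟨r, hr, hball⟩ : ∃ r > 0, Metric.ball 0 r ⊆ o.target ∩ o.symm ⁻¹' W := by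
    refine Metric.mem_nhds_iff.1 (inter_mem (o.open_target.mem_nhds ?_)
      ((o.continuousAt_symm ?_).preimage_mem_nhds ?_))
    · rw [← ho₀]; exact o.map_source hz₀
    · rw [← ho₀]; exact o.map_source hz₀
    · rwa [← ho₀, o.left_inv hz₀]
  have hUW : ∀ y ∈ o.source ∩ o ⁻¹' Metric.ball 0 r, y ∈ W := by
    intro y hy
    have := (hball hy.2).2
    rwa [Set.mem_preimage, o.left_inv hy.1] at this
  -- in the coordinate `ρ` the order of `F - w` is the multiplicity of a root of `T ^ k - (w - w₀)`
  have hord : ∀ w, ∀ y ∈ W, (meromorphicOrderAt (fun z => F z - w) y).untop₀ =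
      ((X ^ k - C (w - w₀) : ℂ[X]).rootMultiplicity (ρ y) : ℤ) := by
    intro w y hy
    have hp : (X ^ k - C (w - w₀) : ℂ[X]) ≠ 0 := X_pow_sub_C_ne_zero (Nat.pos_of_ne_zero hk) _
    have h1 : (fun z => F z - w) =ᶠ[𝓝[≠] y]
        (fun t => (X ^ k - C (w - w₀) : ℂ[X]).eval t) ∘ ρ := by
      filter_upwards [hy.2.2.2] with z hz
      have h2 : F z = w₀ + (z - z₀) ^ k * g z := by rw [← hz]; ring
      simp only [Function.comp_apply, eval_sub, eval_pow, eval_X, eval_C, ρ, mul_pow, hpow, h2]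
      ring
    rw [meromorphicOrderAt_congr h1,
      meromorphicOrderAt_comp_of_deriv_ne_zero hy.2.1 hy.2.2.1, meromorphicOrderAt_eval hp]
    rfl
  refine ⟨o.source ∩ o ⁻¹' Metric.ball 0 r, ?_, fun y hy => (hUW y hy).1, ?_⟩
  · refine inter_mem (o.open_source.mem_nhds hz₀) ((o.continuousAt hz₀).preimage_mem_nhds ?_)
    rw [ho₀]
    exact Metric.ball_mem_nhds _ hr
  have hm : (meromorphicOrderAt (fun z => F z - w₀) z₀).untop₀ = k := by
    rw [hord w₀ z₀ (mem_of_mem_nhds hW), hρ0]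
    simpa using rootMultiplicity_X_sub_C_pow (0 : ℂ) k
  filter_upwards [Metric.ball_mem_nhds w₀ (pow_pos hr k)] with w hw
  set p : ℂ[X] := X ^ k - C (w - w₀) with hp
  have hp0 : p ≠ 0 := X_pow_sub_C_ne_zero (Nat.pos_of_ne_zero hk) _
  have hroot : ∀ ζ ∈ p.roots.toFinset, ζ ∈ Metric.ball (0 : ℂ) r := by
    intro ζ hζ
    have h1 : ζ ^ k = w - w₀ := by
      simpa [hp, sub_eq_zero] using (mem_roots hp0).1 (Multiset.mem_toFinset.1 hζ)
    have h2 : ‖ζ‖ ^ k < r ^ k := by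
      rw [← norm_pow, h1]
      simpa [dist_eq_norm] using hw
    simpa using lt_of_pow_lt_pow_left₀ k hr.le h2
  have hsymm : ∀ ζ ∈ p.roots.toFinset, ρ (o.symm ζ) = ζ := fun ζ hζ => by
    rw [← ho, o.right_inv (hball (hroot ζ hζ)).1]
  refine ⟨p.roots.toFinset.image o.symm, ?_, ?_, ?_, ?_⟩
  · intro y hy
    obtain ⟨ζ, hζ, rfl⟩ := Finset.mem_image.1 (Finset.mem_coe.1 hy)
    refine ⟨o.map_target (hball (hroot ζ hζ)).1, ?_⟩
    rw [Set.mem_preimage, ho, hsymm ζ hζ]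
    exact hroot ζ hζ
  · intro y hy hyS
    have h1 : ¬ p.IsRoot (ρ y) := by
      intro h2
      refine hyS (Finset.mem_image.2 ⟨ρ y, Multiset.mem_toFinset.2 ((mem_roots hp0).2 h2), ?_⟩)
      rw [← ho, o.left_inv hy.1]
    rw [hord w y (hUW y hy), ← hp, rootMultiplicity_eq_zero h1]
    rfl
  · rw [hm, Finset.sum_image fun ζ hζ ζ' hζ' hh => by rw [← hsymm ζ hζ, hh, hsymm ζ' hζ']]
    have h1 : ∀ ζ ∈ p.roots.toFinset,
        (meromorphicOrderAt (fun z => F z - w) (o.symm ζ)).untop₀ = (p.roots.count ζ : ℤ) := by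
      intro ζ hζ
      rw [hord w _ (hball (hroot ζ hζ)).2, hsymm ζ hζ, count_roots]
    rw [Finset.sum_congr rfl h1, ← Nat.cast_sum, Multiset.toFinset_sum_count_eq,
      IsAlgClosed.card_roots_eq_natDegree, hp, natDegree_X_pow_sub_C]
  · intro h0
    exact absurd (hm.symm.trans h0) (by exact_mod_cast hk)

theorem MeromorphicAt.conservesMultiplicity (hF : MeromorphicAt F z₀) (w₀ : ℂ) :
    ConservesMultiplicity (fun w y => (meromorphicOrderAt (fun z => F z - w) y).untop₀) w₀ z₀ := by
  have hF' : MeromorphicAt (fun z => F z - w₀) z₀ := hF.sub analyticAt_const.meromorphicAt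
  cases hm : meromorphicOrderAt (fun z => F z - w₀) z₀ with
  | top =>
    exact conservesMultiplicity_of_eventually_eq
      ((meromorphicOrderAt_eq_top_iff.1 hm).mono fun z hz => sub_eq_zero.1 hz)
  | coe m =>
    obtain ⟨g, hg, hg0, h⟩ := (meromorphicOrderAt_eq_int_iff hF').1 hm
    rcases lt_trichotomy m 0 with h0 | rfl | h0
    · exact conservesMultiplicity_of_order_neg hF (by rw [hm]; exact_mod_cast h0)
    · exact conservesMultiplicity_of_order_zero hg hg0 (by simpa using h)
    · obtain ⟨k, rfl⟩ := Int.eq_ofNat_of_zero_le h0.le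
      exact conservesMultiplicity_of_order_pos hg hg0 (k := k) (by omega) (by simpa using h)

end Planar

/-! ### The degree of a divisor of a meromorphic function -/

/-- Divisors on a compact space that conserve multiplicity locally have locally constant degree. -/
theorem finite_support_and_eventually_finsum_eq {W Y : Type*} [TopologicalSpace W]
    [TopologicalSpace Y] [CompactSpace Y] [T2Space Y] {O : W → Y → ℤ} {w₀ : W}
    (hO : ∀ y, ConservesMultiplicity O w₀ y) :
    (O w₀).support.Finite ∧
      ∀ᶠ w in 𝓝 w₀, (O w).support.Finite ∧ ∑ᶠ y, O w y = ∑ᶠ y, O w₀ y := by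
  classical
  have hfin : (O w₀).support.Finite := by
    choose U hU _ hS using fun y => hO y Set.univ univ_mem
    choose S hS using fun y => (hS y).self_of_nhds
    obtain ⟨t, ht⟩ := finite_cover_nhds hU
    refine (t.biUnion S).finite_toSet.subset fun y hy => ?_
    obtain ⟨x, hx, hyx⟩ := Set.mem_iUnion₂.1 (ht.ge (Set.mem_univ y))
    by_contra h
    refine hy ((hS x).2.1 y hyx fun h1 => h ?_)
    exact Finset.mem_coe.2 (Finset.mem_biUnion.2 ⟨x, hx, h1⟩)
  refine ⟨hfin, ?_⟩
  obtain ⟨V, hV, hdisj⟩ := hfin.t2_separation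
  have hVn : ∀ y, V y ∈ 𝓝 y := fun y => (hV y).2.mem_nhds (hV y).1
  choose U hU hUV hS using fun y => hO y (V y) (hVn y)
  obtain ⟨t, ht⟩ := finite_cover_nhds hU
  have hev : ∀ᶠ w in 𝓝 w₀, ∀ y ∈ t ∪ hfin.toFinset, ∃ S : Finset Y, ↑S ⊆ U y ∧
      (∀ x ∈ U y, x ∉ S → O w x = 0) ∧ ∑ x ∈ S, O w x = O w₀ y ∧ (O w₀ y = 0 → S = ∅) :=
    (Finset.eventually_all _).2 fun y _ => hS y
  filter_upwards [hev] with w hw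
  choose! S hSU hS0 hSsum hSemp using hw
  have hsupp : (O w).support ⊆ hfin.toFinset.biUnion S := by
    intro y hy
    obtain ⟨x, hx, hyx⟩ := Set.mem_iUnion₂.1 (ht.ge (Set.mem_univ y))
    have hx' : x ∈ t ∪ hfin.toFinset := Finset.mem_union_left _ hx
    have hyS : y ∈ S x := by
      by_contra h
      exact hy (hS0 x hx' y hyx h)
    refine Finset.mem_coe.2 (Finset.mem_biUnion.2 ⟨x, ?_, hyS⟩)
    refine hfin.mem_toFinset.2 fun h => ?_
    rw [hSemp x hx' h] at hyS
    exact Finset.notMem_empty _ hyS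
  refine ⟨(Finset.finite_toSet _).subset hsupp, ?_⟩
  rw [finsum_eq_sum_of_support_subset _ hsupp, Finset.sum_biUnion,
    finsum_eq_sum_of_support_subset (O w₀) (s := hfin.toFinset) (by simp)]
  · exact Finset.sum_congr rfl fun y hy => hSsum y (Finset.mem_union_right _ hy)
  · intro x hx y hy hxy
    refine Finset.disjoint_left.2 fun z hz hz' => ?_
    have h1 := hUV x (hSU x (Finset.mem_union_right _ hx) hz)
    have h2 := hUV y (hSU y (Finset.mem_union_right _ hy) hz')
    exact Set.disjoint_left.1 (hdisj (by simpa using hx) (by simpa using hy) hxy) h1 h2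

section RiemannSurface

variable {X : Type*} [TopologicalSpace X] [ChartedSpace ℂ X]

/-- The order of a meromorphic function on a Riemann surface, with the value `0` where the function
vanishes identically. -/
noncomputable def chartOrder (f : X → ℂ) (x : X) : ℤ :=
  (meromorphicOrderAt (inChart f x) (chartAt ℂ x x)).untop₀

variable [IsManifold 𝓘(ℂ) ω X]

theorem analyticAt_chart_transition {x y : X} {z : ℂ} (hz : z ∈ (chartAt ℂ x).target)
    (hzy : (chartAt ℂ x).symm z ∈ (chartAt ℂ y).source) :
    AnalyticAt ℂ (chartAt ℂ y ∘ (chartAt ℂ x).symm) z := by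
  have h := (contDiffGroupoid ω 𝓘(ℂ)).compatible (chart_mem_atlas ℂ x) (chart_mem_atlas ℂ y)
  rw [contDiffGroupoid, mem_groupoid_of_pregroupoid] at h
  have h1 := h.1
  simp only [contDiffPregroupoid, mfld_simps] at h1
  refine (h1.contDiffAt ?_).analyticAt
  refine inter_mem ((chartAt ℂ x).open_target.mem_nhds hz) 
    (((chartAt ℂ x).continuousAt_symm hz).preimage_mem_nhds
      ((chartAt ℂ y).open_source.mem_nhds hzy))

/-- The order of a function at a point can be computed in any chart. -/
theorem meromorphicOrderAt_inChart (f : X → ℂ) {x y : X} (hy : y ∈ (chartAt ℂ x).source) :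
    meromorphicOrderAt (inChart f y) (chartAt ℂ y y) =
      meromorphicOrderAt (inChart f x) (chartAt ℂ x y) := by
  have hyy := mem_chart_source ℂ y
  have hyt := (chartAt ℂ y).map_source hyy
  have hyt' := (chartAt ℂ x).map_source hy
  set τ := chartAt ℂ x ∘ (chartAt ℂ y).symm with hτdef
  set τ' := chartAt ℂ y ∘ (chartAt ℂ x).symm with hτdef'
  have hτ : AnalyticAt ℂ τ (chartAt ℂ y y) :=
    analyticAt_chart_transition hyt (by rwa [(chartAt ℂ y).left_inv hyy])
  have hτy : τ (chartAt ℂ y y) = chartAt ℂ x y := by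
    simp [hτdef, (chartAt ℂ y).left_inv hyy]
  have hτ' : AnalyticAt ℂ τ' (τ (chartAt ℂ y y)) := by
    rw [hτy]
    exact analyticAt_chart_transition hyt' (by rwa [(chartAt ℂ x).left_inv hy])
  have hnhds : ∀ᶠ z in 𝓝 (chartAt ℂ y y), z ∈ (chartAt ℂ y).target ∧
      (chartAt ℂ y).symm z ∈ (chartAt ℂ x).source :=
    inter_mem ((chartAt ℂ y).open_target.mem_nhds hyt)
      (((chartAt ℂ y).continuousAt_symm hyt).preimage_mem_nhds
        ((chartAt ℂ x).open_source.mem_nhds (by rwa [(chartAt ℂ y).left_inv hyy])))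
  have hinv : τ' ∘ τ =ᶠ[𝓝 (chartAt ℂ y y)] id := by
    filter_upwards [hnhds] with z hz
    simp [hτdef, hτdef', (chartAt ℂ x).left_inv hz.2, (chartAt ℂ y).right_inv hz.1]
  have hd : deriv τ (chartAt ℂ y y) ≠ 0 := by
    intro h0
    have h1 := hinv.deriv_eq
    rw [deriv_comp _ hτ'.differentiableAt hτ.differentiableAt, h0, mul_zero, deriv_id] at h1
    exact zero_ne_one h1
  have hcomp : inChart f y =ᶠ[𝓝 (chartAt ℂ y y)] inChart f x ∘ τ := by
    filter_upwards [hnhds] with z hz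
    simp [inChart, hτdef, (chartAt ℂ x).left_inv hz.2]
  rw [meromorphicOrderAt_congr (hcomp.filter_mono nhdsWithin_le_nhds),
    meromorphicOrderAt_comp_of_deriv_ne_zero hτ hd, hτy]

theorem conservesMultiplicity_chartOrder {f : X → ℂ} {x : X}
    (hf : MeromorphicAt (inChart f x) (chartAt ℂ x x)) (w₀ : ℂ) :
    ConservesMultiplicity (fun w => chartOrder (fun y => f y - w)) w₀ x := by
  classical
  intro V hV
  have hx := mem_chart_source ℂ x
  have hxt := (chartAt ℂ x).map_source hx
  have hord : ∀ w, ∀ y ∈ (chartAt ℂ x).source, chartOrder (fun y => f y - w) y =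
      (meromorphicOrderAt (fun z => inChart f x z - w) (chartAt ℂ x y)).untop₀ := by
    intro w y hy
    rw [chartOrder, meromorphicOrderAt_inChart _ hy]
    rfl
  obtain ⟨U, hU, hUV, hS⟩ := hf.conservesMultiplicity w₀
    ((chartAt ℂ x).target ∩ (chartAt ℂ x).symm ⁻¹' V)
    (inter_mem ((chartAt ℂ x).open_target.mem_nhds hxt)
      (((chartAt ℂ x).continuousAt_symm hxt).preimage_mem_nhds (by
        rwa [(chartAt ℂ x).left_inv hx])))
  refine ⟨(chartAt ℂ x).source ∩ chartAt ℂ x ⁻¹' U,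
    inter_mem ((chartAt ℂ x).open_source.mem_nhds hx)
      (((chartAt ℂ x).continuousAt hx).preimage_mem_nhds hU), fun y hy => ?_, ?_⟩
  · have := (hUV hy.2).2
    rwa [Set.mem_preimage, (chartAt ℂ x).left_inv hy.1] at this
  filter_upwards [hS] with w hw
  obtain ⟨S, hSU, hS0, hsum, hemp⟩ := hw
  have hSt : ∀ z ∈ S, z ∈ (chartAt ℂ x).target := fun z hz => (hUV (hSU hz)).1
  refine ⟨S.image (chartAt ℂ x).symm, ?_, ?_, ?_, ?_⟩
  · intro y hy
    obtain ⟨z, hz, rfl⟩ := Finset.mem_image.1 (Finset.mem_coe.1 hy)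
    refine ⟨(chartAt ℂ x).map_target (hSt z hz), ?_⟩
    rw [Set.mem_preimage, (chartAt ℂ x).right_inv (hSt z hz)]
    exact hSU hz
  · intro y hy hyS
    rw [hord w y hy.1]
    refine hS0 _ hy.2 fun h => hyS (Finset.mem_image.2 ⟨_, h, (chartAt ℂ x).left_inv hy.1⟩)
  · rw [hord w₀ x hx, ← hsum, Finset.sum_image fun z hz z' hz' h =>
      (chartAt ℂ x).symm.injOn (hSt z hz) (hSt z' hz') h]
    refine Finset.sum_congr rfl fun z hz => ?_
    rw [hord w _ ((chartAt ℂ x).map_target (hSt z hz)), (chartAt ℂ x).right_inv (hSt z hz)]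
  · intro h0
    rw [hord w₀ x hx] at h0
    rw [hemp h0, Finset.image_empty]

variable [T2Space X] [CompactSpace X]

theorem finite_support_chartOrder {f : X → ℂ}
    (hf : ∀ x, MeromorphicAt (inChart f x) (chartAt ℂ x x)) :
    (chartOrder f).support.Finite := by
  have h := (finite_support_and_eventually_finsum_eq
    fun x => conservesMultiplicity_chartOrder (hf x) 0).1
  simpa using h

/-- A meromorphic function on a compact Riemann surface takes all finite values equally often, when
its poles are counted negatively. -/
theorem finsum_chartOrder_sub_eq {f : X → ℂ}
    (hf : ∀ x, MeromorphicAt (inChart f x) (chartAt ℂ x x)) (w w' : ℂ) :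
    ∑ᶠ x, chartOrder (fun y => f y - w) x = ∑ᶠ x, chartOrder (fun y => f y - w') x := by
  have h : IsLocallyConstant fun w => ∑ᶠ x, chartOrder (fun y => f y - w) x := by
    refine (IsLocallyConstant.iff_eventually_eq _).2 fun w₀ => ?_
    exact (finite_support_and_eventually_finsum_eq
      fun x => conservesMultiplicity_chartOrder (hf x) w₀).2.mono fun w hw => hw.2
  exact h.apply_eq_of_isPreconnected isPreconnected_univ trivial trivial

/-- The divisor of a meromorphic function on a compact Riemann surface has degree zero: the degrees of
`div (f - w)` and of `div (1 / f - w)` do not depend on `w`, and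
`div (1 / f - 1) = div (f - 1) - div f`. -/
theorem finsum_chartOrder_eq_zero {f : X → ℂ}
    (hf : ∀ x, MeromorphicAt (inChart f x) (chartAt ℂ x x))
    (hf0 : ∀ x, meromorphicOrderAt (inChart f x) (chartAt ℂ x x) ≠ ⊤) :
    ∑ᶠ x, chartOrder f x = 0 := by
  have hinv : ∀ x, MeromorphicAt (inChart (fun y => (f y)⁻¹) x) (chartAt ℂ x x) := fun x =>
    (hf x).inv
  have hord : ∀ x, chartOrder (fun y => (f y)⁻¹) x = - chartOrder f x := by
    intro x
    have h1 : inChart (fun y => (f y)⁻¹) x = (inChart f x)⁻¹ := rfl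
    rw [chartOrder, chartOrder, h1, meromorphicOrderAt_inv]
    exact WithTop.untop₀_neg _
  have hsub : ∀ x, chartOrder (fun y => (f y)⁻¹ - 1) x =
      chartOrder (fun y => f y - 1) x - chartOrder f x := by
    intro x
    have hg : MeromorphicAt (inChart (fun y => f y - 1) x) (chartAt ℂ x x) :=
      (hf x).sub analyticAt_const.meromorphicAt
    have hne := (meromorphicOrderAt_ne_top_iff_eventually_ne_zero (hf x)).1 (hf0 x)
    have h1 : inChart (fun y => (f y)⁻¹ - 1) x =ᶠ[𝓝[≠] (chartAt ℂ x x)]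
        (fun _ => (-1 : ℂ)) * (inChart (fun y => f y - 1) x * (inChart f x)⁻¹) := by
      filter_upwards [hne] with z hz
      simp only [inChart, Function.comp_apply, Pi.mul_apply, Pi.inv_apply] at hz ⊢
      field_simp
      ring
    have h2 : meromorphicOrderAt (inChart (fun y => (f y)⁻¹ - 1) x) (chartAt ℂ x x) =
        meromorphicOrderAt (inChart (fun y => f y - 1) x) (chartAt ℂ x x) +
          -meromorphicOrderAt (inChart f x) (chartAt ℂ x x) := by
      rw [meromorphicOrderAt_congr h1,
        meromorphicOrderAt_mul_of_ne_zero analyticAt_const (by norm_num),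
        meromorphicOrderAt_mul hg (hf x).inv, meromorphicOrderAt_inv]
    rw [chartOrder, chartOrder, chartOrder, h2]
    by_cases htop : meromorphicOrderAt (inChart (fun y => f y - 1) x) (chartAt ℂ x x) = ⊤
    · -- where `f` is identically `1` its own order is zero
      have h3 : inChart f x =ᶠ[𝓝[≠] (chartAt ℂ x x)] fun _ => 1 := by
        filter_upwards [meromorphicOrderAt_eq_top_iff.1 htop] with z hz
        exact sub_eq_zero.1 hz
      have h4 := meromorphicOrderAt_untop₀_eq_zero h3 analyticAt_const one_ne_zero
      rw [htop, h4, top_add]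
      rfl
    · rw [WithTop.untop₀_add htop (by simpa using hf0 x), WithTop.untop₀_neg, sub_eq_add_neg]
  have h0 := finsum_chartOrder_sub_eq hf 0 1
  have h1 := finsum_chartOrder_sub_eq hinv 0 1
  have hsupp : (chartOrder fun y => f y - 1).support.Finite :=
    finite_support_chartOrder fun x => (hf x).sub analyticAt_const.meromorphicAt
  simp only [sub_zero] at h0 h1
  change ∑ᶠ x, chartOrder f x = _ at h0
  rw [finsum_congr hsub, finsum_congr hord, finsum_neg_distrib,
    finsum_sub_distrib hsupp (finite_support_chartOrder hf)] at h1
  omega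

end RiemannSurface

/-! ### Sections of powers of a line bundle of positive degree -/

section LineBundle

variable {X : Type*} [TopologicalSpace X] [ChartedSpace ℂ X]
  {M : X → Type*} [TopologicalSpace (TotalSpace ℂ M)] [∀ x, TopologicalSpace (M x)]
  [∀ x, AddCommGroup (M x)] [∀ x, Module ℂ (M x)] [FiberBundle ℂ M] [VectorBundle ℂ ℂ M]

/-- If `b` is a nowhere vanishing section of `M ^ k` and `s` a meromorphic section of `M`, then
`s ^ k / b` is a meromorphic function whose divisor is `k` times that of `s`. -/
theorem lineBundleDegree_eq_zero [T2Space X] [CompactSpace X] [IsManifold 𝓘(ℂ) ω X] {k : ℕ}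
    (hk : k ≠ 0) (b : holSections M k) (hb : ∀ x, (b : ∀ x, ⨂[ℂ]^k (M x)) x ≠ 0) :
    lineBundleDegree M = 0 := by
  by_cases h : ∃ s : ∀ x, M x, IsNonzeroMeromorphicSection M s
  swap
  · -- without meromorphic sections the degree is zero by convention
    exact dif_neg h
  rw [lineBundleDegree, dif_pos h]
  -- the degree is computed with the section chosen in its definition
  obtain ⟨s, hs⟩ : ∃ s, s = h.choose := ⟨_, rfl⟩
  have hsec : IsNonzeroMeromorphicSection M s := hs ▸ h.choose_spec
  rw [← hs]
  -- `s ^ k / b`, computed at each point in its own preferred trivialization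
  let f : X → ℂ := fun y =>
    fibreCoord M y ⟨y, s y⟩ ^ k * (powCoord M y k y ((b : ∀ x, ⨂[ℂ]^k (M x)) y))⁻¹
  have hquot : ∀ x y, y ∈ (trivializationAt ℂ M x).baseSet → f y =
      fibreCoord M x ⟨y, s y⟩ ^ k * (powCoord M x k y ((b : ∀ x, ⨂[ℂ]^k (M x)) y))⁻¹ := by
    intro x y hy
    obtain ⟨c, hc, h1, h2⟩ := exists_coordChange (M := M) (mem_baseSet_trivializationAt ℂ M y) hy
    simp only [f]
    rw [h1, h2, mul_pow, mul_inv]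
    field_simp
  have hloc : ∀ x, inChart f x =ᶠ[𝓝[≠] (chartAt ℂ x x)]
      (inChart (fun y => fibreCoord M x ⟨y, s y⟩) x) ^ k *
        (inChart (fun y => powCoord M x k y ((b : ∀ x, ⨂[ℂ]^k (M x)) y)) x)⁻¹ := by
    intro x
    have h1 := ((chartAt ℂ x).eventually_nhds' (fun y => f y =
      fibreCoord M x ⟨y, s y⟩ ^ k * (powCoord M x k y ((b : ∀ x, ⨂[ℂ]^k (M x)) y))⁻¹)
      (mem_chart_source ℂ x)).2 (mem_of_superset
        ((trivializationAt ℂ M x).open_baseSet.mem_nhds (mem_baseSet_trivializationAt ℂ M x))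
        fun y hy => hquot x y hy)
    exact h1.filter_mono nhdsWithin_le_nhds
  have hban : ∀ x, AnalyticAt ℂ
      (inChart (fun y => powCoord M x k y ((b : ∀ x, ⨂[ℂ]^k (M x)) y)) x) (chartAt ℂ x x) :=
    fun x => (b.2 x).analyticAt_inChart
  have hb0 : ∀ x, meromorphicOrderAt
      (inChart (fun y => powCoord M x k y ((b : ∀ x, ⨂[ℂ]^k (M x)) y)) x) (chartAt ℂ x x) = 0 := by
    intro x
    rw [(hban x).meromorphicOrderAt_eq, (hban x).analyticOrderAt_eq_zero.2]
    · rfl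
    · rw [inChart, Function.comp_apply, (chartAt ℂ x).left_inv (mem_chart_source ℂ x)]
      exact fun h0 => hb x ((powCoord_eq_zero_iff (mem_baseSet_trivializationAt ℂ M x)).1 h0)
  have hord : ∀ x, meromorphicOrderAt (inChart f x) (chartAt ℂ x x) = k * sectionOrder M s x := by
    intro x
    rw [meromorphicOrderAt_congr (hloc x), meromorphicOrderAt_mul ((hsec x).1.pow k)
      (hban x).meromorphicAt.inv, meromorphicOrderAt_inv, hb0, meromorphicOrderAt_pow (hsec x).1]
    simp [sectionOrder]
  have h1 : ∑ᶠ x, chartOrder f x = 0 := by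
    refine finsum_chartOrder_eq_zero (fun x => ?_) fun x => ?_
    · refine MeromorphicAt.congr ?_ (hloc x).symm
      exact ((hsec x).1.pow k).mul (hban x).meromorphicAt.inv
    · rw [hord]
      exact WithTop.mul_ne_top (by simp) (hsec x).2
  have h2 : ∀ x, chartOrder f x = (k : ℤ) • (sectionOrder M s x).untop₀ := by
    intro x
    rw [chartOrder, hord, WithTop.untop₀_mul]
    rfl
  rw [finsum_congr h2, ← smul_finsum] at h1
  exact (smul_eq_zero.1 h1).resolve_left (by exact_mod_cast hk)

/-- Identity theorem for sections of `M ^ k`. -/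
theorem holSections_eq_zero_of_eventually [PreconnectedSpace X] {k : ℕ} (b : holSections M k)
    {x₀ : X} (h : ∀ᶠ y in 𝓝 x₀, (b : ∀ x, ⨂[ℂ]^k (M x)) y = 0) : b = 0 := by
  let Z : Set X := {x | ∀ᶠ y in 𝓝 x, (b : ∀ x, ⨂[ℂ]^k (M x)) y = 0}
  have hopen : IsOpen Z := isOpen_iff_mem_nhds.2 fun x hx => eventually_eventually_nhds.2 hx
  have hclosed : IsClosed Z := by
    refine ⟨isOpen_iff_mem_nhds.2 fun x hx => ?_⟩
    have hcoord : ∀ᶠ y in 𝓝 x, powCoord M x k y ((b : ∀ x, ⨂[ℂ]^k (M x)) y) = 0 ↔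
        (b : ∀ x, ⨂[ℂ]^k (M x)) y = 0 := by
      filter_upwards [(trivializationAt ℂ M x).open_baseSet.mem_nhds
        (mem_baseSet_trivializationAt ℂ M x)] with y hy using powCoord_eq_zero_iff hy
    have hxs := mem_chart_source ℂ x
    rcases ((b.2 x).analyticAt_inChart).eventually_eq_zero_or_eventually_ne_zero with h0 | h0
    · refine absurd ?_ hx
      have h1 := ((chartAt ℂ x).eventually_nhds' (fun y => powCoord M x k y
        ((b : ∀ x, ⨂[ℂ]^k (M x)) y) = 0) hxs).1 h0
      filter_upwards [h1, hcoord] with y hy hy' using hy'.1 hy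
    · rw [eventually_nhdsWithin_iff] at h0
      have h1 := ((chartAt ℂ x).continuousAt hxs).eventually h0
      filter_upwards [h1, hcoord, (chartAt ℂ x).open_source.mem_nhds hxs] with y hy hy' hys
      by_cases hyx : y = x
      · rwa [hyx]
      · intro hyZ
        have hne : chartAt ℂ x y ≠ chartAt ℂ x x := fun h => hyx ((chartAt ℂ x).injOn hys hxs h)
        have h2 := hy hne
        rw [inChart, Function.comp_apply, (chartAt ℂ x).left_inv hys] at h2
        exact h2 (hy'.2 hyZ.self_of_nhds)
  have huniv : Z = Set.univ := IsClopen.eq_univ ⟨hclosed, hopen⟩ ⟨x₀, h⟩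
  refine Subtype.ext (funext fun x => ?_)
  have hx : x ∈ Z := huniv ▸ Set.mem_univ x
  exact hx.self_of_nhds

theorem coeff_quotPoly {n : ℕ} (c : Fin n → ℂ) (j : Fin n) :
    (quotPoly c).coeff (n - ((j : ℕ) + 1)) = c j := by
  have hj := j.2
  rw [quotPoly, coeff_add, coeff_X_pow, if_neg (by omega), finsetSum_coeff, zero_add,
    Finset.sum_eq_single j]
  · simp
  · intro i _ hij
    have hi := i.2
    have : n - ((j : ℕ) + 1) ≠ n - ((i : ℕ) + 1) := fun h => hij (Fin.ext (by omega))
    rw [coeff_C_mul_X_pow, if_neg this]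
  · simp

variable [T2Space X] [CompactSpace X] [ConnectedSpace X] [IsManifold 𝓘(ℂ) ω X]
  [ContMDiffVectorBundle ω ℂ M 𝓘(ℂ)]

/-- On a curve of `sl(2)`-type `a_{2n}` is not identically zero: otherwise `Σ/σ` would contain the
zero section, smoothness along it would make `a_{2n-2}` nowhere zero, and `M` would have degree
zero. -/
theorem IsSl2Type.not_eventually_quotientEq_eq_zero (hdeg : 0 < lineBundleDegree M) {n : ℕ}
    (hn : 1 ≤ n) {a : HitchinBase M n} (ha : IsSl2Type a) (hne : 2 ≤ n ∨ a ≠ 0) (x : X) :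
    ¬ ∀ᶠ z in 𝓝 0, quotientEq a x 0 (z, 0) = 0 := by
  intro h
  obtain ⟨m, rfl⟩ : ∃ m, n = m + 1 := ⟨n - 1, by omega⟩
  have heval : ∀ c : Fin (m + 1) → ℂ, (quotPoly c).eval 0 = c (Fin.last m) := by
    intro c
    simpa [coeff_zero_eq_eval_zero] using coeff_quotPoly c (Fin.last m)
  have hq : ∀ y z, quotientEq a y 0 (z, 0) =
      localCoeff a y ((chartAt ℂ y).symm (z + chartAt ℂ y y)) (Fin.last m) := by
    intro y z
    rw [quotientEq, zero_add, heval]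
  have hlast : a (Fin.last m) = 0 := by
    have hxs := mem_chart_source ℂ x
    refine holSections_eq_zero_of_eventually (x₀ := x) _ ?_
    have hsub : Tendsto (fun y => chartAt ℂ x y - chartAt ℂ x x) (𝓝 x) (𝓝 0) := by
      simpa using ((chartAt ℂ x).continuousAt hxs).tendsto.sub_const (chartAt ℂ x x)
    filter_upwards [hsub.eventually h, (chartAt ℂ x).open_source.mem_nhds hxs,
      (trivializationAt ℂ M x).open_baseSet.mem_nhds (mem_baseSet_trivializationAt ℂ M x)]
      with y hy hys hyb
    rw [hq, sub_add_cancel, (chartAt ℂ x).left_inv hys] at hy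
    exact (powCoord_eq_zero_iff hyb).1 hy
  rcases Nat.eq_zero_or_pos m with rfl | hm
  · refine hne.elim (by omega) fun h0 => h0 (funext fun j => ?_)
    rw [show j = Fin.last 0 from Fin.ext (by simp), hlast]
    rfl
  -- `i` is the index of `a_{2n-2}`
  obtain ⟨i, hi⟩ : ∃ i : Fin (m + 1), (i : ℕ) + 1 = m := ⟨⟨m - 1, by omega⟩, by simp; omega⟩
  have hnowhere : ∀ y, (a i : ∀ x, ⨂[ℂ]^(2 * ((i : ℕ) + 1)) (M x)) y ≠ 0 := by
    intro y hy
    have hzero : ∀ z, quotientEq a y 0 (z, 0) = 0 := by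
      intro z
      rw [hq, localCoeff, hlast]
      exact map_zero _
    have hcoord : fibreCoord M y (⟨y, 0⟩ : TotalSpace ℂ M) ^ 2 = 0 := by
      rw [fibreCoord_zero_section rfl, zero_pow two_ne_zero]
    refine (isSl2Type_iff a).1 ha ⟨y, 0⟩ ?_ ?_
    · rw [mem_spectralCurve_iff, hcoord]
      exact hzero 0
    · rw [hcoord]
      have h1 : fderiv ℂ (quotientEq a y 0) 0 (1, 0) = 0 := by
        have h2 : (fun z => (quotPoly (localCoeff a y ((chartAt ℂ y).symm z))).eval 0) =
            fun _ => 0 := by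
          funext z
          have := hzero (z - chartAt ℂ y y)
          rwa [hq, sub_add_cancel, ← heval (localCoeff a y _)] at this
        rw [fderiv_quotientEq_fst, h2, deriv_const]
      have h2 : fderiv ℂ (quotientEq a y 0) 0 (0, 1) = 0 := by
        have h3 := coeff_quotPoly (localCoeff a y y) i
        rw [hi, Nat.add_sub_cancel_left] at h3
        rw [fderiv_quotientEq_snd, ← coeff_zero_eq_eval_zero, coeff_derivative, zero_add, h3,
          localCoeff, hy, map_zero, zero_mul]
      refine ContinuousLinearMap.ext fun w => ?_
      have h3 : w = w.1 • ((1 : ℂ), (0 : ℂ)) + w.2 • ((0 : ℂ), (1 : ℂ)) := by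
        ext <;> simp
      rw [h3, map_add, map_smul, map_smul, h1, h2]
      simp
  exact hdeg.ne' (lineBundleDegree_eq_zero (by omega) (a i) hnowhere)

end LineBundle

theorem mainTheorem12 {X : Type*} [TopologicalSpace X] [T2Space X] [CompactSpace X]
    [ConnectedSpace X] [ChartedSpace ℂ X] [IsManifold 𝓘(ℂ) ω X]
    (M : X → Type*) [TopologicalSpace (TotalSpace ℂ M)] [∀ x, TopologicalSpace (M x)]
    [∀ x, AddCommGroup (M x)] [∀ x, Module ℂ (M x)] [FiberBundle ℂ M] [VectorBundle ℂ ℂ M]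
    [ContMDiffVectorBundle ω ℂ M 𝓘(ℂ)] (hdeg : 0 < lineBundleDegree M)
    (n : ℕ) (hn : 1 ≤ n) (a : HitchinBase M n) :
    (IsSl2Type a ↔ ∀ p, IsSingularPoint a p → p.2 = 0 ∧ sheetNumber a p = 2) ∧
    (IsSl2Type a → (2 ≤ n ∨ a ≠ 0) →
      ∀ p, IsSingularPoint a p → ∃ k, 1 ≤ k ∧ IsTypeA a k p) ∧
    (RedDiscSimpleZeros a → (∀ x, ¬ (CoeffVanishesAt a (n - 1) x ∧ CoeffVanishesAt a n x)) →
      IsSl2Type a) :=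
  ⟨isSl2Type_iff_isSingularPoint a,
    fun ha hne p hp => ha.exists_isTypeA hp
      (ha.not_eventually_quotientEq_eq_zero hdeg hn hne p.1),
    fun ha _ => ha.isSl2Type hn⟩
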